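/- Let $A\in\mathbb{R}^{n\times n}$, $B\in\mathbb{R}^{n\times m}$ and suppose that the plant $[A|B]$, $\dot x=Ax+Bu$, is stabilizable, i.e. $A+BF$ is stable (all its eigenvalues have negative real part) for some $F\in\mathbb{R}^{m\times n}$. Let $l\ge m$, and let $P_i>0$ and $N_i>0$, $i=1,\dots,l$, be the admissible input powers and the noise power spectral densities of $l$ AWGN subchannels, with capacities $\mathfrak{C}_i=\frac12\frac{P_i}{N_i}$. The network is $v=Fx$, $q=Tv$, $p=q+d$, $u=Rp$, where $d$ is white Gaussian noise with power spectral density $N=\mathrm{diag}\{N_1,\dots,N_l\}$. With the closed-loop transfer function from $d$ to $q$, $$\boldsymbol{T}(s)=TF(sI-A-BRTF)^{-1}BR,$$ the steady-state power of the channel input $q_i$ of a stable closed loop is $$\mathbf{E}[q_i^2]=\frac1{2\pi}\int_{-\infty}^{\infty}\{\boldsymbol{T}(j\omega)N\boldsymbol{T}(j\omega)^*\}_{ii}\,d\omega .$$ Say that $[A|B]$ is stabilizable via MIMO communication over the AWGN subchannels if there exist a feedback gain $F\in\mathbb{R}^{m\times n}$, an encoder $T\in\mathbb{R}^{l\times m}$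 and a decoder $R\in\mathbb{R}^{m\times l}$ with $RT=I$ such that the closed-loop matrix $A+BRTF=A+BF$ is stable and $\mathbf{E}[q_i^2]<P_i$ for $i=1,\dots,l$. A cyclic decomposition of $A$ is a similarity transformation of $A$ to $\mathrm{diag}\{A_1,\dots,A_k\}$, where every $A_i$ is a nonempty square real matrix that is cyclic (the degree of its minimal polynomial $\alpha_i$ equals its size), $\alpha_1$ is the minimal polynomial of $A$, and $\alpha_{i+1}\mid\alpha_i$ for $1\le i<k$. For a square real matrix $M$ let $H(M)$ be the sum of its eigenvalues with positive real part, counted with algebraic multiplicity. For $x,y\in\mathbb{R}^l$ write $x\prec^w y$ ($x$ is strictly weakly majorized by $y$ from above) if, for every $j=1,\dots,l$, the sum of the $j$ smallest entries of $x$ is strictly greater than the sum of the $j$ smallest entries of $y$. Then $A$ has a cyclic decomposition, and for every cyclic decomposition of $A$, with diagonal blocks $A_1,\dots,A_k$: $[A|B]$ is stabilizable via MIMO communication over the AWGN subchannels if and only if $$(\mathfrak{C}_1,\dots,\mathfrak{C}_l)\prec^w(H(A_1),\dots,H(A_k),0,\dots,0),$$ where the right-hand vector has length $l$ (if $k>l$,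 only its first $l$ entries $H(A_1),\dots,H(A_l)$ are kept; the omitted ones are $0$). -/

import Mathlib

namespace NCS

/-- A real square matrix is (Hurwitz) stable if all its complex eigenvalues have negative
real part. -/
def IsHurwitz {ι : Type} [Fintype ι] [DecidableEq ι] (A : Matrix ι ι ℝ) : Prop :=
  ∀ z ∈ spectrum ℂ (A.map Complex.ofReal), z.re < 0

/-- The plant `x' = A x + B u` is stabilizable by an ideal state feedback `u = F x`. -/
def IsStabilizable {n m : ℕ} (A : Matrix (Fin n) (Fin n) ℝ) (B : Matrix (Fin n) (Fin m) ℝ) :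
    Prop :=
  ∃ F : Matrix (Fin m) (Fin n) ℝ, IsHurwitz (A + B * F)

/-- The topological entropy of `x' = A x`: the sum of the eigenvalues of `A` in the open right
half plane, counted with algebraic multiplicity. Since `A` is real, nonreal eigenvalues come in
conjugate pairs and the sum equals the sum of the real parts. -/
noncomputable def topEntropy {ι : Type} [Fintype ι] [DecidableEq ι] (A : Matrix ι ι ℝ) : ℝ :=
  (((A.map Complex.ofReal).charpoly.roots.filter (fun z : ℂ => 0 < z.re)).map Complex.re).sum

/-- A square matrix is cyclic if the degree of its minimal polynomial equals its size. -/
def IsCyclicMatrix {ι : Type} [Fintype ι] [DecidableEq ι] (A : Matrix ι ι ℝ) : Prop :=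
  (minpoly ℝ A).natDegree = Fintype.card ι

/-- A cyclic decomposition of `A`: a nonsingular `S` such that `S⁻¹ A S` is block diagonal with
nonempty cyclic diagonal blocks, the minimal polynomial of the first block being the minimal
polynomial of `A` and that of each block dividing that of the preceding one. -/
structure CyclicDecomposition {n : ℕ} (A : Matrix (Fin n) (Fin n) ℝ) where
  /-- the number of blocks -/
  k : ℕ
  /-- the sizes of the blocks -/
  dim : Fin k → ℕ
  dim_pos : ∀ i, 0 < dim i
  /-- the diagonal blocks -/
  block : ∀ i, Matrix (Fin (dim i)) (Fin (dim i)) ℝ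
  /-- the state space transformation -/
  S : Matrix (Fin n) (Σ i, Fin (dim i)) ℝ
  /-- its inverse -/
  Sinv : Matrix (Σ i, Fin (dim i)) (Fin n) ℝ
  S_mul_Sinv : S * Sinv = 1
  Sinv_mul_S : Sinv * S = 1
  conj_eq : Sinv * A * S = Matrix.blockDiagonal' block
  cyclic : ∀ i, IsCyclicMatrix (block i)
  minpoly_first : ∀ h : 0 < k, minpoly ℝ (block ⟨0, h⟩) = minpoly ℝ A
  minpoly_dvd : ∀ (i : ℕ) (h : i + 1 < k),
    minpoly ℝ (block ⟨i + 1, h⟩) ∣ minpoly ℝ (block ⟨i, i.lt_succ_self.trans h⟩)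

/-- The vector `(H(A₁), …, H(A_k), 0, …, 0)` of length `l` of the topological entropies of the
blocks, padded with zeros. (If `k > l` only the first `l` entries are kept.) -/
noncomputable def CyclicDecomposition.entropyVector {n : ℕ} {A : Matrix (Fin n) (Fin n) ℝ}
    (D : CyclicDecomposition A) (l : ℕ) : Fin l → ℝ :=
  fun i => if h : (i : ℕ) < D.k then topEntropy (D.block ⟨i, h⟩) else 0

/-- `x` is strictly weakly majorized by `y` from above: for every `j`, the sum of the `j` smallest
entries of `x` is strictly larger than the sum of the `j` smallest entries of `y`. The function
`x ∘ Tuple.sort x` is the nondecreasing rearrangement of `x`. -/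
def StrictWeakMajorizedAbove {l : ℕ} (x y : Fin l → ℝ) : Prop :=
  ∀ j : Fin l, ∑ i ∈ Finset.Iic j, y (Tuple.sort y i) < ∑ i ∈ Finset.Iic j, x (Tuple.sort x i)

/-- The capacity of an AWGN channel with admissible input power `P i` and noise power spectral
density `N i`. -/
noncomputable def capacity {l : ℕ} (P N : Fin l → ℝ) (i : Fin l) : ℝ :=
  1 / 2 * (P i / N i)

section ClosedLoop

variable {n m l : ℕ} (A : Matrix (Fin n) (Fin n) ℝ) (B : Matrix (Fin n) (Fin m) ℝ)
  (F : Matrix (Fin m) (Fin n) ℝ) (T : Matrix (Fin l) (Fin m) ℝ) (R : Matrix (Fin m) (Fin l) ℝ)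

/-- The state matrix of the closed loop `x' = A x + B u`, `u = R p`, `p = q + d`, `q = T v`,
`v = F x`. -/
def closedLoop : Matrix (Fin n) (Fin n) ℝ :=
  A + B * R * T * F

/-- The complementary sensitivity function, the closed-loop transfer function from `d` to `q`:
`T F (s I - A - B R T F)⁻¹ B R`. -/
noncomputable def compSensitivity (s : ℂ) : Matrix (Fin l) (Fin l) ℂ :=
  (T * F).map Complex.ofReal *
    (s • (1 : Matrix (Fin n) (Fin n) ℂ) - (closedLoop A B F T R).map Complex.ofReal)⁻¹ *
    (B * R).map Complex.ofReal

/-- The power spectral density of the `i`-th channel input `q i` in steady state, when `d` is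
white with power spectral density `diag N`: the `i`-th diagonal entry of
`𝐓(jω) diag(N) 𝐓(jω)^*` (a real number). -/
noncomputable def inputPSD (N : Fin l → ℝ) (i : Fin l) (ω : ℝ) : ℝ :=
  ((compSensitivity A B F T R (Complex.I * ω) *
    Matrix.diagonal (fun j => (N j : ℂ)) *
    (compSensitivity A B F T R (Complex.I * ω)).conjTranspose) i i).re

/-- The steady-state power `E[q i ^ 2]` of the `i`-th channel input: `1 / 2π` times the integral
of its power spectral density. It is used only for stable closed loops, where the integral
converges. -/
noncomputable def inputPower (N : Fin l → ℝ) (i : Fin l) : ℝ :=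
  1 / (2 * Real.pi) * ∫ ω : ℝ, inputPSD A B F T R N i ω

end ClosedLoop

/-- `[A|B]` is stabilizable via MIMO communication over `l` AWGN subchannels with noise power
spectral densities `N` and admissible input powers `P`: some feedback gain `F`, encoder `T` and
decoder `R` with `R T = I` make the closed loop stable and satisfy all power constraints. -/
def StabilizableOverAWGN {n m l : ℕ} (A : Matrix (Fin n) (Fin n) ℝ)
    (B : Matrix (Fin n) (Fin m) ℝ) (P N : Fin l → ℝ) : Prop :=
  ∃ (F : Matrix (Fin m) (Fin n) ℝ) (T : Matrix (Fin l) (Fin m) ℝ) (R : Matrix (Fin m) (Fin l) ℝ),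
    R * T = 1 ∧ IsHurwitz (closedLoop A B F T R) ∧ ∀ i, inputPower A B F T R N i < P i

end NCS

namespace NCS

open Matrix Polynomial

/-! For a stable loop, Parseval's identity gives the power of `q i` as `(T F X Fᵀ Tᵀ) i i`, where
`X` is the Gramian of the closed loop driven by the channel noise, the solution of a Lyapunov
equation (`inputPower_eq`).

Necessity. Fix a nonempty set `J` of channels. Feedback through the other channels is counted as
part of the plant, a perturbation of `A` of rank at most `l - |J|`, and dropping their noise turns
the Lyapunov equation into an inequality. What is left is a stabilizing feedback through `J`, and
its noise-normalized power is at least twice the entropy of the perturbed plant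
(`two_mul_topEntropy_le_trace`). A perturbation of rank `r` cannot remove the entropy of the blocks
after the first `r`: expanding the determinant by rows shows that the product of their
characteristic polynomials divides that of the perturbed matrix (`prod_det_dvd_det_add_mul`). Over
all `J` these bounds are the majorization (`strictWeakMajorizedAbove_iff`).

Sufficiency. Stable modes are free, and the antistable part is controllable. A generic input
direction generates its first cyclic block; a change of state coordinates frees the other blocks
from this input, and the argument is repeated. The result is a triangular chain of single-input
systems whose couplings can be scaled away, each controllable with power close to twice its trace. A
strict Riccati inequality with `Bᵀ X⁻¹ B < diag h` and `h i` close to `2 H(A i)` records this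
(`CyclicDecomposition.inputRiccatiFeasible`). By a form of the Schur–Horn theorem
(`exists_orthogonal_diag_le`), the majorization provides an orthogonal matrix that redistributes
these demands below the budgets `P i / N i`; it serves as the encoder.

A cyclic decomposition exists because a vector whose annihilator is the minimal polynomial spans a
cyclic subspace with an invariant complement (`exists_cyclic_splitting`). -/

/-! ### Entropy as a root sum of the characteristic polynomial. -/

theorem charpoly_map_ofReal {ι : Type} [Fintype ι] [DecidableEq ι] (A : Matrix ι ι ℝ) :
    (A.map Complex.ofReal).charpoly = A.charpoly.map Complex.ofRealHom :=
  Matrix.charpoly_map A Complex.ofRealHom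

/-- The sum of the real parts of the complex roots of `p` in the open right half plane. -/
noncomputable def rightRootSum (p : ℝ[X]) : ℝ :=
  (((p.map Complex.ofRealHom).roots.filter (fun z : ℂ => 0 < z.re)).map Complex.re).sum

theorem topEntropy_eq {ι : Type} [Fintype ι] [DecidableEq ι] (A : Matrix ι ι ℝ) :
    topEntropy A = rightRootSum A.charpoly := by
  rw [topEntropy, charpoly_map_ofReal, rightRootSum]

theorem rightRootSum_mul {p q : ℝ[X]} (hp : p ≠ 0) (hq : q ≠ 0) :
    rightRootSum (p * q) = rightRootSum p + rightRootSum q := by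
  have h : (p.map Complex.ofRealHom) * (q.map Complex.ofRealHom) ≠ 0 :=
    mul_ne_zero ((Polynomial.map_ne_zero_iff Complex.ofRealHom.injective).2 hp)
      ((Polynomial.map_ne_zero_iff Complex.ofRealHom.injective).2 hq)
  simp [rightRootSum, Polynomial.map_mul, Polynomial.roots_mul h]

theorem rightRootSum_one : rightRootSum 1 = 0 := by
  simp [rightRootSum]

theorem rightRootSum_nonneg (p : ℝ[X]) : 0 ≤ rightRootSum p := by
  refine Multiset.sum_nonneg fun x hx => ?_
  obtain ⟨z, hz, rfl⟩ := Multiset.mem_map.1 hx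
  exact (Multiset.mem_filter.1 hz).2.le

theorem rightRootSum_le_of_dvd {p q : ℝ[X]} (hq : q ≠ 0) (h : p ∣ q) :
    rightRootSum p ≤ rightRootSum q := by
  obtain ⟨r, rfl⟩ := h
  rw [rightRootSum_mul (left_ne_zero_of_mul hq) (right_ne_zero_of_mul hq)]
  linarith [rightRootSum_nonneg r]

theorem rightRootSum_prod {ι : Type} (s : Finset ι) (p : ι → ℝ[X]) (hp : ∀ i ∈ s, p i ≠ 0) :
    rightRootSum (∏ i ∈ s, p i) = ∑ i ∈ s, rightRootSum (p i) := by
  classical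
  induction s using Finset.induction_on with
  | empty => simp [rightRootSum_one]
  | insert a s ha ih =>
    rw [Finset.prod_insert ha, Finset.sum_insert ha, rightRootSum_mul (hp _ (by simp)), ih]
    · exact fun i hi => hp i (by simp [hi])
    · exact Finset.prod_ne_zero_iff.2 fun i hi => hp i (by simp [hi])

theorem rightRootSum_eq_zero {p : ℝ[X]}
    (h : ∀ z : ℂ, (p.map Complex.ofRealHom).IsRoot z → z.re ≤ 0) : rightRootSum p = 0 := by
  rw [rightRootSum, Multiset.filter_eq_nil.2]
  · simp
  · intro z hz
    exact not_lt.2 (h z (Polynomial.isRoot_of_mem_roots hz))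

/-- Imaginary roots contribute zero real part, so discarding them does not change the sum of real
parts, which is the trace. -/
theorem rightRootSum_eq_trace {ι : Type} [Fintype ι] [DecidableEq ι] (A : Matrix ι ι ℝ)
    (h : ∀ z : ℂ, (A.charpoly.map Complex.ofRealHom).IsRoot z → 0 ≤ z.re) :
    rightRootSum A.charpoly = A.trace := by
  have h1 : ((A.map Complex.ofReal).trace).re = A.trace := by
    simp [Matrix.trace]
  rw [← h1, Matrix.trace_eq_sum_roots_charpoly, charpoly_map_ofReal, rightRootSum]
  have key : ∀ s : Multiset ℂ, (∀ z ∈ s, 0 ≤ z.re) →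
      ((s.filter (fun z : ℂ => 0 < z.re)).map Complex.re).sum = s.sum.re := by
    intro s
    induction s using Multiset.induction_on with
    | empty => simp
    | cons a s ih =>
      intro hs
      have ih' := ih fun z hz => hs z (Multiset.mem_cons_of_mem hz)
      by_cases ha : 0 < a.re
      · rw [Multiset.filter_cons_of_pos (p := fun z : ℂ => 0 < z.re) _ ha]; simp [ih']
      · rw [Multiset.filter_cons_of_neg (p := fun z : ℂ => 0 < z.re) _ ha]
        have : a.re = 0 := le_antisymm (not_lt.1 ha) (hs a (Multiset.mem_cons_self a s))
        simp [ih', this]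
  exact key _ fun z hz => h z (Polynomial.isRoot_of_mem_roots hz)

theorem isHurwitz_iff_charpoly {ι : Type} [Fintype ι] [DecidableEq ι] (A : Matrix ι ι ℝ) :
    IsHurwitz A ↔ ∀ z : ℂ, (A.charpoly.map Complex.ofRealHom).IsRoot z → z.re < 0 := by
  simp only [IsHurwitz, Matrix.mem_spectrum_iff_isRoot_charpoly, charpoly_map_ofReal]

theorem topEntropy_eq_zero {ι : Type} [Fintype ι] [DecidableEq ι] {A : Matrix ι ι ℝ}
    (h : IsHurwitz A) : topEntropy A = 0 := by
  rw [topEntropy_eq]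
  exact rightRootSum_eq_zero fun z hz => ((isHurwitz_iff_charpoly A).1 h z hz).le

theorem topEntropy_nonneg {ι : Type} [Fintype ι] [DecidableEq ι] (A : Matrix ι ι ℝ) :
    0 ≤ topEntropy A := by
  rw [topEntropy_eq]; exact rightRootSum_nonneg _

theorem map_aeval {ι : Type} [Fintype ι] [DecidableEq ι] (A : Matrix ι ι ℝ) (p : ℝ[X]) :
    (aeval A p).map Complex.ofReal =
      aeval (A.map Complex.ofReal) (p.map Complex.ofRealHom) := by
  have : (Complex.ofRealHom.mapMatrix : Matrix ι ι ℝ →+* Matrix ι ι ℂ) (aeval A p) =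
      aeval (Complex.ofRealHom.mapMatrix A) (p.map Complex.ofRealHom) := by
    rw [aeval_def, aeval_def, hom_eval₂, eval₂_map]
    congr 1
    ext r i j
    by_cases h : i = j <;>
      simp [Matrix.algebraMap_matrix_apply, h]
  exact this

theorem isRoot_of_isRoot_charpoly {ι : Type} [Fintype ι] [DecidableEq ι] {A : Matrix ι ι ℝ}
    {p : ℝ[X]} (hp : aeval A p = 0) {z : ℂ} (hz : (A.charpoly.map Complex.ofRealHom).IsRoot z) :
    (p.map Complex.ofRealHom).IsRoot z := by
  rw [← charpoly_map_ofReal, ← Matrix.mem_spectrum_iff_isRoot_charpoly] at hz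
  cases isEmpty_or_nonempty ι
  · rw [Matrix.mem_spectrum_iff_isRoot_charpoly] at hz; simp [Matrix.charpoly, IsRoot] at hz
  have h := spectrum.subset_polynomial_aeval (A.map Complex.ofReal) (p.map Complex.ofRealHom)
    ⟨z, hz, rfl⟩
  rw [← map_aeval, hp] at h
  simpa using h

theorem isCoprime_of_roots {p q : ℝ[X]}
    (h : ∀ z : ℂ, (p.map Complex.ofRealHom).IsRoot z → (q.map Complex.ofRealHom).IsRoot z → False) :
    IsCoprime p q := by
  rw [Polynomial.isCoprime_iff_aeval_ne_zero_of_isAlgClosed ℝ ℂ]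
  intro z
  by_contra! hz
  refine h z ?_ ?_
  · rw [IsRoot, eval_map]; exact hz.1
  · rw [IsRoot, eval_map]; exact hz.2

/-- The two index types differ, so the commutation formula for rectangular factors is used; its
powers of `X` agree because the types have equal cardinality. -/
theorem charpoly_similar {ι κ : Type} [Fintype ι] [DecidableEq ι] [Fintype κ] [DecidableEq κ]
    (A : Matrix ι ι ℝ) (S : Matrix ι κ ℝ) (S' : Matrix κ ι ℝ) (h : S * S' = 1) (h' : S' * S = 1) :
    (S' * A * S).charpoly = A.charpoly := by
  have e : Fintype.card ι = Fintype.card κ := Matrix.square_of_invertible S S' h h'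
  have h1 := Matrix.charpoly_mul_comm' (S' * A) S
  rw [e, ← Matrix.mul_assoc, h, Matrix.one_mul] at h1
  exact mul_left_cancel₀ (pow_ne_zero _ X_ne_zero) h1

theorem aeval_similar {ι κ : Type} [Fintype ι] [DecidableEq ι] [Fintype κ] [DecidableEq κ]
    {A : Matrix ι ι ℝ} {A' : Matrix κ κ ℝ} {S : Matrix ι κ ℝ} (h : A * S = S * A') (p : ℝ[X]) :
    aeval A p * S = S * aeval A' p := by
  induction p using Polynomial.induction_on' with
  | add p q hp hq => simp [Matrix.add_mul, Matrix.mul_add, hp, hq]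
  | monomial n a =>
    have : A ^ n * S = S * A' ^ n := by
      induction n with
      | zero => simp
      | succ n ih => rw [pow_succ, pow_succ, Matrix.mul_assoc, h, ← Matrix.mul_assoc, ih,
          Matrix.mul_assoc]
    simp only [aeval_monomial, Algebra.algebraMap_eq_smul_one, Matrix.smul_mul, Matrix.mul_smul,
      Matrix.one_mul, this]

theorem charpoly_eq_minpoly {ι : Type} [Fintype ι] [DecidableEq ι] {A : Matrix ι ι ℝ}
    (h : IsCyclicMatrix A) : A.charpoly = minpoly ℝ A := by
  refine (Polynomial.eq_of_monic_of_dvd_of_natDegree_le (minpoly.monic ?_) A.charpoly_monic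
    (Matrix.minpoly_dvd_charpoly A) ?_)
  · exact Algebra.IsIntegral.isIntegral A
  · rw [Matrix.charpoly_natDegree_eq_dim, h.symm]

/-! ### Contour integrals of the resolvent and Parseval's identity. -/

section ContourIntegral

open Filter Asymptotics Bornology Topology MeasureTheory Complex

/-- Cauchy's theorem on the rectangle `[0, T] × [-T, T]`: the other three sides have total length `4
T` and the integrand there is at most `C / T ^ 2`. -/
theorem integral_imaginary_axis_eq_zero {g : ℂ → ℂ}
    (hd : ∀ z : ℂ, 0 ≤ z.re → DifferentiableAt ℂ g z)
    (hO : g =O[cobounded ℂ] fun z => (‖z‖ ^ 2)⁻¹) :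
    Integrable (fun ω : ℝ => g (I * ω)) ∧ ∫ ω : ℝ, g (I * ω) = 0 := by
  obtain ⟨C, hC0, hC⟩ := hO.exists_pos
  rw [IsBigOWith] at hC
  obtain ⟨r, -, hr⟩ := (atTop_basis_Ioi.cobounded_of_norm (E := ℂ)).eventually_iff.1 hC
  have hbound : ∀ z : ℂ, max r 1 < ‖z‖ → ‖g z‖ ≤ C * (‖z‖ ^ 2)⁻¹ := by
    intro z hz
    have := hr (show z ∈ norm ⁻¹' Set.Ioi r from (le_max_left _ _).trans_lt hz)
    simpa using this
  have hcont : Continuous fun ω : ℝ => g (I * ω) := by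
    rw [continuous_iff_continuousAt]
    intro ω
    have h1 : ContinuousAt g (I * ω) := (hd _ (by simp)).continuousAt
    exact ContinuousAt.comp (f := fun ω : ℝ => I * (ω : ℂ)) h1 (by fun_prop)
  have hint : Integrable (fun ω : ℝ => g (I * ω)) := by
    refine (hcont.locallyIntegrable).integrable_of_isBigO_cocompact
      (g := fun ω : ℝ => (1 + ω ^ 2)⁻¹) ?_ (integrable_inv_one_add_sq.integrableAtFilter _)
    refine IsBigO.of_bound (2 * C) ?_
    rw [← Metric.cobounded_eq_cocompact]
    refine ((atTop_basis_Ioi.cobounded_of_norm (E := ℝ)).eventually_iff).2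
      ⟨max r 1, trivial, fun ω hω => ?_⟩
    have hω' : max r 1 < |ω| := hω
    have h1 : (1 : ℝ) < |ω| := (le_max_right _ _).trans_lt hω'
    have hn : ‖I * (ω : ℂ)‖ = |ω| := by simp
    have h2 := hbound (I * ω) (by rw [hn]; exact hω')
    rw [hn] at h2
    refine h2.trans ?_
    rw [Real.norm_of_nonneg (by positivity), sq_abs, mul_comm 2 C, mul_assoc]
    have hω2 : 1 < ω ^ 2 := by rw [← sq_abs]; nlinarith
    refine mul_le_mul_of_nonneg_left ?_ hC0.le
    rw [← div_eq_mul_inv, inv_eq_one_div, div_le_div_iff₀ (by linarith) (by linarith)]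
    linarith
  refine ⟨hint, ?_⟩
  have ht := intervalIntegral_tendsto_integral hint tendsto_neg_atTop_atBot tendsto_id
  refine tendsto_nhds_unique ht ?_
  have hb : ∀ᶠ T : ℝ in atTop, ‖∫ ω in (-T)..(id T), g (I * ω)‖ ≤ 4 * C * T⁻¹ := by
    filter_upwards [eventually_gt_atTop (max r 1)] with T hT
    have hT1 : 1 < T := (le_max_right _ _).trans_lt hT
    have hrect := Complex.integral_boundary_rect_eq_zero_of_differentiableOn g (⟨0, -T⟩) (⟨T, T⟩) (by
      intro z hz
      refine (hd z ?_).differentiableWithinAt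
      have := hz.1
      simp only [Set.mem_preimage] at this
      rw [Set.uIcc_of_le (by linarith)] at this
      exact this.1)
    simp only at hrect
    have hb1 : ∀ z : ℂ, T ≤ ‖z‖ → ‖g z‖ ≤ C * (T ^ 2)⁻¹ := by
      intro z hz
      refine (hbound z (hT.trans_le hz)).trans (mul_le_mul_of_nonneg_left ?_ hC0.le)
      exact inv_anti₀ (by positivity) (by gcongr)
    have e1 : ‖∫ x : ℝ in (0 : ℝ)..T, g (x + (-T : ℝ) * I)‖ ≤ C * (T ^ 2)⁻¹ * |T - 0| := by
      refine intervalIntegral.norm_integral_le_of_norm_le_const fun x _ => hb1 _ ?_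
      calc T = |((x : ℂ) + (-T : ℝ) * I).im| := by simp [abs_of_pos (by linarith : 0 < T)]
        _ ≤ _ := Complex.abs_im_le_norm _
    have e2 : ‖∫ x : ℝ in (0 : ℝ)..T, g (x + (T : ℝ) * I)‖ ≤ C * (T ^ 2)⁻¹ * |T - 0| := by
      refine intervalIntegral.norm_integral_le_of_norm_le_const fun x _ => hb1 _ ?_
      calc T = |((x : ℂ) + (T : ℝ) * I).im| := by simp [abs_of_pos (by linarith : 0 < T)]
        _ ≤ _ := Complex.abs_im_le_norm _
    have e3 : ‖∫ y : ℝ in (-T)..T, g ((T : ℝ) + y * I)‖ ≤ C * (T ^ 2)⁻¹ * |T - -T| := by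
      refine intervalIntegral.norm_integral_le_of_norm_le_const fun x _ => hb1 _ ?_
      calc T = |((T : ℂ) + x * I).re| := by simp [abs_of_pos (by linarith : 0 < T)]
        _ ≤ _ := Complex.abs_re_le_norm _
    have e4 : I • (∫ ω in (-T)..(id T), g (I * ω)) =
        (∫ x : ℝ in (0 : ℝ)..T, g (x + (-T : ℝ) * I)) - (∫ x : ℝ in (0 : ℝ)..T, g (x + (T : ℝ) * I))
          + I • ∫ y : ℝ in (-T)..T, g ((T : ℝ) + y * I) := by
      rw [sub_eq_zero] at hrect
      rw [hrect]
      congr 2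
      ext y
      congr 1
      push_cast
      ring
    have e5 : ‖∫ ω in (-T)..(id T), g (I * ω)‖ = ‖I • (∫ ω in (-T)..(id T), g (I * ω))‖ := by
      simp
    rw [e5, e4]
    refine (norm_add_le _ _).trans ((add_le_add (norm_sub_le _ _) le_rfl).trans ?_)
    rw [norm_smul, Complex.norm_I, one_mul]
    refine (add_le_add (add_le_add e1 e2) e3).trans (le_of_eq ?_)
    rw [sub_neg_eq_add, sub_zero, abs_of_pos (by linarith), abs_of_pos (by linarith)]
    field_simp
    ring
  have hz : Tendsto (fun T : ℝ => 4 * C * T⁻¹) atTop (𝓝 0) := by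
    simpa using tendsto_inv_atTop_zero.const_mul (4 * C)
  exact squeeze_zero_norm' hb hz

theorem re_inv_one_add_I_mul (ω : ℝ) : ((1 + I * ω : ℂ)⁻¹).re = (1 + ω ^ 2)⁻¹ := by
  rw [Complex.inv_re]
  simp [Complex.normSq_apply]
  ring

attribute [local instance] Matrix.linftyOpNormedRing Matrix.linftyOpNormedAlgebra

/-- The resolvent decays only like `1 / |z|`. Subtracting `(1 + z)⁻¹` leaves `(z + 1)⁻¹ (z - M)⁻¹ (1
+ M)`, which is `O(|z|⁻²)` and holomorphic on the closed right half plane. -/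
theorem integral_functional_resolvent {ι : Type} [Fintype ι] [DecidableEq ι] {M : Matrix ι ι ℂ}
    (hM : ∀ z ∈ spectrum ℂ M, z.re < 0) (φ : Matrix ι ι ℂ →ₗ[ℂ] ℂ) :
    Integrable (fun ω : ℝ => φ ((I * ω) • (1 : Matrix ι ι ℂ) - M)⁻¹ - φ 1 * (1 + I * ω)⁻¹) ∧
      ∫ ω : ℝ, (φ ((I * ω) • (1 : Matrix ι ι ℂ) - M)⁻¹ - φ 1 * (1 + I * ω)⁻¹) = 0 := by
  let ψ : Matrix ι ι ℂ →L[ℂ] ℂ :=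
    LinearMap.toContinuousLinearMap (φ ∘ₗ LinearMap.mulRight ℂ (1 + M))
  let g : ℂ → ℂ := fun z => (z + 1)⁻¹ * ψ (resolvent M z)
  have hmem : ∀ z : ℂ, 0 ≤ z.re → z ∈ resolventSet ℂ M := by
    intro z hz
    by_contra h
    exact absurd (hM z h) (not_lt.2 hz)
  have hne : ∀ z : ℂ, 0 ≤ z.re → z + 1 ≠ 0 := by
    intro z hz h
    have := congrArg Complex.re h
    simp at this
    linarith
  have hd : ∀ z : ℂ, 0 ≤ z.re → DifferentiableAt ℂ g z := by
    intro z hz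
    refine DifferentiableAt.mul ?_ ?_
    · exact (differentiableAt_id.add_const 1).inv (hne z hz)
    · exact ψ.differentiableAt.comp z
        (spectrum.hasDerivAt_resolvent_const_left (hmem z hz)).differentiableAt
  have hO : g =O[cobounded ℂ] fun z => (‖z‖ ^ 2)⁻¹ := by
    have h1 : (fun z => ψ (resolvent M z)) =O[cobounded ℂ] fun z : ℂ => z⁻¹ :=
      (ψ.isBigO_comp _ _).trans (spectrum.resolvent_isBigO_inv M)
    have h2 : (fun z : ℂ => (z + 1)⁻¹) =O[cobounded ℂ] fun z : ℂ => z⁻¹ := by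
      refine IsBigO.of_bound 2 ?_
      refine ((atTop_basis_Ioi.cobounded_of_norm (E := ℂ)).eventually_iff).2
        ⟨2, trivial, fun z hz => ?_⟩
      have hz' : 2 < ‖z‖ := hz
      have h3 : ‖z‖ / 2 ≤ ‖z + 1‖ := by
        have := norm_sub_le (z + 1) 1
        simp at this
        linarith
      rw [norm_inv, norm_inv]
      calc ‖z + 1‖⁻¹ ≤ (‖z‖ / 2)⁻¹ := inv_anti₀ (by linarith) h3
        _ = 2 * ‖z‖⁻¹ := by rw [inv_div]; rfl
    refine (h2.mul h1).trans (IsBigO.of_bound 1 (Eventually.of_forall fun z => ?_))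
    simp [pow_two]
  have key : ∀ ω : ℝ, g (I * ω) =
      φ ((I * ω) • (1 : Matrix ι ι ℂ) - M)⁻¹ - φ 1 * (1 + I * ω)⁻¹ := by
    intro ω
    have hre : 0 ≤ (I * (ω : ℂ)).re := by simp
    have hu := hmem _ hre
    have hres : resolvent M (I * (ω : ℂ)) = ((I * ω) • (1 : Matrix ι ι ℂ) - M)⁻¹ := by
      rw [resolvent, Algebra.algebraMap_eq_smul_one, Matrix.nonsing_inv_eq_ringInverse]
    rw [spectrum.mem_resolventSet_iff, Algebra.algebraMap_eq_smul_one] at hu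
    set W := (I * (ω : ℂ)) • (1 : Matrix ι ι ℂ) - M with hW
    have hinv : W⁻¹ * W = 1 := Matrix.nonsing_inv_mul _ ((Matrix.isUnit_iff_isUnit_det _).1 hu)
    have h1 : W⁻¹ * (1 + M) = (I * (ω : ℂ) + 1) • W⁻¹ - 1 := by
      have : (1 + M) = (I * (ω : ℂ) + 1) • (1 : Matrix ι ι ℂ) - W := by
        rw [hW, add_smul, one_smul]; abel
      rw [this, Matrix.mul_sub, hinv, Matrix.mul_smul, Matrix.mul_one]
    have h2 : ψ W⁻¹ = φ (W⁻¹ * (1 + M)) := rfl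
    have h3 := hne _ hre
    simp only [g]
    rw [hres, h2, h1, map_sub, map_smul, smul_eq_mul, mul_sub, ← mul_assoc, inv_mul_cancel₀ h3,
      one_mul, add_comm (1 : ℂ), mul_comm (φ 1)]
  have := integral_imaginary_axis_eq_zero hd hO
  simpa only [key] using this

/-- Parseval's identity for the Lyapunov equation. -/
theorem integral_resolvent_quadratic {ι κ : Type} [Fintype ι] [DecidableEq ι]
    {M X Q : Matrix ι ι ℝ} (hM : IsHurwitz M) (hX : Xᵀ = X) (h : M * X + X * Mᵀ + Q = 0)
    (K : Matrix κ ι ℝ) (i : κ) :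
    ∫ ω : ℝ, ((K.map ofReal * ((I * ω) • (1 : Matrix ι ι ℂ) - M.map ofReal)⁻¹ * Q.map ofReal *
      (((I * ω) • (1 : Matrix ι ι ℂ) - M.map ofReal)⁻¹)ᴴ * (K.map ofReal)ᴴ) i i).re =
      2 * Real.pi * (K * X * Kᵀ) i i := by
  have hct : ∀ {α β : Type} (Y : Matrix α β ℝ), (Y.map ofReal)ᴴ = Yᵀ.map ofReal := by
    intro α β Y; ext a b; simp
  -- With `W = iω - M` the Lyapunov equation reads `Q = W X + X Wᴴ`. Hence `W⁻¹ Q (W⁻¹)ᴴ` is `W⁻¹ X`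
  -- plus its adjoint, and the integrand is `2 Re φ(W⁻¹)`.
  let φ : Matrix ι ι ℂ →ₗ[ℂ] ℂ :=
    { toFun := fun W => (K.map ofReal * W * X.map ofReal * (K.map ofReal)ᴴ) i i
      map_add' := fun V W => by simp [Matrix.mul_add, Matrix.add_mul]
      map_smul' := fun c W => by simp }
  obtain ⟨h1, h2⟩ := integral_functional_resolvent hM φ
  have hφ1 : φ 1 = ((K * X * Kᵀ) i i : ℝ) := by
    have : (K.map ofReal * (1 : Matrix ι ι ℂ) * X.map ofReal * (K.map ofReal)ᴴ) = (K * X * Kᵀ).map ofReal := by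
      rw [hct, Matrix.mul_one]
      change _ = (K * X * Kᵀ).map Complex.ofRealHom
      rw [Matrix.map_mul, Matrix.map_mul]; rfl
    change (K.map ofReal * (1 : Matrix ι ι ℂ) * X.map ofReal * (K.map ofReal)ᴴ) i i = _
    rw [this]; rfl
  have hQ : Q.map ofReal = -(M.map ofReal * X.map ofReal + X.map ofReal * (M.map ofReal)ᴴ) := by
    have : Q = -(M * X + X * Mᵀ) := by rw [eq_neg_iff_add_eq_zero, add_comm]; exact h
    rw [hct, this]
    ext a b
    simp [Matrix.mul_apply]
  have hXX : (X.map ofReal)ᴴ = X.map ofReal := by rw [hct, hX]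
  -- The first summand integrates to zero; the whole value comes from the real part `(1 + ω²)⁻¹` of
  -- the subtracted term, whose integral is `π`.
  have key : ∀ ω : ℝ,
      ((K.map ofReal * ((I * ω) • (1 : Matrix ι ι ℂ) - M.map ofReal)⁻¹ * Q.map ofReal *
      (((I * ω) • (1 : Matrix ι ι ℂ) - M.map ofReal)⁻¹)ᴴ * (K.map ofReal)ᴴ) i i).re =
      2 * (φ ((I * ω) • (1 : Matrix ι ι ℂ) - M.map ofReal)⁻¹ - φ 1 * (1 + I * ω)⁻¹).re +
        2 * (K * X * Kᵀ) i i * (1 + ω ^ 2)⁻¹ := by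
    intro ω
    set W := (I * (ω : ℂ)) • (1 : Matrix ι ι ℂ) - M.map ofReal with hW
    have hu : IsUnit W := by
      by_contra hcon
      have : (I * (ω : ℂ)) ∈ spectrum ℂ (M.map ofReal) := by
        rw [spectrum.mem_iff, Algebra.algebraMap_eq_smul_one]; exact hcon
      have := hM _ this
      simp at this
    have hWW : W⁻¹ * W = 1 := Matrix.nonsing_inv_mul _ ((Matrix.isUnit_iff_isUnit_det _).1 hu)
    have hWH : Wᴴ * (W⁻¹)ᴴ = 1 := by rw [← Matrix.conjTranspose_mul, hWW, conjTranspose_one]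
    have hWc : Wᴴ = -((I * (ω : ℂ)) • (1 : Matrix ι ι ℂ)) - (M.map ofReal)ᴴ := by
      rw [hW, conjTranspose_sub, conjTranspose_smul, conjTranspose_one]
      congr 1
      simp
    have hQ2 : Q.map ofReal = W * X.map ofReal + X.map ofReal * Wᴴ := by
      rw [hQ, hWc, hW]
      simp only [Matrix.sub_mul, Matrix.mul_sub, Matrix.smul_mul, Matrix.mul_smul, Matrix.one_mul,
        Matrix.mul_one, Matrix.mul_neg]
      abel
    have hsum : K.map ofReal * W⁻¹ * Q.map ofReal * (W⁻¹)ᴴ * (K.map ofReal)ᴴ =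
        (K.map ofReal * W⁻¹ * X.map ofReal * (K.map ofReal)ᴴ) +
        (K.map ofReal * W⁻¹ * X.map ofReal * (K.map ofReal)ᴴ)ᴴ := by
      have e1 : W⁻¹ * Q.map ofReal * (W⁻¹)ᴴ = X.map ofReal * (W⁻¹)ᴴ + W⁻¹ * X.map ofReal := by
        rw [hQ2, Matrix.mul_add, ← Matrix.mul_assoc, hWW, Matrix.one_mul, Matrix.add_mul,
          Matrix.mul_assoc, Matrix.mul_assoc, hWH, Matrix.mul_one]
      calc K.map ofReal * W⁻¹ * Q.map ofReal * (W⁻¹)ᴴ * (K.map ofReal)ᴴ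
          = K.map ofReal * (W⁻¹ * Q.map ofReal * (W⁻¹)ᴴ) * (K.map ofReal)ᴴ := by
            simp only [Matrix.mul_assoc]
        _ = _ := by
            rw [e1]
            simp only [Matrix.conjTranspose_mul, Matrix.conjTranspose_conjTranspose, hXX,
              Matrix.mul_add, Matrix.add_mul, Matrix.mul_assoc]
            exact add_comm _ _
    have hφW : φ W⁻¹ = (K.map ofReal * W⁻¹ * X.map ofReal * (K.map ofReal)ᴴ) i i := rfl
    rw [hsum, Matrix.add_apply, Matrix.conjTranspose_apply, ← hφW, hφ1, Complex.sub_re,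
      Complex.re_ofReal_mul, re_inv_one_add_I_mul]
    simp
    ring
  simp_rw [key]
  have i1 := h1.re.const_mul 2
  have i2 := integrable_inv_one_add_sq.const_mul (2 * (K * X * Kᵀ) i i)
  have i3 := integral_add i1 i2
  rw [show (∫ ω : ℝ, 2 * (φ ((I * ω) • (1 : Matrix ι ι ℂ) - M.map ofReal)⁻¹ -
    φ 1 * (1 + I * ω)⁻¹).re + 2 * (K * X * Kᵀ) i i * (1 + ω ^ 2)⁻¹) = _ from i3]
  rw [integral_const_mul, integral_const_mul, integral_univ_inv_one_add_sq]
  have : ∫ ω : ℝ, RCLike.re (φ ((I * ω) • (1 : Matrix ι ι ℂ) - M.map ofReal)⁻¹ -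
    φ 1 * (1 + I * ω)⁻¹) = 0 := by
    rw [integral_re h1, h2]; simp
  rw [this]
  ring

end ContourIntegral

/-! ### Square roots and quadratic forms of real positive matrices. -/

section MatrixOrder
open scoped MatrixOrder ComplexOrder

theorem exists_symm_mul_self {ι : Type} [Fintype ι] [DecidableEq ι] {X : Matrix ι ι ℝ}
    (hX : X.PosSemidef) : ∃ L : Matrix ι ι ℝ, Lᵀ = L ∧ L * L = X := by
  have h0 : 0 ≤ X := hX.nonneg
  refine ⟨CFC.sqrt X, ?_, CFC.sqrt_mul_sqrt_self X h0⟩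
  have : (CFC.sqrt X).PosSemidef := (CFC.sqrt_nonneg X).posSemidef
  simpa [IsHermitian, conjTranspose_eq_transpose_of_trivial] using this.1

end MatrixOrder

theorem posDef_iff_real {ι : Type} [Fintype ι] {X : Matrix ι ι ℝ} :
    X.PosDef ↔ Xᵀ = X ∧ ∀ v : ι → ℝ, v ≠ 0 → 0 < v ⬝ᵥ X *ᵥ v := by
  rw [posDef_iff_dotProduct_mulVec]
  simp [IsHermitian, conjTranspose_eq_transpose_of_trivial]

theorem posSemidef_iff_real {ι : Type} [Fintype ι] {X : Matrix ι ι ℝ} :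
    X.PosSemidef ↔ Xᵀ = X ∧ ∀ v : ι → ℝ, 0 ≤ v ⬝ᵥ X *ᵥ v := by
  rw [posSemidef_iff_dotProduct_mulVec]
  simp [IsHermitian, conjTranspose_eq_transpose_of_trivial]

/-! ### Lyapunov equations. -/

section Lyapunov
open scoped ComplexOrder
set_option linter.unusedSectionVars false

variable {ι : Type} [Fintype ι] [DecidableEq ι]

/-- `X` intertwines `M` and `-Mᵀ`, so `X χ(-Mᵀ) = χ(M) X = 0` for the characteristic polynomial `χ`
of `M`. Since `M` is Hurwitz, `χ(-x)` and `χ(x)` are coprime, which makes `χ(-Mᵀ)` invertible. -/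
theorem lyapunov_injective {M X : Matrix ι ι ℝ} (hM : IsHurwitz M) (h : M * X + X * Mᵀ = 0) :
    X = 0 := by
  have h1 : M * X = X * (-Mᵀ) := by rw [Matrix.mul_neg]; exact eq_neg_of_add_eq_zero_left h
  have h2 := aeval_similar h1 M.charpoly
  rw [Matrix.aeval_self_charpoly, Matrix.zero_mul] at h2
  have hroot := (isHurwitz_iff_charpoly M).1 hM
  obtain ⟨a, b, hab⟩ := isCoprime_of_roots (p := M.charpoly.comp (-Polynomial.X)) (q := M.charpoly) (by
    intro z hz hz'
    rw [IsRoot, Polynomial.map_comp, eval_comp] at hz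
    have h3 := hroot _ hz
    have h4 := hroot _ hz'
    simp at h3
    linarith)
  have h5 : aeval (-Mᵀ) M.charpoly = aeval Mᵀ (M.charpoly.comp (-Polynomial.X)) := by
    rw [aeval_comp]; simp
  have h6 := congrArg (aeval Mᵀ) hab
  have h7 : aeval Mᵀ M.charpoly = 0 := by
    rw [← Matrix.charpoly_transpose, Matrix.aeval_self_charpoly]
  rw [map_add, map_mul, map_mul, map_one, h7, mul_zero, add_zero, ← h5] at h6
  have hcomm : aeval Mᵀ a * aeval (-Mᵀ) M.charpoly = aeval (-Mᵀ) M.charpoly * aeval Mᵀ a := by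
    rw [h5, ← map_mul, mul_comm, map_mul]
  calc X = X * (aeval (-Mᵀ) M.charpoly * aeval Mᵀ a) := by rw [← hcomm, h6, Matrix.mul_one]
    _ = 0 := by rw [← Matrix.mul_assoc, ← h2, Matrix.zero_mul]

/-- Injectivity of the Lyapunov operator on a finite-dimensional space gives existence; uniqueness
applied to the transpose gives symmetry. -/
theorem exists_lyapunov {M Q : Matrix ι ι ℝ} (hM : IsHurwitz M) (hQ : Qᵀ = Q) :
    ∃ X : Matrix ι ι ℝ, Xᵀ = X ∧ M * X + X * Mᵀ + Q = 0 := by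
  let f : Matrix ι ι ℝ →ₗ[ℝ] Matrix ι ι ℝ :=
    LinearMap.mulLeft ℝ M + LinearMap.mulRight ℝ Mᵀ
  have hinj : Function.Injective f := by
    rw [← LinearMap.ker_eq_bot, LinearMap.ker_eq_bot']
    exact fun X hX => lyapunov_injective hM hX
  obtain ⟨X, hX⟩ := LinearMap.surjective_of_injective hinj (-Q)
  have hX' : M * X + X * Mᵀ = -Q := hX
  refine ⟨X, ?_, by rw [hX']; simp⟩
  have h1 : M * (Xᵀ - X) + (Xᵀ - X) * Mᵀ = 0 := by
    have h2 := congrArg Matrix.transpose hX'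
    simp only [transpose_add, transpose_mul, transpose_transpose, transpose_neg, hQ] at h2
    rw [Matrix.mul_sub, Matrix.sub_mul, sub_add_sub_comm, hX', add_comm (M * Xᵀ), h2, sub_self]
  exact sub_eq_zero.1 (lyapunov_injective hM h1)

theorem map_posSemidef {Q : Matrix ι ι ℝ} (hQ : Q.PosSemidef) :
    (Q.map Complex.ofReal).PosSemidef := by
  obtain ⟨L, hL, rfl⟩ := exists_symm_mul_self hQ
  have : (L * L).map Complex.ofReal = (L.map Complex.ofReal)ᴴ * L.map Complex.ofReal := by
    nth_rewrite 1 [← hL]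
    ext i j
    simp [Matrix.mul_apply]
  rw [this]
  exact posSemidef_conjTranspose_mul_self _

/-- By Parseval, `2π vᵀ X v` is the integral of a nonnegative function of frequency. -/
theorem posSemidef_of_lyapunov {M X Q : Matrix ι ι ℝ} (hM : IsHurwitz M) (hX : Xᵀ = X)
    (hQ : Q.PosSemidef) (h : M * X + X * Mᵀ + Q = 0) : X.PosSemidef := by
  rw [posSemidef_iff_real]
  refine ⟨hX, fun v => ?_⟩
  have h1 := integral_resolvent_quadratic hM hX h (replicateRow Unit v) ()
  have h2 : (replicateRow Unit v * X * (replicateRow Unit v)ᵀ) () () = v ⬝ᵥ X *ᵥ v := by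
    rw [Matrix.mul_assoc]
    simp [Matrix.mul_apply, dotProduct, mulVec]
  rw [h2] at h1
  have h3 : 0 ≤ 2 * Real.pi * (v ⬝ᵥ X *ᵥ v) := by
    rw [← h1]
    refine MeasureTheory.integral_nonneg fun ω => ?_
    have hp := (map_posSemidef hQ).mul_mul_conjTranspose_same
      ((replicateRow Unit v).map Complex.ofReal *
        ((Complex.I * ω) • (1 : Matrix ι ι ℂ) - M.map Complex.ofReal)⁻¹)
    have hd := hp.diag_nonneg (i := ())
    rw [Matrix.conjTranspose_mul, ← Matrix.mul_assoc] at hd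
    exact (Complex.le_def.1 hd).1
  exact nonneg_of_mul_nonneg_right h3 (by positivity)

theorem mulVec_eq_zero_of_posSemidef {X : Matrix ι ι ℝ} (hX : X.PosSemidef) {v : ι → ℝ}
    (h : v ⬝ᵥ X *ᵥ v = 0) : X *ᵥ v = 0 := by
  have := hX.dotProduct_mulVec_zero_iff v
  simpa using this.1 (by simpa using h)

theorem posDef_of_posSemidef {X : Matrix ι ι ℝ} (hX : X.PosSemidef)
    (h : ∀ v : ι → ℝ, X *ᵥ v = 0 → v = 0) : X.PosDef := by
  rw [posDef_iff_real]
  have h1 := posSemidef_iff_real.1 hX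
  refine ⟨h1.1, fun v hv => lt_of_le_of_ne (h1.2 v) fun h0 => hv (h v ?_)⟩
  exact mulVec_eq_zero_of_posSemidef hX h0.symm

theorem posDef_of_lyapunov {M X Q : Matrix ι ι ℝ} (hM : IsHurwitz M) (hX : Xᵀ = X)
    (hQ : Q.PosDef) (h : M * X + X * Mᵀ + Q = 0) : X.PosDef := by
  refine posDef_of_posSemidef (posSemidef_of_lyapunov hM hX hQ.posSemidef h) fun v hv => ?_
  by_contra hne
  have h1 := (posDef_iff_real.1 hQ).2 v hne
  have h2 : v ⬝ᵥ (M * X + X * Mᵀ + Q) *ᵥ v = 0 := by rw [h]; simp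
  have h3 : v ᵥ* X = 0 := by rw [← Matrix.mulVec_transpose, hX, hv]
  rw [Matrix.add_mulVec, Matrix.add_mulVec, ← Matrix.mulVec_mulVec, hv, ← Matrix.mulVec_mulVec,
    dotProduct_add, dotProduct_add, dotProduct_mulVec v X, h3] at h2
  simp at h2
  linarith

/-- Lyapunov's stability criterion. -/
theorem isHurwitz_of_lyapunov {M X : Matrix ι ι ℝ} (hX : X.PosDef)
    (h : (-(M * X + X * Mᵀ)).PosDef) : IsHurwitz M := by
  rw [isHurwitz_iff_charpoly]
  intro z hz
  rw [← Matrix.charpoly_transpose, ← charpoly_map_ofReal, ← Matrix.mem_spectrum_iff_isRoot_charpoly,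
    ← Matrix.spectrum_toLin', ← Module.End.hasEigenvalue_iff_mem_spectrum] at hz
  obtain ⟨w, hw⟩ := hz.exists_hasEigenvector
  have hw0 : w ≠ 0 := hw.2
  have hwe : (Mᵀ.map Complex.ofReal) *ᵥ w = z • w := by
    simpa using hw.apply_eq_smul
  -- With `x + i y` a left eigenvector, adding the quadratic forms at `x` and at `y` cancels the
  -- terms in `z.im`, which leaves `-2 z.re (xᵀ X x + yᵀ X y) > 0`.
  let x : ι → ℝ := fun i => (w i).re
  let y : ι → ℝ := fun i => (w i).im
  have hx : Mᵀ *ᵥ x = z.re • x - z.im • y := by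
    ext i
    have := congrArg Complex.re (congrFun hwe i)
    simpa [mulVec, dotProduct, x, y] using this
  have hy : Mᵀ *ᵥ y = z.re • y + z.im • x := by
    ext i
    have := congrArg Complex.im (congrFun hwe i)
    simpa [mulVec, dotProduct, x, y, add_comm] using this
  have hq : ∀ v : ι → ℝ, v ⬝ᵥ (-(M * X + X * Mᵀ)) *ᵥ v = -(2 * (v ⬝ᵥ X *ᵥ (Mᵀ *ᵥ v))) := by
    intro v
    have e : v ⬝ᵥ (M * X) *ᵥ v = v ⬝ᵥ (X * Mᵀ) *ᵥ v := by
      rw [← dotProduct_transpose_mulVec, transpose_mul, (posDef_iff_real.1 hX).1]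
    rw [Matrix.neg_mulVec, Matrix.add_mulVec, dotProduct_neg, dotProduct_add, e,
      Matrix.mulVec_mulVec]
    ring
  have hxy : x ≠ 0 ∨ y ≠ 0 := by
    by_contra! hc
    exact hw0 (funext fun i => Complex.ext (congrFun hc.1 i) (congrFun hc.2 i))
  have hsymm : y ⬝ᵥ X *ᵥ x = x ⬝ᵥ X *ᵥ y := by
    rw [← dotProduct_transpose_mulVec, (posDef_iff_real.1 hX).1]
  have hpos : ∀ {P : Matrix ι ι ℝ}, P.PosDef → 0 < x ⬝ᵥ P *ᵥ x + y ⬝ᵥ P *ᵥ y := by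
    intro P hP
    have hP1 := posSemidef_iff_real.1 hP.posSemidef
    rcases hxy with h1 | h1
    · exact add_pos_of_pos_of_nonneg ((posDef_iff_real.1 hP).2 _ h1) (hP1.2 y)
    · exact add_pos_of_nonneg_of_pos (hP1.2 x) ((posDef_iff_real.1 hP).2 _ h1)
  have h1 := hpos h
  have h2 := hpos hX
  rw [hq, hq, hx, hy, Matrix.mulVec_sub, Matrix.mulVec_add, dotProduct_sub, dotProduct_add] at h1
  simp only [Matrix.mulVec_smul, dotProduct_smul, smul_eq_mul, hsymm] at h1
  nlinarith

end Lyapunov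

/-! ### Input power as a Gramian entry and its lower bound by entropy. -/

section Gramian

open scoped ComplexOrder

theorem closedLoop_eq {n m l : ℕ} (A : Matrix (Fin n) (Fin n) ℝ) (B : Matrix (Fin n) (Fin m) ℝ)
    (F : Matrix (Fin m) (Fin n) ℝ) (T : Matrix (Fin l) (Fin m) ℝ) (R : Matrix (Fin m) (Fin l) ℝ) :
    closedLoop A B F T R = A + (B * R) * (T * F) := by
  simp [closedLoop, Matrix.mul_assoc]

/-- The steady-state power in terms of the closed-loop controllability Gramian. -/
theorem inputPower_eq {n m l : ℕ} {A : Matrix (Fin n) (Fin n) ℝ} {B : Matrix (Fin n) (Fin m) ℝ}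
    {F : Matrix (Fin m) (Fin n) ℝ} {T : Matrix (Fin l) (Fin m) ℝ} {R : Matrix (Fin m) (Fin l) ℝ}
    {N : Fin l → ℝ} (hM : IsHurwitz (closedLoop A B F T R)) {X : Matrix (Fin n) (Fin n) ℝ}
    (hX : Xᵀ = X) (h : closedLoop A B F T R * X + X * (closedLoop A B F T R)ᵀ +
      (B * R) * diagonal N * (B * R)ᵀ = 0) (i : Fin l) :
    inputPower A B F T R N i = ((T * F) * X * (T * F)ᵀ) i i := by
  have h1 := integral_resolvent_quadratic hM hX h (T * F) i
  have h2 : ∀ ω : ℝ, inputPSD A B F T R N i ω =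
      (((T * F).map Complex.ofReal * ((Complex.I * ω) • (1 : Matrix (Fin n) (Fin n) ℂ) -
        (closedLoop A B F T R).map Complex.ofReal)⁻¹ *
        ((B * R) * diagonal N * (B * R)ᵀ).map Complex.ofReal *
      (((Complex.I * ω) • (1 : Matrix (Fin n) (Fin n) ℂ) -
        (closedLoop A B F T R).map Complex.ofReal)⁻¹)ᴴ * ((T * F).map Complex.ofReal)ᴴ) i i).re := by
    intro ω
    have e : ((B * R) * diagonal N * (B * R)ᵀ).map Complex.ofReal =
        (B * R).map Complex.ofReal * diagonal (fun j => (N j : ℂ)) *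
          ((B * R).map Complex.ofReal)ᴴ := by
      ext a b
      rw [Matrix.map_apply, Matrix.mul_apply, Matrix.mul_apply]
      simp only [Matrix.mul_diagonal, Matrix.conjTranspose_apply, Matrix.map_apply,
        Matrix.transpose_apply]
      simp
    rw [inputPSD, compSensitivity, e]
    simp only [Matrix.conjTranspose_mul, Matrix.mul_assoc]
  simp_rw [inputPower, h2, h1]
  field_simp

/-- Schur triangularization, one eigenvector at a time: in a unitary basis that starts with an
eigenvector for `z`, the corner of `M` has real part at least `0` and at least `2 Re z`, while the
trailing blocks of `A` and `M` inherit both hypotheses. -/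
theorem two_mul_rightSum_le_trace : ∀ (n : ℕ) (A M : Matrix (Fin n) (Fin n) ℂ), M.PosSemidef →
    (M - (A + Aᴴ)).PosSemidef →
    2 * ((A.charpoly.roots.filter (fun z : ℂ => 0 < z.re)).map Complex.re).sum ≤ M.trace.re := by
  intro n
  induction n with
  | zero =>
    intro A M _ _
    simp [Matrix.charpoly, Matrix.trace]
  | succ n ih =>
    intro A M hM hAM
    obtain ⟨z, hz⟩ := Module.End.exists_eigenvalue (Matrix.toLin' A)
    obtain ⟨w, hw⟩ := hz.exists_hasEigenvector
    let w' : EuclideanSpace ℂ (Fin (n + 1)) := WithLp.toLp 2 w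
    have hw' : w' ≠ 0 := by
      intro h
      apply hw.2
      have := congrArg WithLp.ofLp h
      simpa [w'] using this
    let v : EuclideanSpace ℂ (Fin (n + 1)) := ((‖w'‖⁻¹ : ℝ) : ℂ) • w'
    have hv : ‖v‖ = 1 := by
      simp [v, norm_smul, norm_ne_zero_iff.2 hw']
    obtain ⟨b, hb⟩ := Orthonormal.exists_orthonormalBasis_extension_of_card_eq (𝕜 := ℂ)
      (E := EuclideanSpace ℂ (Fin (n + 1))) (ι := Fin (n + 1)) (by simp)
      (v := fun _ => v) (s := {0}) (by
        rw [orthonormal_iff_ite]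
        rintro ⟨i, hi⟩ ⟨j, hj⟩
        simp only [Set.mem_singleton_iff] at hi hj
        subst hi; subst hj
        simp [hv])
    have hb0 : b 0 = v := hb 0 rfl
    let U : Matrix (Fin (n + 1)) (Fin (n + 1)) ℂ := Matrix.of fun i j => b j i
    have hU : Uᴴ * U = 1 := by
      ext i j
      have := orthonormal_iff_ite.1 b.orthonormal i j
      rw [EuclideanSpace.inner_eq_star_dotProduct] at this
      rw [Matrix.one_apply, ← this, Matrix.mul_apply, dotProduct]
      simp [U, mul_comm]
    have hU' : U * Uᴴ = 1 := mul_eq_one_comm.1 hU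
    have hAv : A * U.submatrix id (fun _ : Unit => 0) = z • U.submatrix id (fun _ : Unit => 0) := by
      have h1 : A *ᵥ w = z • w := by simpa using hw.apply_eq_smul
      ext i j
      have h2 := congrFun h1 i
      simp only [Matrix.mul_apply, Matrix.submatrix_apply, id, U, Matrix.of_apply, hb0,
        Matrix.smul_apply, v, w', PiLp.smul_apply, smul_eq_mul]
      simp only [mulVec, dotProduct, Pi.smul_apply, smul_eq_mul] at h2
      rw [mul_left_comm, ← h2, Finset.mul_sum]
      exact Finset.sum_congr rfl fun k _ => by ring
    let A' := Uᴴ * A * U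
    let M' := Uᴴ * M * U
    have hcol : ∀ i, A' i 0 = if i = 0 then z else 0 := by
      intro i
      have h1 : A' i 0 = (Uᴴ * (A * U.submatrix id (fun _ : Unit => 0))) i () := by
        simp [A', Matrix.mul_assoc, Matrix.mul_apply]
      rw [h1, hAv, Matrix.mul_smul]
      have h2 : (Uᴴ * U.submatrix id (fun _ : Unit => 0)) i () = (Uᴴ * U) i 0 := by
        simp [Matrix.mul_apply]
      rw [Matrix.smul_apply, h2, hU, Matrix.one_apply]
      simp
    have hchar : A.charpoly = (X - C z) * (A'.submatrix Fin.succ Fin.succ).charpoly := by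
      have h1 : A'.charpoly = A.charpoly := by
        simp only [A']
        rw [Matrix.charpoly_mul_comm, ← Matrix.mul_assoc, hU', Matrix.one_mul]
      rw [← h1, Matrix.charpoly, Matrix.det_succ_column_zero, Fin.sum_univ_succ]
      rw [Finset.sum_eq_zero]
      · simp only [Fin.val_zero, pow_zero, one_mul, add_zero, Matrix.charmatrix_apply_eq, hcol]
        simp only [if_true]
        congr 1
        rw [Matrix.charpoly]
        congr 1
        ext i j : 2
        by_cases hij : i = j
        · subst hij; simp
        · simp [hij]
      · intro i _
        rw [Matrix.charmatrix_apply_ne _ _ _ (Fin.succ_ne_zero i), hcol]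
        simp [Fin.succ_ne_zero]
    have hM' : M'.PosSemidef := hM.conjTranspose_mul_mul_same U
    have hAM' : (M' - (A' + A'ᴴ)).PosSemidef := by
      have := hAM.conjTranspose_mul_mul_same U
      convert this using 1
      simp only [M', A', Matrix.conjTranspose_mul, Matrix.conjTranspose_conjTranspose,
        Matrix.mul_sub, Matrix.sub_mul, Matrix.mul_add, Matrix.add_mul, Matrix.mul_assoc]
    have hIH := ih (A'.submatrix Fin.succ Fin.succ) (M'.submatrix Fin.succ Fin.succ)
      (hM'.submatrix _) (by
        have := hAM'.submatrix Fin.succ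
        convert this using 1
        ext i j
        simp)
    have htr : M.trace = M' 0 0 + (M'.submatrix Fin.succ Fin.succ).trace := by
      have h1 : M'.trace = M.trace := by
        simp only [M']
        rw [Matrix.trace_mul_comm, ← Matrix.mul_assoc, hU', Matrix.one_mul]
      rw [← h1, Matrix.trace, Fin.sum_univ_succ]
      rfl
    have h00 : 0 ≤ (M' 0 0).re := (Complex.le_def.1 (hM'.diag_nonneg (i := 0))).1
    have h01 : 2 * z.re ≤ (M' 0 0).re := by
      have := (Complex.le_def.1 (hAM'.diag_nonneg (i := 0))).1
      simp [Matrix.conjTranspose_apply, hcol] at this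
      linarith
    have hne : (X - C z) * (A'.submatrix Fin.succ Fin.succ).charpoly ≠ 0 :=
      mul_ne_zero (X_sub_C_ne_zero z) (Matrix.charpoly_monic _).ne_zero
    rw [hchar, Polynomial.roots_mul hne, roots_X_sub_C, Multiset.filter_add, Multiset.map_add,
      Multiset.sum_add, htr, Complex.add_re, mul_add]
    refine add_le_add ?_ hIH
    by_cases hz0 : 0 < z.re
    · rw [Multiset.filter_singleton, if_pos hz0]; simpa using h01
    · rw [Multiset.filter_singleton, if_neg hz0]; simpa using h00

section Bound

variable {ι κ : Type} [Fintype ι] [DecidableEq ι] [Fintype κ]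

theorem two_mul_topEntropy_le_trace_of_le {A M : Matrix ι ι ℝ} (hM : M.PosSemidef)
    (h : (M - (A + Aᵀ)).PosSemidef) : 2 * topEntropy A ≤ M.trace := by
  let e := (Fintype.equivFin ι).symm
  have h0 : ((M.map Complex.ofReal).submatrix e e -
      ((A.map Complex.ofReal).submatrix e e + ((A.map Complex.ofReal).submatrix e e)ᴴ)) =
      ((M - (A + Aᵀ)).map Complex.ofReal).submatrix e e := by
    ext i j
    simp
  have h1 := two_mul_rightSum_le_trace _ ((A.map Complex.ofReal).submatrix e e)
    ((M.map Complex.ofReal).submatrix e e) ((map_posSemidef hM).submatrix e) (by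
      rw [h0]; exact (map_posSemidef h).submatrix e)
  have h2 : ((A.map Complex.ofReal).submatrix e e).charpoly = (A.map Complex.ofReal).charpoly := by
    have := Matrix.charpoly_reindex e.symm (A.map Complex.ofReal)
    rwa [Matrix.reindex_apply, Equiv.symm_symm] at this
  have h3 : ((M.map Complex.ofReal).submatrix e e).trace.re = M.trace := by
    simp only [Matrix.trace, Matrix.diag_apply, Matrix.submatrix_apply, Matrix.map_apply,
      Complex.re_sum, Complex.ofReal_re]
    exact e.sum_comp (fun i => M i i)
  rw [h2, h3] at h1
  exact h1

/-- Completing the square: adding `(B + X Kᵀ)(B + X Kᵀ)ᵀ` to the Lyapunov inequality gives `A X + X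
Aᵀ ≤ X Kᵀ K X`. Conjugation by `X ^ (-1/2)` reduces this to `two_mul_topEntropy_le_trace_of_le` with
a matrix whose trace is that of `K X Kᵀ`. -/
theorem two_mul_topEntropy_le_trace_of_posDef {A X : Matrix ι ι ℝ} {B : Matrix ι κ ℝ}
    {K : Matrix κ ι ℝ} (hX : X.PosDef)
    (h : (-((A + B * K) * X + X * (A + B * K)ᵀ + B * Bᵀ)).PosSemidef) :
    2 * topEntropy A ≤ (K * X * Kᵀ).trace := by
  obtain ⟨L, hL, rfl⟩ := exists_symm_mul_self hX.posSemidef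
  have hu : IsUnit L := by
    have := hX.isUnit
    rw [Matrix.isUnit_iff_isUnit_det, Matrix.det_mul] at this
    exact (Matrix.isUnit_iff_isUnit_det _).2 (isUnit_of_mul_isUnit_left this)
  have hd := (Matrix.isUnit_iff_isUnit_det _).1 hu
  have e1 : L * L⁻¹ = 1 := Matrix.mul_nonsing_inv _ hd
  have e2 : L⁻¹ * L = 1 := Matrix.nonsing_inv_mul _ hd
  have hLi : (L⁻¹)ᵀ = L⁻¹ := by rw [Matrix.transpose_nonsing_inv, hL]
  have h1 : 2 * topEntropy (L⁻¹ * A * L) ≤ (L * Kᵀ * (L * Kᵀ)ᵀ).trace := by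
    apply two_mul_topEntropy_le_trace_of_le
    · simpa [conjTranspose_eq_transpose_of_trivial] using
        posSemidef_self_mul_conjTranspose (L * Kᵀ)
    · have h2 := h.add (posSemidef_self_mul_conjTranspose (B + L * L * Kᵀ))
      have h3 := h2.conjTranspose_mul_mul_same L⁻¹
      rw [conjTranspose_eq_transpose_of_trivial, conjTranspose_eq_transpose_of_trivial, hLi] at h3
      convert h3 using 1
      have h4 : (-((A + B * K) * (L * L) + (L * L) * (A + B * K)ᵀ + B * Bᵀ)) +
          (B + L * L * Kᵀ) * (B + L * L * Kᵀ)ᵀ =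
          (L * (L * Kᵀ * (L * Kᵀ)ᵀ) * L - (A * L * L + L * L * Aᵀ)) := by
        simp only [transpose_add, transpose_mul, transpose_transpose, hL, Matrix.mul_add,
          Matrix.add_mul, Matrix.mul_assoc]
        abel
      rw [h4]
      simp only [Matrix.mul_sub, Matrix.sub_mul, Matrix.mul_add, Matrix.add_mul, transpose_mul,
        transpose_transpose, hL, hLi]
      have e3 : ∀ Y : Matrix ι ι ℝ, L⁻¹ * (L * Y) = Y := fun Y => by
        rw [← Matrix.mul_assoc, e2, Matrix.one_mul]
      simp only [Matrix.mul_assoc, e1, e3, Matrix.mul_one]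
  have h2 : topEntropy (L⁻¹ * A * L) = topEntropy A := by
    rw [topEntropy_eq, topEntropy_eq, charpoly_similar A L L⁻¹ e1 e2]
  rw [h2] at h1
  refine h1.trans (le_of_eq ?_)
  rw [Matrix.transpose_mul, transpose_transpose, hL, Matrix.trace_mul_comm]
  simp only [Matrix.mul_assoc]

/-- Any stabilizing feedback spends at least twice the topological entropy as input power. -/
theorem two_mul_topEntropy_le_trace {A X : Matrix ι ι ℝ} {B : Matrix ι κ ℝ}
    {K : Matrix κ ι ℝ} (hM : IsHurwitz (A + B * K)) (hX : X.PosSemidef)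
    (h : (-((A + B * K) * X + X * (A + B * K)ᵀ + B * Bᵀ)).PosSemidef) :
    2 * topEntropy A ≤ (K * X * Kᵀ).trace := by
  obtain ⟨Z, hZs, hZ⟩ := exists_lyapunov (Q := 1) hM (by simp)
  have hZp := posDef_of_lyapunov hM hZs PosDef.one hZ
  have hZt : 0 ≤ (K * Z * Kᵀ).trace := by
    have := (hZp.posSemidef.mul_mul_conjTranspose_same K).trace_nonneg
    simpa [conjTranspose_eq_transpose_of_trivial] using this
  -- The Gramian `X` may be singular. Adding `ε Z` makes it definite and preserves the inequality,
  -- at a cost that vanishes with `ε`.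
  have key : ∀ ε : ℝ, 0 < ε →
      2 * topEntropy A ≤ (K * X * Kᵀ).trace + ε * (K * Z * Kᵀ).trace := by
    intro ε hε
    have h1 : (X + ε • Z).PosDef := (hZp.smul hε).posSemidef_add hX
    have h2 := two_mul_topEntropy_le_trace_of_posDef (A := A) (B := B) (K := K) h1 (by
      have h3 := h.add ((PosSemidef.one (n := ι) (R := ℝ)).smul hε.le)
      convert h3 using 1
      have hZ' : (1 : Matrix ι ι ℝ) = -((A + B * K) * Z + Z * (A + B * K)ᵀ) := by
        rw [eq_neg_iff_add_eq_zero, add_comm]; exact hZ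
      rw [hZ']
      simp only [Matrix.mul_add, Matrix.add_mul X, Matrix.mul_smul,
        Matrix.smul_mul, smul_neg, smul_add]
      abel)
    refine h2.trans (le_of_eq ?_)
    simp [Matrix.mul_add, Matrix.add_mul]
  refine le_of_forall_pos_le_add fun δ hδ => ?_
  have h1 := key (δ / ((K * Z * Kᵀ).trace + 1)) (by positivity)
  refine h1.trans (add_le_add le_rfl ?_)
  rw [div_mul_eq_mul_div, div_le_iff₀ (by positivity)]
  nlinarith

end Bound

end Gramian

/-! ### Determinants of low-rank perturbations of block diagonal matrices. -/

section BlockDeterminant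

variable {R : Type} [CommRing R] {k : ℕ} {d : Fin k → ℕ}

theorem det_blockDiagonal_sigma (M : ∀ i, Matrix (Fin (d i)) (Fin (d i)) R) :
    (blockDiagonal' M).det = ∏ i, (M i).det := by
  rw [(blockTriangular_blockDiagonal' M).det_fintype]
  refine Finset.prod_congr rfl fun i _ => ?_
  let e : {s : Σ i, Fin (d i) // s.1 = i} ≃ Fin (d i) := Equiv.sigmaSubtype i
  have h : (blockDiagonal' M).toSquareBlock Sigma.fst i = (M i).submatrix e e := by
    ext ⟨⟨a, x⟩, ha⟩ ⟨⟨b, y⟩, hb⟩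
    dsimp at ha hb
    subst ha
    subst hb
    simp [Matrix.toSquareBlock, Matrix.toSquareBlockProp, e, Equiv.sigmaSubtype,
      blockDiagonal'_apply_eq]
  rw [h, Matrix.det_submatrix_equiv_self]

/-- In a divisor chain, deleting at most `r` factors leaves at least the tail after the first `r`:
each deleted tail index is matched injectively with a kept index below `r`, whose entry is a
multiple. -/
theorem prod_dvd_prod_compl {p : Fin k → R} (hp : ∀ i j, i ≤ j → p j ∣ p i) {r : ℕ}
    (H : Finset (Fin k)) (hH : H.card ≤ r) :
    ∏ i ∈ Finset.univ.filter (fun i : Fin k => r ≤ i), p i ∣ ∏ i ∈ Hᶜ, p i := by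
  classical
  set T := Finset.univ.filter (fun i : Fin k => r ≤ i) with hT
  rw [← Finset.prod_sdiff (Finset.inter_subset_left : T ∩ H ⊆ T),
    ← Finset.prod_sdiff (show T \ (T ∩ H) ⊆ Hᶜ by
      intro i hi
      simp only [Finset.mem_sdiff, Finset.mem_inter, not_and] at hi
      simpa using hi.2 hi.1), mul_comm]
  refine mul_dvd_mul ?_ dvd_rfl
  have hsub : Hᶜ \ (T \ (T ∩ H)) = Tᶜ \ H := by
    ext i; simp only [Finset.mem_sdiff, Finset.mem_compl, Finset.mem_inter]; tauto
  rw [hsub]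
  rcases (T ∩ H).eq_empty_or_nonempty with h0 | ⟨t, ht⟩
  · rw [h0]; simp
  · have hrk : r ≤ k := by
      have h1 := (Finset.mem_filter.1 (Finset.mem_inter.1 ht).1).2
      have := t.2
      omega
    have hTc : (Tᶜ).card = r := by
      have : Tᶜ = Finset.univ.filter (fun i : Fin k => (i : ℕ) < r) := by
        ext i; simp [hT]
      rw [this, Fin.card_filter_val_lt]
      exact min_eq_right hrk
    have hcard : (T ∩ H).card ≤ (Tᶜ \ H).card := by
      have h1 : (T ∩ H).card + (Tᶜ ∩ H).card = H.card := by
        rw [← Finset.card_union_of_disjoint]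
        · congr 1; ext i; simp only [Finset.mem_union, Finset.mem_inter, Finset.mem_compl]; tauto
        · exact Finset.disjoint_left.2 fun i hi hi' => by
            simp only [Finset.mem_inter, Finset.mem_compl] at hi hi'; tauto
      have h2 : (Tᶜ \ H).card + (Tᶜ ∩ H).card = (Tᶜ).card := Finset.card_sdiff_add_card_inter _ _
      omega
    obtain ⟨f⟩ := Function.Embedding.nonempty_of_card_le
      (α := (T ∩ H : Finset (Fin k))) (β := (Tᶜ \ H : Finset (Fin k))) (by
        simpa only [Fintype.card_coe] using hcard)
    rw [← Finset.prod_coe_sort (T ∩ H), ← Finset.prod_coe_sort (Tᶜ \ H)]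
    calc ∏ x : (T ∩ H : Finset (Fin k)), p x ∣ ∏ x : (T ∩ H : Finset (Fin k)), p (f x) := by
          refine Finset.prod_dvd_prod_of_dvd _ _ fun x _ => hp _ _ ?_
          have h1 := (Finset.mem_filter.1 (Finset.mem_inter.1 x.2).1).2
          have h2 := (Finset.mem_sdiff.1 (f x).2).1
          simp only [hT, Finset.mem_compl, Finset.mem_filter, Finset.mem_univ, true_and] at h2
          exact Fin.le_def.2 (by omega)
      _ = ∏ y ∈ Finset.univ.map f, p y := by rw [Finset.prod_map]
      _ ∣ _ := Finset.prod_dvd_prod_of_subset _ _ _ (Finset.subset_univ _)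

/-- The rows in `s` lie in the span of the rows of `V`, which are too few for independence. -/
theorem det_eq_zero_of_rows {ι ρ : Type} [Fintype ι] [DecidableEq ι] [Fintype ρ] [IsDomain R]
    (W : Matrix ι ι R) (U : Matrix ι ρ R) (V : Matrix ρ ι R) (s : Finset ι)
    (hs : Fintype.card ρ < s.card) (hW : ∀ i ∈ s, W i = (U * V) i) : W.det = 0 := by
  classical
  by_contra h
  let _ : Fintype (Set.range V) := Set.fintypeRange V
  have hli := Matrix.linearIndependent_rows_of_det_ne_zero h
  have hli' : LinearIndependent R fun i : s => W.row i := hli.comp _ Subtype.val_injective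
  have h1 := linearIndependent_le_span' _ hli' (Set.range V) (by
    rintro _ ⟨i, rfl⟩
    have : W.row i = ∑ a, U i a • V a := by
      ext j
      rw [Matrix.row_apply, hW i i.2, Matrix.mul_apply]
      simp
    simp only [this]
    exact Submodule.sum_mem _ fun a _ => Submodule.smul_mem _ _ (Submodule.subset_span ⟨a, rfl⟩))
  rw [Cardinal.mk_fintype, Fintype.card_coe] at h1
  have h2 : Fintype.card (Set.range V) ≤ Fintype.card ρ := Fintype.card_range_le V
  have h3 : s.card ≤ Fintype.card (Set.range V) := by exact_mod_cast h1
  omega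

/-- Moving all rows of the blocks in `H` into a second factor `W'` leaves a block diagonal factor
whose determinant is the product over the untouched blocks. -/
theorem prod_det_dvd_det (M : ∀ i, Matrix (Fin (d i)) (Fin (d i)) R)
    (W : Matrix (Σ i, Fin (d i)) (Σ i, Fin (d i)) R) (H : Finset (Fin k))
    (hW : ∀ x : Σ i, Fin (d i), x.1 ∉ H → W x = blockDiagonal' M x) :
    ∏ i ∈ Hᶜ, (M i).det ∣ W.det := by
  classical
  let E : ∀ i, Matrix (Fin (d i)) (Fin (d i)) R := fun i => if i ∈ H then 1 else M i
  let W' : Matrix (Σ i, Fin (d i)) (Σ i, Fin (d i)) R :=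
    Matrix.of fun x => if x.1 ∈ H then W x else (1 : Matrix _ _ R) x
  have hfac : W = blockDiagonal' E * W' := by
    ext ⟨i, a⟩ y
    rw [Matrix.mul_apply, Fintype.sum_sigma, Finset.sum_eq_single i]
    · simp only [blockDiagonal'_apply_eq, E, W', Matrix.of_apply]
      by_cases hi : i ∈ H
      · simp [hi, Matrix.one_apply]
      · simp only [hi, if_false]
        rw [hW _ hi]
        obtain ⟨j, b⟩ := y
        by_cases hij : i = j
        · subst hij
          simp [Matrix.one_apply, blockDiagonal'_apply_eq]
        · rw [blockDiagonal'_apply_ne _ _ _ hij]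
          symm
          refine Finset.sum_eq_zero fun c _ => ?_
          rw [Matrix.one_apply_ne, mul_zero]
          intro h
          exact hij (congrArg Sigma.fst h)
    · intro j _ hj
      refine Finset.sum_eq_zero fun c _ => ?_
      rw [blockDiagonal'_apply_ne _ _ _ hj.symm, zero_mul]
    · simp
  rw [hfac, Matrix.det_mul, det_blockDiagonal_sigma]
  refine Dvd.dvd.mul_right ?_ _
  have : ∏ i ∈ Hᶜ, (M i).det = ∏ i ∈ Hᶜ, (E i).det := by
    refine Finset.prod_congr rfl fun i hi => ?_
    simp [E, Finset.mem_compl.1 hi]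
  rw [this]
  exact Finset.prod_dvd_prod_of_subset _ _ _ (Finset.subset_univ _)

/-- The determinant is multilinear in the rows. A term with more than `|ρ|` rows from `U * V`
vanishes; any other term disturbs at most `|ρ|` blocks. -/
theorem prod_det_dvd_det_add_mul [IsDomain R] {ρ : Type} [Fintype ρ]
    (M : ∀ i, Matrix (Fin (d i)) (Fin (d i)) R) (hM : ∀ i j, i ≤ j → (M j).det ∣ (M i).det)
    (U : Matrix (Σ i, Fin (d i)) ρ R) (V : Matrix ρ (Σ i, Fin (d i)) R) :
    ∏ i ∈ Finset.univ.filter (fun i : Fin k => Fintype.card ρ ≤ i), (M i).det ∣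
      (blockDiagonal' M + U * V).det := by
  classical
  have h1 : (blockDiagonal' M + U * V).det = ∑ s : Finset (Σ i, Fin (d i)),
      (Matrix.of (s.piecewise (blockDiagonal' M) (U * V))).det :=
    (Matrix.detRowAlternating (R := R)).map_add_univ (blockDiagonal' M) (U * V)
  rw [h1]
  refine Finset.dvd_sum fun s _ => ?_
  by_cases hs : Fintype.card ρ < (sᶜ).card
  · rw [det_eq_zero_of_rows _ U V sᶜ hs]
    · exact dvd_zero _
    · intro i hi
      exact Finset.piecewise_eq_of_notMem s _ _ (Finset.mem_compl.1 hi)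
  · refine (prod_dvd_prod_compl hM (sᶜ.image Sigma.fst)
      (Finset.card_image_le.trans (not_lt.1 hs))).trans (prod_det_dvd_det M _ _ ?_)
    intro x hx
    refine Finset.piecewise_eq_of_mem s _ _ ?_
    by_contra hxs
    exact hx (Finset.mem_image_of_mem _ (Finset.mem_compl.2 hxs))

end BlockDeterminant

/-- The block determinant results apply over `ℝ[X]`, so that they yield divisibility of
characteristic polynomials. -/
theorem charpoly_blockDiagonal_add_mul {k : ℕ} {d : Fin k → ℕ} {ρ : Type} [Fintype ρ]
    (A : ∀ i, Matrix (Fin (d i)) (Fin (d i)) ℝ)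
    (U : Matrix (Σ i, Fin (d i)) ρ ℝ) (V : Matrix ρ (Σ i, Fin (d i)) ℝ) :
    (blockDiagonal' A + U * V).charpoly =
      (blockDiagonal' (fun i => (A i).charmatrix) + (-U).map C * V.map C).det := by
  rw [Matrix.charpoly]
  congr 1
  ext ⟨i, a⟩ ⟨j, b⟩ : 2
  have h1 : ((-U).map C * V.map C) ⟨i, a⟩ ⟨j, b⟩ = -C ((U * V) ⟨i, a⟩ ⟨j, b⟩) := by
    simp [Matrix.mul_apply, map_sum]
  rw [Matrix.charmatrix_apply, Matrix.add_apply, Matrix.add_apply, h1]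
  by_cases hij : i = j
  · subst hij
    simp only [blockDiagonal'_apply_eq, Matrix.charmatrix_apply, Matrix.diagonal_apply, map_add]
    by_cases hab : a = b
    · subst hab; simp; ring
    · simp [hab]; ring
  · rw [blockDiagonal'_apply_ne _ _ _ hij, blockDiagonal'_apply_ne _ _ _ hij,
      Matrix.diagonal_apply_ne _ (fun h => hij (congrArg Sigma.fst h))]
    simp

/-! ### Entropies along a cyclic decomposition. -/

namespace CyclicDecomposition

variable {n : ℕ} {A : Matrix (Fin n) (Fin n) ℝ} (D : CyclicDecomposition A)

theorem charpoly_dvd (i j : Fin D.k) (h : i ≤ j) : (D.block j).charpoly ∣ (D.block i).charpoly := by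
  obtain ⟨i, hi⟩ := i
  obtain ⟨j, hj⟩ := j
  have h' : i ≤ j := h
  clear h
  rw [charpoly_eq_minpoly (D.cyclic _), charpoly_eq_minpoly (D.cyclic _)]
  induction j, h' using Nat.le_induction with
  | base => exact dvd_rfl
  | succ j _ ih => exact (D.minpoly_dvd j hj).trans (ih (Nat.lt_of_succ_lt hj))

/-- A perturbation of rank `r` leaves at least the entropy of the blocks after the first `r`. -/
theorem sum_topEntropy_le_of_rank {ρ : Type} [Fintype ρ] (U : Matrix (Fin n) ρ ℝ)
    (V : Matrix ρ (Fin n) ℝ) :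
    ∑ i ∈ Finset.univ.filter (fun i : Fin D.k => Fintype.card ρ ≤ i), topEntropy (D.block i) ≤
      topEntropy (A + U * V) := by
  have h1 : D.Sinv * (A + U * V) * D.S = blockDiagonal' D.block + (D.Sinv * U) * (V * D.S) := by
    rw [← D.conj_eq, Matrix.mul_add, Matrix.add_mul]
    simp only [Matrix.mul_assoc]
  rw [topEntropy_eq, ← charpoly_similar _ D.S D.Sinv D.S_mul_Sinv D.Sinv_mul_S, h1]
  simp_rw [topEntropy_eq]
  rw [← rightRootSum_prod _ _ fun i _ => (Matrix.charpoly_monic _).ne_zero]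
  refine rightRootSum_le_of_dvd (Matrix.charpoly_monic _).ne_zero ?_
  rw [charpoly_blockDiagonal_add_mul]
  exact prod_det_dvd_det_add_mul _ D.charpoly_dvd _ _

theorem topEntropy_block_anti (i j : Fin D.k) (h : i ≤ j) :
    topEntropy (D.block j) ≤ topEntropy (D.block i) := by
  rw [topEntropy_eq, topEntropy_eq]
  exact rightRootSum_le_of_dvd (Matrix.charpoly_monic _).ne_zero (D.charpoly_dvd i j h)

theorem entropyVector_nonneg (l : ℕ) (i : Fin l) : 0 ≤ D.entropyVector l i := by
  rw [entropyVector]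
  split_ifs
  · exact topEntropy_nonneg _
  · exact le_rfl

theorem entropyVector_antitone (l : ℕ) : Antitone (D.entropyVector l) := by
  intro i j hij
  by_cases hj : (j : ℕ) < D.k
  · have hi : (i : ℕ) < D.k := lt_of_le_of_lt hij hj
    simp only [entropyVector, dif_pos hi, dif_pos hj]
    exact D.topEntropy_block_anti _ _ hij
  · rw [entropyVector, dif_neg hj]
    exact D.entropyVector_nonneg l i

/-- Padding adds zeros and truncation drops nonnegative terms, so no relation between `l` and the
number of blocks is needed. -/
theorem sum_entropyVector_le {l r : ℕ} :
    ∑ i ∈ Finset.univ.filter (fun i : Fin l => r ≤ i), D.entropyVector l i ≤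
      ∑ i ∈ Finset.univ.filter (fun i : Fin D.k => r ≤ i), topEntropy (D.block i) := by
  let e : ℕ → ℝ := fun i => if h : i < D.k then topEntropy (D.block ⟨i, h⟩) else 0
  have he : ∀ i, 0 ≤ e i := fun i => by
    simp only [e]; split_ifs
    · exact topEntropy_nonneg _
    · exact le_rfl
  have h1 : ∑ i ∈ Finset.univ.filter (fun i : Fin l => r ≤ i), D.entropyVector l i =
      ∑ i ∈ (Finset.range l).filter (fun i => r ≤ i), e i := by
    rw [Finset.sum_filter, Finset.sum_filter, ← Fin.sum_univ_eq_sum_range (fun i => if r ≤ i then e i else 0)]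
    rfl
  have h2 : ∑ i ∈ Finset.univ.filter (fun i : Fin D.k => r ≤ i), topEntropy (D.block i) =
      ∑ i ∈ (Finset.range D.k).filter (fun i => r ≤ i), e i := by
    rw [Finset.sum_filter, Finset.sum_filter, ← Fin.sum_univ_eq_sum_range (fun i => if r ≤ i then e i else 0)]
    refine Finset.sum_congr rfl fun i _ => ?_
    simp [e]
  rw [h1, h2]
  have h3 : ∑ i ∈ (Finset.range l).filter (fun i => r ≤ i), e i =
      ∑ i ∈ ((Finset.range l).filter (fun i => r ≤ i)).filter (fun i => i < D.k), e i := by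
    symm
    refine Finset.sum_filter_of_ne fun i _ hi => ?_
    by_contra hik
    exact hi (by simp [e, hik])
  rw [h3]
  refine Finset.sum_le_sum_of_subset_of_nonneg ?_ fun i _ _ => he i
  intro i hi
  simp only [Finset.mem_filter, Finset.mem_range] at hi ⊢
  exact ⟨hi.2, hi.1.2⟩

end CyclicDecomposition

/-! ### Majorization tested on subsets. -/

section Sorting

/-- In the increasing enumeration of `J`, the element with index `i` is at least `i`. -/
theorem sum_lt_card_le_sum_of_monotone {l : ℕ} {f : Fin l → ℝ} (hf : Monotone f)
    (J : Finset (Fin l)) :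
    ∑ i ∈ Finset.univ.filter (fun i : Fin l => (i : ℕ) < J.card), f i ≤ ∑ i ∈ J, f i := by
  have hJl : J.card ≤ l := by simpa using Finset.card_le_univ J
  let e := J.orderEmbOfFin rfl
  have he : ∀ (i : ℕ) (hi : i < J.card), i ≤ (e ⟨i, hi⟩ : ℕ) := by
    intro i
    induction i with
    | zero => intro _; exact Nat.zero_le _
    | succ i ih =>
      intro hi
      have h1 := ih (Nat.lt_of_succ_lt hi)
      have h2 : e ⟨i, Nat.lt_of_succ_lt hi⟩ < e ⟨i + 1, hi⟩ := e.strictMono (Nat.lt_succ_self i)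
      have h3 : (e ⟨i, Nat.lt_of_succ_lt hi⟩ : ℕ) < e ⟨i + 1, hi⟩ := h2
      omega
  have h1 : ∑ i ∈ J, f i = ∑ i : Fin J.card, f (e i) := by
    conv_lhs => rw [← Finset.map_orderEmbOfFin_univ J rfl]
    rw [Finset.sum_map]
    rfl
  have h2 : Finset.univ.filter (fun i : Fin l => (i : ℕ) < J.card) =
      Finset.univ.map (Fin.castLEEmb hJl) := by
    ext i
    simp only [Finset.mem_filter, Finset.mem_univ, true_and, Finset.mem_map, Fin.castLEEmb_apply]
    constructor
    · intro hi; exact ⟨⟨i, hi⟩, rfl⟩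
    · rintro ⟨a, rfl⟩; exact a.2
  rw [h1, h2, Finset.sum_map]
  exact Finset.sum_le_sum fun i _ => hf (Fin.le_def.2 (he i i.2))

theorem sum_tail_le_sum_of_antitone {l : ℕ} {f : Fin l → ℝ} (hf : Antitone f)
    (J : Finset (Fin l)) :
    ∑ i ∈ Finset.univ.filter (fun i : Fin l => l - J.card ≤ (i : ℕ)), f i ≤ ∑ i ∈ J, f i := by
  have h := sum_lt_card_le_sum_of_monotone (f := f ∘ Fin.rev)
    (fun a b hab => hf (Fin.rev_le_rev.2 hab)) (J.map Fin.revPerm.toEmbedding)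
  rw [Finset.card_map, Finset.sum_map] at h
  simp only [Equiv.coe_toEmbedding, Fin.revPerm_apply, Function.comp_apply, Fin.rev_rev] at h
  refine le_trans (le_of_eq ?_) h
  refine Finset.sum_bij (fun i _ => Fin.rev i) ?_ ?_ ?_ ?_
  · intro i hi
    simp only [Finset.mem_filter, Finset.mem_univ, true_and, Fin.val_rev] at hi ⊢
    have := i.2
    have h3 : J.card ≤ l := by simpa using Finset.card_le_univ J
    omega
  · intro a _ b _ h; exact Fin.rev_injective h
  · intro b hb
    refine ⟨Fin.rev b, ?_, Fin.rev_rev b⟩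
    simp only [Finset.mem_filter, Finset.mem_univ, true_and, Fin.val_rev] at hb ⊢
    have := b.2
    omega
  · intro i _; simp

theorem sum_sort_le_sum {l : ℕ} (x : Fin l → ℝ) (j : Fin l) (J : Finset (Fin l))
    (hJ : J.card = j + 1) : ∑ i ∈ Finset.Iic j, x (Tuple.sort x i) ≤ ∑ i ∈ J, x i := by
  have h := sum_lt_card_le_sum_of_monotone (Tuple.monotone_sort x)
    (J.map (Tuple.sort x).symm.toEmbedding)
  rw [Finset.card_map, Finset.sum_map] at h
  simp only [Equiv.coe_toEmbedding, Function.comp_apply, Equiv.apply_symm_apply] at h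
  have h1 : Finset.Iic j = Finset.univ.filter (fun i : Fin l => (i : ℕ) < J.card) := by
    ext i
    rw [Finset.mem_Iic, Finset.mem_filter, Fin.le_def]
    simp only [Finset.mem_univ, true_and]
    omega
  rw [h1]
  exact h

/-- For a nonincreasing `y`, strict weak majorization from above can be tested on subsets. -/
theorem strictWeakMajorizedAbove_iff {l : ℕ} {x y : Fin l → ℝ} (hy : Antitone y) :
    StrictWeakMajorizedAbove x y ↔ ∀ J : Finset (Fin l), J.Nonempty →
      ∑ i ∈ Finset.univ.filter (fun i : Fin l => l - J.card ≤ (i : ℕ)), y i < ∑ i ∈ J, x i := by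
  have hset : ∀ (z : Fin l → ℝ) (j : Fin l), ∑ i ∈ Finset.Iic j, z (Tuple.sort z i) =
      ∑ i ∈ (Finset.Iic j).map (Tuple.sort z).toEmbedding, z i := by
    intro z j; rw [Finset.sum_map]; rfl
  have htail : ∀ c : ℕ, c ≤ l →
      (Finset.univ.filter (fun i : Fin l => l - c ≤ (i : ℕ))).card = c := by
    intro c hc
    have h1 : Finset.univ.filter (fun i : Fin l => l - c ≤ (i : ℕ)) =
        (Finset.univ.filter (fun i : Fin l => (i : ℕ) < l - c))ᶜ := by
      ext i; simp
    rw [h1, Finset.card_compl, Fin.card_filter_val_lt, Fintype.card_fin]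
    omega
  constructor
  · intro h J hJ
    have hJl : J.card ≤ l := by simpa using Finset.card_le_univ J
    have hpos := hJ.card_pos
    let j : Fin l := ⟨J.card - 1, by omega⟩
    have hj : J.card = j + 1 := by simp only [j]; omega
    have h1 := sum_sort_le_sum x j J hj
    have h2 := h j
    rw [hset y j] at h2
    have h3 := sum_tail_le_sum_of_antitone hy ((Finset.Iic j).map (Tuple.sort y).toEmbedding)
    rw [Finset.card_map, Fin.card_Iic, ← hj] at h3
    linarith
  · intro h j
    have h1 := h ((Finset.Iic j).map (Tuple.sort x).toEmbedding) ⟨Tuple.sort x j, by simp⟩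
    rw [← hset x j, Finset.card_map, Fin.card_Iic] at h1
    refine lt_of_le_of_lt ?_ h1
    exact sum_sort_le_sum y j _ (htail _ j.2)

end Sorting

/-! ### Necessity of the majorization. -/

section Necessity

variable {n m l : ℕ}

theorem sum_entropyVector_lt_of_stabilizable {A : Matrix (Fin n) (Fin n) ℝ}
    {B : Matrix (Fin n) (Fin m) ℝ} {P N : Fin l → ℝ} (hN : ∀ i, 0 < N i)
    (D : CyclicDecomposition A) (h : StabilizableOverAWGN A B P N) (J : Finset (Fin l))
    (hJ : J.Nonempty) :
    ∑ i ∈ Finset.univ.filter (fun i : Fin l => l - J.card ≤ (i : ℕ)), D.entropyVector l i <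
      ∑ i ∈ J, capacity P N i := by
  obtain ⟨F, T, R, -, hM, hpow⟩ := h
  have hQs : ((B * R) * diagonal N * (B * R)ᵀ)ᵀ = (B * R) * diagonal N * (B * R)ᵀ := by
    simp [Matrix.mul_assoc]
  have hQ : ((B * R) * diagonal N * (B * R)ᵀ).PosSemidef := by
    have := (PosSemidef.diagonal (d := N) fun i => (hN i).le).mul_mul_conjTranspose_same (B * R)
    simpa [conjTranspose_eq_transpose_of_trivial] using this
  obtain ⟨X, hXs, hX⟩ := exists_lyapunov hM hQs
  have hXp := posSemidef_of_lyapunov hM hXs hQ hX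
  -- Dividing the outputs and multiplying the inputs by `√N` leaves the loop unchanged and gives the
  -- noise unit intensity.
  let K : Matrix J (Fin n) ℝ := Matrix.of fun j b => (T * F) j b / √(N j)
  let noise : ∀ I : Finset (Fin l), Matrix (Fin n) I ℝ :=
    fun I => Matrix.of fun a j => (B * R) a j * √(N j)
  -- `U * V` is the feedback through the channels outside `J`, from now on part of the plant; its
  -- rank is at most `l - |J|`.
  let U : Matrix (Fin n) (Jᶜ : Finset (Fin l)) ℝ := Matrix.of fun a j => (B * R) a j
  let V : Matrix (Jᶜ : Finset (Fin l)) (Fin n) ℝ := Matrix.of fun j b => (T * F) j b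
  have hsqrt : ∀ j, √(N j) * √(N j) = N j := fun j => Real.mul_self_sqrt (hN j).le
  have hsq0 : ∀ j, √(N j) ≠ 0 := fun j => (Real.sqrt_pos.2 (hN j)).ne'
  have hsplit : ∀ g : Fin l → ℝ,
      ∑ j, g j = (∑ j : (Jᶜ : Finset (Fin l)), g j) + ∑ j : J, g j := by
    intro g
    rw [Finset.sum_coe_sort J g, Finset.sum_coe_sort Jᶜ g, add_comm, Finset.sum_add_sum_compl]
  have hcl : closedLoop A B F T R = (A + U * V) + noise J * K := by
    rw [closedLoop_eq, add_assoc]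
    congr 1
    ext a b
    rw [Matrix.mul_apply, hsplit, Matrix.add_apply, Matrix.mul_apply, Matrix.mul_apply]
    congr 1
    refine Finset.sum_congr rfl fun j _ => ?_
    have := hsq0 j
    simp only [noise, K, Matrix.of_apply]
    field_simp
  have hnoise : (B * R) * diagonal N * (B * R)ᵀ =
      noise Jᶜ * (noise Jᶜ)ᵀ + noise J * (noise J)ᵀ := by
    ext a b
    rw [Matrix.mul_apply, hsplit, Matrix.add_apply, Matrix.mul_apply, Matrix.mul_apply]
    congr 1 <;>
    · refine Finset.sum_congr rfl fun j _ => ?_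
      simp only [Matrix.mul_diagonal, Matrix.transpose_apply, noise, Matrix.of_apply]
      linear_combination -(B * R) a j * (B * R) b j * hsqrt j
  -- The noise outside `J` is exactly the slack of the Lyapunov inequality.
  have hlb := two_mul_topEntropy_le_trace (A := A + U * V) (B := noise J) (K := K)
    (hcl ▸ hM) hXp (by
      rw [← hcl]
      have h1 : -(closedLoop A B F T R * X + X * (closedLoop A B F T R)ᵀ +
          noise J * (noise J)ᵀ) = noise Jᶜ * (noise Jᶜ)ᵀ := by
        rw [hnoise, ← add_assoc, add_right_comm] at hX
        exact neg_eq_of_add_eq_zero_right hX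
      rw [h1]
      simpa [conjTranspose_eq_transpose_of_trivial] using
        posSemidef_self_mul_conjTranspose (noise Jᶜ))
  have htr : (K * X * Kᵀ).trace = ∑ j ∈ J, inputPower A B F T R N j / N j := by
    rw [← Finset.sum_coe_sort J, Matrix.trace]
    refine Finset.sum_congr rfl fun j _ => ?_
    rw [inputPower_eq hM hXs hX, Matrix.diag_apply, Matrix.mul_apply, Matrix.mul_apply,
      Finset.sum_div]
    refine Finset.sum_congr rfl fun b _ => ?_
    rw [Matrix.mul_apply, Matrix.mul_apply, Finset.sum_mul, Finset.sum_mul, Finset.sum_div]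
    refine Finset.sum_congr rfl fun c _ => ?_
    simp only [K, Matrix.of_apply, Matrix.transpose_apply]
    rw [← hsqrt j]
    have := hsq0 j
    rw [Real.sqrt_mul_self (Real.sqrt_nonneg _)]
    field_simp
  have hlt : ∑ j ∈ J, inputPower A B F T R N j / N j < ∑ j ∈ J, P j / N j :=
    Finset.sum_lt_sum_of_nonempty hJ fun j _ => div_lt_div_of_pos_right (hpow j) (hN j)
  have hrank := D.sum_topEntropy_le_of_rank U V
  have hcard : Fintype.card (Jᶜ : Finset (Fin l)) = l - J.card := by
    rw [Fintype.card_coe, Finset.card_compl, Fintype.card_fin]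
  rw [hcard] at hrank
  have h1 := (D.sum_entropyVector_le (l := l) (r := l - J.card)).trans hrank
  have h2 : ∑ i ∈ J, capacity P N i = 1 / 2 * ∑ j ∈ J, P j / N j := by
    rw [Finset.mul_sum]; rfl
  rw [h2]
  linarith

end Necessity

/-! ### Congruence, Schur complements and openness of positive definiteness. -/

section PosDef

variable {ι κ : Type} [Fintype ι] [Fintype κ]

theorem posDef_conj {P : Matrix ι ι ℝ} (hP : P.PosDef) [DecidableEq κ] {S : Matrix κ ι ℝ}
    {S' : Matrix ι κ ℝ} (h : S * S' = 1) : (S * P * Sᵀ).PosDef := by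
  have := hP.mul_mul_conjTranspose_same (B := S) (by
    intro v w hvw
    have h1 := congrArg (fun u => u ᵥ* S') hvw
    simpa [Matrix.vecMul_vecMul, h] using h1)
  simpa [conjTranspose_eq_transpose_of_trivial] using this

theorem posDef_fromBlocks_diagonal {P : Matrix ι ι ℝ} {Q : Matrix κ κ ℝ} (hP : P.PosDef)
    (hQ : Q.PosDef) : (fromBlocks P 0 0 Q).PosDef := by
  rw [posDef_iff_real] at *
  refine ⟨by simp [fromBlocks_transpose, hP.1, hQ.1], fun v hv => ?_⟩
  have hP' : ∀ u : ι → ℝ, 0 ≤ u ⬝ᵥ P *ᵥ u := fun u =>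
    (posSemidef_iff_real.1 (posDef_iff_real.2 hP).posSemidef).2 u
  have hQ' : ∀ u : κ → ℝ, 0 ≤ u ⬝ᵥ Q *ᵥ u := fun u =>
    (posSemidef_iff_real.1 (posDef_iff_real.2 hQ).posSemidef).2 u
  obtain ⟨x, y, rfl⟩ : ∃ x y, v = Sum.elim x y :=
    ⟨v ∘ Sum.inl, v ∘ Sum.inr, (Sum.elim_comp_inl_inr v).symm⟩
  rw [fromBlocks_mulVec, Sum.elim_comp_inl, Sum.elim_comp_inr, sumElim_dotProduct_sumElim]
  simp only [Matrix.zero_mulVec, add_zero, zero_add]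
  by_cases hx : x = 0
  · have hy : y ≠ 0 := by
      rintro rfl
      exact hv (by rw [hx]; ext i; cases i <;> rfl)
    exact add_pos_of_nonneg_of_pos (hP' x) (hQ.2 y hy)
  · exact add_pos_of_pos_of_nonneg (hP.2 x hx) (hQ' y)

theorem posDef_fromBlocks_of_schur [DecidableEq ι] [DecidableEq κ] {X : Matrix ι ι ℝ}
    {B : Matrix ι κ ℝ} {H : Matrix κ κ ℝ} (hX : X.PosDef) (h : (H - Bᵀ * X⁻¹ * B).PosDef) :
    (fromBlocks X B Bᵀ H).PosDef := by
  have hd := (Matrix.isUnit_iff_isUnit_det _).1 hX.isUnit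
  have e1 : X * X⁻¹ = 1 := Matrix.mul_nonsing_inv _ hd
  have e2 : X⁻¹ * X = 1 := Matrix.nonsing_inv_mul _ hd
  have hXt : Xᵀ = X := (posDef_iff_real.1 hX).1
  have h1 := posDef_conj (posDef_fromBlocks_diagonal hX h)
    (S := fromBlocks (1 : Matrix ι ι ℝ) 0 (Bᵀ * X⁻¹) 1)
    (S' := fromBlocks (1 : Matrix ι ι ℝ) 0 (-(Bᵀ * X⁻¹)) 1) (by
      simp [fromBlocks_multiply])
  convert h1 using 1
  rw [fromBlocks_multiply, fromBlocks_transpose, fromBlocks_multiply]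
  simp only [Matrix.transpose_one, Matrix.transpose_zero, Matrix.transpose_mul,
    Matrix.transpose_transpose, Matrix.transpose_nonsing_inv, hXt, Matrix.one_mul, Matrix.mul_one,
    Matrix.zero_mul, Matrix.mul_zero, add_zero, zero_add]
  have e3 : X * (X⁻¹ * B) = B := by rw [← Matrix.mul_assoc, e1, Matrix.one_mul]
  have e4 : Bᵀ * X⁻¹ * X = Bᵀ := by rw [Matrix.mul_assoc, e2, Matrix.mul_one]
  rw [e3, e4, ← Matrix.mul_assoc]
  congr 1
  abel

theorem posSemidef_sub_of_fromBlocks [DecidableEq ι] {X : Matrix ι ι ℝ}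
    {B : Matrix ι κ ℝ} {H : Matrix κ κ ℝ} (hX : X.PosDef) (h : (fromBlocks X B Bᵀ H).PosDef) :
    (H - Bᵀ * X⁻¹ * B).PosSemidef := by
  have hi : Invertible X := hX.isUnit.invertible
  have := (hX.fromBlocks₁₁ B H).1 (by
    rw [conjTranspose_eq_transpose_of_trivial]; exact h.posSemidef)
  simpa [conjTranspose_eq_transpose_of_trivial] using this

open Filter Topology in
-- The quadratic form is continuous and positive on the compact unit sphere; homogeneity extends
-- this to all vectors.
theorem eventually_posDef {α : Type} {f : Filter α} {P : α → Matrix ι ι ℝ} {P₀ : Matrix ι ι ℝ}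
    (hsymm : ∀ t, (P t)ᵀ = P t) (hP : Tendsto P f (𝓝 P₀)) (h₀ : P₀.PosDef) :
    ∀ᶠ t in f, (P t).PosDef := by
  have h1 : ∀ᶠ Q in 𝓝 P₀, ∀ v ∈ Metric.sphere (0 : ι → ℝ) 1, 0 < v ⬝ᵥ Q *ᵥ v := by
    refine (isCompact_sphere (0 : ι → ℝ) 1).eventually_forall_of_forall_eventually ?_
    intro v hv
    have hcont : Continuous fun z : Matrix ι ι ℝ × (ι → ℝ) => z.2 ⬝ᵥ z.1 *ᵥ z.2 :=
      continuous_snd.dotProduct (continuous_fst.matrix_mulVec continuous_snd)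
    refine hcont.continuousAt.eventually_const_lt (show 0 < v ⬝ᵥ P₀ *ᵥ v from ?_)
    refine (posDef_iff_real.1 h₀).2 v fun h => ?_
    simp [h] at hv
  filter_upwards [hP.eventually h1] with t ht
  rw [posDef_iff_real]
  refine ⟨hsymm t, fun v hv => ?_⟩
  have hn : 0 < ‖v‖ := norm_pos_iff.2 hv
  have h2 := ht (‖v‖⁻¹ • v) (by simp [norm_smul, hn.ne'])
  rw [Matrix.mulVec_smul, smul_dotProduct, dotProduct_smul, smul_eq_mul, smul_eq_mul] at h2
  have h3 : 0 < ‖v‖⁻¹ := inv_pos.2 hn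
  exact pos_of_mul_pos_right (pos_of_mul_pos_right h2 h3.le) h3.le

end PosDef

/-! ### Strict Riccati inequalities and their composition. -/

section Riccati

set_option linter.unusedSectionVars false

variable {ι ι' ι₁ ι₂ κ κ' κ₁ κ₂ : Type} [Fintype ι] [DecidableEq ι] [Fintype ι'] [DecidableEq ι']
  [Fintype ι₁] [DecidableEq ι₁] [Fintype ι₂] [DecidableEq ι₂] [Fintype κ] [DecidableEq κ]
  [Fintype κ'] [DecidableEq κ'] [Fintype κ₁] [DecidableEq κ₁] [Fintype κ₂] [DecidableEq κ₂]

/-- The strict Riccati inequality `A X + X Aᵀ < B Bᵀ` has a positive definite solution with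
`Bᵀ X⁻¹ B < diag h`. -/
def RiccatiFeasible (A : Matrix ι ι ℝ) (B : Matrix ι κ ℝ) (h : κ → ℝ) : Prop :=
  ∃ X : Matrix ι ι ℝ, X.PosDef ∧ (fromBlocks X B Bᵀ (diagonal h)).PosDef ∧
    (B * Bᵀ - (A * X + X * Aᵀ)).PosDef

/-- Riccati feasibility up to a nonsingular transformation of the inputs. -/
def InputRiccatiFeasible (A : Matrix ι ι ℝ) (B : Matrix ι κ ℝ) (h : κ' → ℝ) : Prop :=
  ∃ (G : Matrix κ κ' ℝ) (G' : Matrix κ' κ ℝ), G * G' = 1 ∧ G' * G = 1 ∧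
    RiccatiFeasible A (B * G) h

theorem RiccatiFeasible.similar {A : Matrix ι ι ℝ} {A' : Matrix ι' ι' ℝ} {B : Matrix ι κ ℝ}
    {B' : Matrix ι' κ ℝ} {h : κ → ℝ} (H : RiccatiFeasible A' B' h) {S : Matrix ι ι' ℝ}
    {S' : Matrix ι' ι ℝ} (hS : S * S' = 1) (hA : A * S = S * A') (hB : B = S * B') :
    RiccatiFeasible A B h := by
  obtain ⟨X, h1, h2, h3⟩ := H
  refine ⟨S * X * Sᵀ, posDef_conj h1 hS, ?_, ?_⟩
  · have := posDef_conj h2 (S := fromBlocks S 0 0 (1 : Matrix κ κ ℝ))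
      (S' := fromBlocks S' 0 0 (1 : Matrix κ κ ℝ)) (by simp [fromBlocks_multiply, hS])
    convert this using 1
    simp [fromBlocks_multiply, fromBlocks_transpose, hB]
  · have := posDef_conj h3 hS
    convert this using 1
    have hAt : S * X * (A'ᵀ * Sᵀ) = S * X * (Sᵀ * Aᵀ) := by
      rw [← Matrix.transpose_mul, ← Matrix.transpose_mul, hA]
    simp only [hB, Matrix.transpose_mul, Matrix.mul_sub, Matrix.sub_mul, Matrix.mul_add,
      Matrix.add_mul, Matrix.mul_assoc] at hAt ⊢
    rw [hAt, ← Matrix.mul_assoc A, hA, Matrix.mul_assoc S A']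

open Filter Topology in
-- All inequalities are strict, so the same `X` serves for nearby input matrices. This absorbs small
-- couplings.
theorem RiccatiFeasible.eventually {α : Type} {f : Filter α} {A : Matrix ι ι ℝ}
    {B : Matrix ι κ ℝ} {h : κ → ℝ} (H : RiccatiFeasible A B h) {Bt : α → Matrix ι κ ℝ}
    (hB : Tendsto Bt f (𝓝 B)) : ∀ᶠ t in f, RiccatiFeasible A (Bt t) h := by
  obtain ⟨X, h1, h2, h3⟩ := H
  have hX := (posDef_iff_real.1 h1).1
  have e1 := eventually_posDef (P := fun t => fromBlocks X (Bt t) (Bt t)ᵀ (diagonal h)) (f := f)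
    (fun t => by simp [fromBlocks_transpose, hX]) (by
      have hc : Continuous fun Y : Matrix ι κ ℝ => fromBlocks X Y Yᵀ (diagonal h) :=
        continuous_const.matrix_fromBlocks continuous_id continuous_id.matrix_transpose
          continuous_const
      exact (hc.tendsto B).comp hB) h2
  have e2 := eventually_posDef (P := fun t => Bt t * (Bt t)ᵀ - (A * X + X * Aᵀ)) (f := f)
    (fun t => by simp [hX, add_comm]) (by
      have hc : Continuous fun Y : Matrix ι κ ℝ => Y * Yᵀ - (A * X + X * Aᵀ) :=
        (continuous_id.matrix_mul continuous_id.matrix_transpose).sub continuous_const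
      exact (hc.tendsto B).comp hB) h3
  filter_upwards [e1, e2] with t h4 h5
  exact ⟨X, h1, h4, h5⟩

theorem RiccatiFeasible.fromBlocks {A₁ : Matrix ι₁ ι₁ ℝ} {A₂ : Matrix ι₂ ι₂ ℝ}
    {B₁ : Matrix ι₁ κ₁ ℝ} {B₂ : Matrix ι₂ κ₂ ℝ} {h₁ : κ₁ → ℝ} {h₂ : κ₂ → ℝ}
    (H₁ : RiccatiFeasible A₁ B₁ h₁) (H₂ : RiccatiFeasible A₂ B₂ h₂) :
    RiccatiFeasible (fromBlocks A₁ 0 0 A₂) (fromBlocks B₁ 0 0 B₂) (Sum.elim h₁ h₂) := by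
  obtain ⟨X₁, a1, a2, a3⟩ := H₁
  obtain ⟨X₂, b1, b2, b3⟩ := H₂
  refine ⟨Matrix.fromBlocks X₁ 0 0 X₂, posDef_fromBlocks_diagonal a1 b1, ?_, ?_⟩
  · have := (posDef_fromBlocks_diagonal a2 b2).submatrix
      (e := Equiv.sumSumSumComm ι₁ ι₂ κ₁ κ₂) (Equiv.injective _)
    convert this using 1
    ext ((i | i) | (i | i)) ((j | j) | (j | j)) <;> simp [Matrix.diagonal_apply]
  · have := posDef_fromBlocks_diagonal a3 b3
    convert this using 1
    ext (i | i) (j | j) <;> simp [fromBlocks_multiply, fromBlocks_transpose]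

theorem RiccatiFeasible.reindex {A : Matrix ι ι ℝ} {B : Matrix ι κ ℝ} {h : κ → ℝ}
    (H : RiccatiFeasible A B h) (e : κ' ≃ κ) :
    RiccatiFeasible A (B.submatrix id e) (h ∘ e) := by
  obtain ⟨X, h1, h2, h3⟩ := H
  refine ⟨X, h1, ?_, ?_⟩
  · have := h2.submatrix (e := Equiv.sumCongr (Equiv.refl ι) e) (Equiv.injective _)
    convert this using 1
    ext (i | i) (j | j) <;> simp [Matrix.diagonal_apply]
  · convert h3 using 2
    ext i j
    simp [Matrix.mul_apply, e.sum_comp (fun k => B i k * B j k)]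

theorem riccatiFeasible_of_isEmpty [IsEmpty ι] (A : Matrix ι ι ℝ) (B : Matrix ι κ ℝ) {h : κ → ℝ}
    (hh : ∀ i, 0 < h i) : RiccatiFeasible A B h := by
  have hE : ∀ Y : Matrix ι ι ℝ, Y.PosDef := fun Y =>
    posDef_iff_real.2 ⟨Subsingleton.elim _ _, fun v hv => absurd (Subsingleton.elim _ _) hv⟩
  refine ⟨1, hE _, posDef_fromBlocks_of_schur (hE _) ?_, hE _⟩
  have : Bᵀ * (1 : Matrix ι ι ℝ)⁻¹ * B = 0 := by
    ext i j; simp [Matrix.mul_apply]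
  rw [this, sub_zero]
  exact PosDef.diagonal hh

theorem InputRiccatiFeasible.similar {A : Matrix ι ι ℝ} {A' : Matrix ι' ι' ℝ} {B : Matrix ι κ ℝ}
    {B' : Matrix ι' κ ℝ} {h : κ' → ℝ} (H : InputRiccatiFeasible A' B' h) {S : Matrix ι ι' ℝ}
    {S' : Matrix ι' ι ℝ} (hS : S * S' = 1) (hA : A * S = S * A') (hB : B = S * B') :
    InputRiccatiFeasible A B h := by
  obtain ⟨G, G', h1, h2, h3⟩ := H
  exact ⟨G, G', h1, h2, h3.similar hS hA (by rw [hB, Matrix.mul_assoc])⟩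

theorem InputRiccatiFeasible.of_mul {A : Matrix ι ι ℝ} {B : Matrix ι κ ℝ} {h : κ' → ℝ}
    {G : Matrix κ κ₁ ℝ} {G' : Matrix κ₁ κ ℝ} (h1 : G * G' = 1) (h2 : G' * G = 1)
    (H : InputRiccatiFeasible A (B * G) h) : InputRiccatiFeasible A B h := by
  obtain ⟨G₂, G₂', h3, h4, h5⟩ := H
  refine ⟨G * G₂, G₂' * G', ?_, ?_, by rwa [← Matrix.mul_assoc]⟩
  · rw [Matrix.mul_assoc, ← Matrix.mul_assoc G₂, h3, Matrix.one_mul, h1]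
  · rw [Matrix.mul_assoc, ← Matrix.mul_assoc G', h2, Matrix.one_mul, h4]

theorem InputRiccatiFeasible.reindex {A : Matrix ι ι ℝ} {B : Matrix ι κ ℝ} {h : κ' → ℝ}
    (H : InputRiccatiFeasible A B h) (e : κ₁ ≃ κ') : InputRiccatiFeasible A B (h ∘ e) := by
  obtain ⟨G, G', h1, h2, h3⟩ := H
  refine ⟨G.submatrix id e, G'.submatrix e id, ?_, ?_, ?_⟩
  · rw [Matrix.submatrix_mul_equiv, h1]; simp
  · rw [← Matrix.submatrix_mul _ _ _ _ _ Function.bijective_id, h2]; simp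
  · have := h3.reindex e
    rwa [Matrix.submatrix_mul B G id id e Function.bijective_id, Matrix.submatrix_id_id] at this

open Filter Topology in
/-- Block triangular input matrices: the coupling block can be scaled away. -/
theorem InputRiccatiFeasible.fromBlocks_upper {A₁ : Matrix ι₁ ι₁ ℝ} {A₂ : Matrix ι₂ ι₂ ℝ}
    {B₁₁ : Matrix ι₁ κ₁ ℝ} {B₂₂ : Matrix ι₂ κ₂ ℝ} {h₁ : κ₁ → ℝ} {h₂ : κ' → ℝ}
    (H₁ : RiccatiFeasible A₁ B₁₁ h₁) (H₂ : InputRiccatiFeasible A₂ B₂₂ h₂)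
    (B₁₂ : Matrix ι₁ κ₂ ℝ) :
    InputRiccatiFeasible (fromBlocks A₁ 0 0 A₂) (fromBlocks B₁₁ B₁₂ 0 B₂₂) (Sum.elim h₁ h₂) := by
  obtain ⟨G, G', h1, h2, h3⟩ := H₂
  have h4 := (H₁.fromBlocks h3).eventually (f := 𝓝[>] (0 : ℝ))
    (Bt := fun ε => Matrix.fromBlocks B₁₁ (ε • (B₁₂ * G)) 0 (B₂₂ * G)) (by
      have hc : Continuous fun ε : ℝ => Matrix.fromBlocks B₁₁ (ε • (B₁₂ * G)) 0 (B₂₂ * G) :=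
        continuous_const.matrix_fromBlocks (continuous_id.smul continuous_const) continuous_const
          continuous_const
      have := (hc.tendsto 0).mono_left (nhdsWithin_le_nhds (s := Set.Ioi 0))
      simpa using this)
  obtain ⟨ε, h5, hε⟩ := (h4.and self_mem_nhdsWithin).exists
  have hε' : ε ≠ 0 := (show 0 < ε from hε).ne'
  -- Scaling the first state block and the first inputs both by `ε⁻¹` preserves `B₁₁` and turns the
  -- coupling `ε B₁₂ G` back into `B₁₂ G`.
  refine ⟨Matrix.fromBlocks (ε⁻¹ • (1 : Matrix κ₁ κ₁ ℝ)) 0 0 G,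
    Matrix.fromBlocks (ε • (1 : Matrix κ₁ κ₁ ℝ)) 0 0 G', ?_, ?_, ?_⟩
  · simp [fromBlocks_multiply, smul_smul, hε', h1]
  · simp [fromBlocks_multiply, smul_smul, hε', h2]
  · refine h5.similar (S := Matrix.fromBlocks (ε⁻¹ • (1 : Matrix ι₁ ι₁ ℝ)) 0 0 1)
      (S' := Matrix.fromBlocks (ε • (1 : Matrix ι₁ ι₁ ℝ)) 0 0 1) ?_ ?_ ?_
    · simp [fromBlocks_multiply, smul_smul, hε']
    · simp [fromBlocks_multiply]
    · simp [fromBlocks_multiply, smul_smul, hε']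

open Filter Topology in
/-- A Hurwitz direct summand of the state matrix can be ignored. -/
theorem InputRiccatiFeasible.fromRows_of_isHurwitz {A₁ : Matrix ι₁ ι₁ ℝ} {A₂ : Matrix ι₂ ι₂ ℝ}
    {B₂ : Matrix ι₂ κ ℝ} {h : κ' → ℝ} (hA : IsHurwitz A₁) (H : InputRiccatiFeasible A₂ B₂ h)
    (B₁ : Matrix ι₁ κ ℝ) :
    InputRiccatiFeasible (fromBlocks A₁ 0 0 A₂) (fromRows B₁ B₂) h := by
  obtain ⟨G, G', h1, h2, h3⟩ := H
  obtain ⟨X, hXs, hX⟩ := exists_lyapunov (Q := 1) hA (by simp)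
  have hXp := posDef_of_lyapunov hA hXs PosDef.one hX
  -- A Hurwitz block is feasible with no input at all, its Lyapunov solution being the certificate.
  -- The rows `B₁` are then a small coupling after rescaling of the state.
  have h0 : RiccatiFeasible A₁ (0 : Matrix ι₁ Empty ℝ) (fun _ => 1) := by
    refine ⟨X, hXp, posDef_fromBlocks_of_schur hXp ?_, ?_⟩
    · exact posDef_iff_real.2 ⟨Subsingleton.elim _ _, fun v hv => absurd (Subsingleton.elim _ _) hv⟩
    · have : (1 : Matrix ι₁ ι₁ ℝ) = -(A₁ * X + X * A₁ᵀ) := by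
        rw [eq_neg_iff_add_eq_zero, add_comm]; exact hX
      rw [Matrix.zero_mul, zero_sub, ← this]
      exact PosDef.one
  have h4 : RiccatiFeasible (Matrix.fromBlocks A₁ 0 0 A₂) (fromRows 0 (B₂ * G)) h := by
    have := (h0.fromBlocks h3).reindex (Equiv.emptySum Empty κ').symm
    convert this using 1
    · ext (i | i) j <;> simp
    · ext j; simp
  have h5 := h4.eventually (f := 𝓝[>] (0 : ℝ)) (Bt := fun ε => fromRows (ε • (B₁ * G)) (B₂ * G)) (by
      have hc : Continuous fun ε : ℝ => fromRows (ε • (B₁ * G)) (B₂ * G) := by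
        refine continuous_matrix fun i j => ?_
        rcases i with i | i
        · simp only [fromRows_apply_inl, Matrix.smul_apply]; fun_prop
        · simp only [fromRows_apply_inr]; fun_prop
      have := (hc.tendsto 0).mono_left (nhdsWithin_le_nhds (s := Set.Ioi 0))
      simpa using this)
  obtain ⟨ε, h6, hε⟩ := (h5.and self_mem_nhdsWithin).exists
  have hε' : ε ≠ 0 := (show 0 < ε from hε).ne'
  refine ⟨G, G', h1, h2, h6.similar (S := Matrix.fromBlocks (ε⁻¹ • (1 : Matrix ι₁ ι₁ ℝ)) 0 0 1)
      (S' := Matrix.fromBlocks (ε • (1 : Matrix ι₁ ι₁ ℝ)) 0 0 1) ?_ ?_ ?_⟩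
  · simp [fromBlocks_multiply, smul_smul, hε']
  · simp [fromBlocks_multiply]
  · rw [fromRows_mul, fromBlocks_mul_fromRows]
    simp [smul_smul, hε']

end Riccati

/-! ### Controllability, cyclic vectors and the single-input case. -/

section Controllability

set_option linter.unusedSectionVars false

variable {ι ι₁ ι₂ κ : Type} [Fintype ι] [DecidableEq ι] [Fintype ι₁] [DecidableEq ι₁]
  [Fintype ι₂] [DecidableEq ι₂] [Fintype κ] [DecidableEq κ]

/-- No nonzero row vector annihilates all the `A ^ i * B`. -/
def IsControllable (A : Matrix ι ι ℝ) (B : Matrix ι κ ℝ) : Prop :=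
  ∀ v : ι → ℝ, (∀ i : ℕ, v ᵥ* (A ^ i * B) = 0) → v = 0

/-- The vector `b` generates the space under `A`. -/
def IsCyclicVector (A : Matrix ι ι ℝ) (b : ι → ℝ) : Prop :=
  ∀ x : ι → ℝ, ∃ p : ℝ[X], aeval A p *ᵥ b = x

theorem vecMul_aeval_mul {A : Matrix ι ι ℝ} {B : Matrix ι κ ℝ} {v : ι → ℝ}
    (h : ∀ i : ℕ, v ᵥ* (A ^ i * B) = 0) (p : ℝ[X]) : v ᵥ* (aeval A p * B) = 0 := by
  rw [aeval_eq_sum_range, Matrix.sum_mul, Matrix.vecMul_sum]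
  refine Finset.sum_eq_zero fun i _ => ?_
  rw [Matrix.smul_mul, Matrix.vecMul_smul, h i, smul_zero]

theorem IsCyclicVector.isControllable {A : Matrix ι ι ℝ} {b : ι → ℝ} (h : IsCyclicVector A b) :
    IsControllable A (replicateCol Unit b) := by
  intro v hv
  rw [← dotProduct_self_eq_zero]
  obtain ⟨p, hp⟩ := h v
  have h1 := congrFun (vecMul_aeval_mul hv p) ()
  rw [← Matrix.vecMul_vecMul] at h1
  have h2 : (v ᵥ* aeval A p) ⬝ᵥ b = 0 := h1
  rwa [← dotProduct_mulVec, hp] at h2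

theorem isHurwitz_neg_add {A : Matrix ι ι ℝ}
    (hA : ∀ z : ℂ, (A.charpoly.map Complex.ofRealHom).IsRoot z → 0 ≤ z.re) {ε : ℝ} (hε : 0 < ε) :
    IsHurwitz (-(A + ε • (1 : Matrix ι ι ℝ))) := by
  rw [isHurwitz_iff_charpoly]
  intro z hz
  have h1 : aeval (-(A + ε • (1 : Matrix ι ι ℝ))) (A.charpoly.comp (-Polynomial.X - C ε)) = 0 := by
    rw [aeval_comp]
    have : aeval (-(A + ε • (1 : Matrix ι ι ℝ))) (-Polynomial.X - C ε : ℝ[X]) = A := by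
      simp [Algebra.algebraMap_eq_smul_one]
    rw [this, Matrix.aeval_self_charpoly]
  have h2 := isRoot_of_isRoot_charpoly h1 hz
  rw [IsRoot, Polynomial.map_comp, eval_comp] at h2
  have h3 := hA _ h2
  simp at h3
  linarith

/-- `X` is the Gramian of the time-reversed plant, shifted by `ε` so that imaginary eigenvalues are
allowed: `A X + X Aᵀ + 2 ε X = B Bᵀ`. The term `2 ε X` gives the strictness, and the `1 × 1` matrix
`Bᵀ X⁻¹ B` equals its trace, `2 tr A + 2 ε dim`. -/
theorem riccatiFeasible_of_cyclicVector {A : Matrix ι ι ℝ} {b : ι → ℝ} (hb : IsCyclicVector A b)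
    (hA : ∀ z : ℂ, (A.charpoly.map Complex.ofRealHom).IsRoot z → 0 ≤ z.re) {h : ℝ}
    (hh : 2 * A.trace < h) : RiccatiFeasible A (replicateCol Unit b) (fun _ => h) := by
  set B := replicateCol Unit b with hB
  obtain ⟨ε, hε, hεh⟩ : ∃ ε : ℝ, 0 < ε ∧ 2 * A.trace + 2 * ε * Fintype.card ι < h := by
    refine ⟨(h - 2 * A.trace) / (2 * (Fintype.card ι + 1)), ?_, ?_⟩
    · exact div_pos (by linarith) (by positivity)
    · have h0 : (0 : ℝ) ≤ Fintype.card ι := Nat.cast_nonneg _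
      have h1 : 0 < h - 2 * A.trace := by linarith
      have h2 : 2 * ((h - 2 * A.trace) / (2 * (Fintype.card ι + 1))) * Fintype.card ι =
          (h - 2 * A.trace) * (Fintype.card ι / (Fintype.card ι + 1)) := by field_simp
      have h3 : (Fintype.card ι : ℝ) / (Fintype.card ι + 1) < 1 := by
        rw [div_lt_one (by positivity)]; linarith
      rw [h2]
      nlinarith
  have hBB : (B * Bᵀ).PosSemidef := by
    simpa [conjTranspose_eq_transpose_of_trivial] using posSemidef_self_mul_conjTranspose B
  have hM := isHurwitz_neg_add hA hε
  obtain ⟨X, hXs, hX⟩ := exists_lyapunov (Q := B * Bᵀ) hM (by simp)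
  have hXp := posSemidef_of_lyapunov hM hXs hBB hX
  have hX' : A * X + X * Aᵀ + (2 * ε) • X = B * Bᵀ := by
    have h1 : B * Bᵀ = -(-(A + ε • (1 : Matrix ι ι ℝ)) * X +
        X * (-(A + ε • (1 : Matrix ι ι ℝ)))ᵀ) := by
      rw [eq_neg_iff_add_eq_zero, add_comm]; exact hX
    rw [h1]
    simp only [Matrix.neg_mul, Matrix.add_mul, Matrix.smul_mul, Matrix.one_mul, transpose_neg,
      transpose_add, transpose_smul, transpose_one, Matrix.mul_neg, Matrix.mul_add,
      Matrix.mul_smul, Matrix.mul_one, two_mul, add_smul]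
    abel
  -- The left kernel of `X` is invariant under `A` and annihilates `B`, so controllability makes it
  -- trivial.
  have hstep : ∀ w : ι → ℝ, w ᵥ* X = 0 → w ᵥ* B = 0 ∧ (w ᵥ* A) ᵥ* X = 0 := by
    intro w hw
    have hw' : X *ᵥ w = 0 := by rw [← hXs, Matrix.mulVec_transpose, hw]
    have h1 : w ᵥ* (A * X + X * Aᵀ + (2 * ε) • X) = (w ᵥ* A) ᵥ* X := by
      rw [Matrix.vecMul_add, Matrix.vecMul_add, ← Matrix.vecMul_vecMul, ← Matrix.vecMul_vecMul, hw,
        Matrix.zero_vecMul, Matrix.vecMul_smul, hw]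
      simp
    have h2 : (w ᵥ* A) ᵥ* X = (w ᵥ* B) ᵥ* Bᵀ := by rw [← h1, hX', Matrix.vecMul_vecMul]
    have h3 : (w ᵥ* B) ⬝ᵥ (w ᵥ* B) = 0 := by
      have h4 := congrArg (fun u => u ⬝ᵥ w) h2
      rw [← dotProduct_mulVec, hw', dotProduct_zero, ← dotProduct_mulVec,
        Matrix.mulVec_transpose] at h4
      exact h4.symm
    have h4 := dotProduct_self_eq_zero.1 h3
    exact ⟨h4, by rw [h2, h4, Matrix.zero_vecMul]⟩
  have hXpd : X.PosDef := by
    refine posDef_of_posSemidef hXp fun v hv => hb.isControllable v fun i => ?_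
    have h1 : ∀ i : ℕ, (v ᵥ* A ^ i) ᵥ* X = 0 := by
      intro i
      induction i with
      | zero => rw [pow_zero, Matrix.vecMul_one, ← hXs, Matrix.vecMul_transpose, hv]
      | succ i ih => rw [pow_succ, ← Matrix.vecMul_vecMul]; exact (hstep _ ih).2
    rw [← Matrix.vecMul_vecMul]
    exact (hstep _ (h1 i)).1
  refine ⟨X, hXpd, posDef_fromBlocks_of_schur hXpd ?_, ?_⟩
  · have hd := (Matrix.isUnit_iff_isUnit_det _).1 hXpd.isUnit
    have e1 : X * X⁻¹ = 1 := Matrix.mul_nonsing_inv _ hd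
    have e2 : X⁻¹ * X = 1 := Matrix.nonsing_inv_mul _ hd
    have htr : (Bᵀ * X⁻¹ * B).trace = 2 * A.trace + 2 * ε * Fintype.card ι := by
      rw [Matrix.mul_assoc, Matrix.trace_mul_comm, Matrix.mul_assoc, ← hX', Matrix.mul_add,
        Matrix.mul_add, Matrix.trace_add, Matrix.trace_add, ← Matrix.mul_assoc,
        Matrix.trace_mul_comm (X⁻¹ * A), ← Matrix.mul_assoc, e1, Matrix.one_mul,
        ← Matrix.mul_assoc, e2, Matrix.one_mul, Matrix.trace_transpose, Matrix.mul_smul, e2,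
        Matrix.trace_smul, Matrix.trace_one, smul_eq_mul]
      ring
    have hdiag : diagonal (fun _ : Unit => h) - Bᵀ * X⁻¹ * B =
        diagonal (fun _ : Unit => h - (Bᵀ * X⁻¹ * B).trace) := by
      ext i j
      simp [Matrix.trace]
    rw [hdiag, htr]
    exact PosDef.diagonal fun _ => by linarith
  · rw [← hX']
    have : A * X + X * Aᵀ + (2 * ε) • X - (A * X + X * Aᵀ) = (2 * ε) • X := by abel
    rw [this]
    exact hXpd.smul (by linarith)

/-- On polynomials of degree below the dimension, `p ↦ p(A) b` is injective, hence surjective by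
equality of dimensions. -/
theorem isCyclicVector_of_annihilator {A : Matrix ι ι ℝ} (hA : IsCyclicMatrix A) {b : ι → ℝ}
    (hb : ∀ p : ℝ[X], aeval A p *ᵥ b = 0 → minpoly ℝ A ∣ p) : IsCyclicVector A b := by
  let φ : degreeLT ℝ (Fintype.card ι) →ₗ[ℝ] (ι → ℝ) :=
    { toFun := fun p => aeval A (p : ℝ[X]) *ᵥ b
      map_add' := fun p q => by simp [Matrix.add_mulVec]
      map_smul' := fun c p => by simp [Matrix.smul_mulVec] }
  have hinj : Function.Injective φ := by
    rw [← LinearMap.ker_eq_bot, LinearMap.ker_eq_bot']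
    rintro ⟨p, hp⟩ hp0
    have h1 := hb p hp0
    rw [mem_degreeLT, ← hA] at hp
    have h2 := Polynomial.eq_zero_of_dvd_of_degree_lt h1 (by
      rw [Polynomial.degree_eq_natDegree
        (minpoly.ne_zero (Algebra.IsIntegral.isIntegral (R := ℝ) A))]
      exact hp)
    exact Subtype.ext h2
  have hfin : FiniteDimensional ℝ (degreeLT ℝ (Fintype.card ι)) :=
    LinearEquiv.finiteDimensional (degreeLTEquiv ℝ (Fintype.card ι)).symm
  have hrank : Module.finrank ℝ (degreeLT ℝ (Fintype.card ι)) = Module.finrank ℝ (ι → ℝ) := by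
    rw [(degreeLTEquiv ℝ (Fintype.card ι)).finrank_eq]; simp
  have hsurj := (LinearMap.injective_iff_surjective_of_finrank_eq_finrank hrank).1 hinj
  intro x
  obtain ⟨p, hp⟩ := hsurj x
  exact ⟨p, hp⟩

/-- A generic combination of the inputs of a controllable system with cyclic state matrix has the
minimal polynomial as its annihilator. -/
theorem exists_annihilator_eq_minpoly [Nonempty κ] {A : Matrix ι ι ℝ} {B : Matrix ι κ ℝ}
    (hAB : IsControllable A B) : ∃ g : κ → ℝ, g ≠ 0 ∧
      ∀ p : ℝ[X], aeval A p *ᵥ (B *ᵥ g) = 0 → minpoly ℝ A ∣ p := by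
  classical
  set α := minpoly ℝ A with hα
  have hα0 : α ≠ 0 := minpoly.ne_zero (Algebra.IsIntegral.isIntegral (R := ℝ) A)
  let K : ℝ[X] → Submodule ℝ (κ → ℝ) := fun q => LinearMap.ker (Matrix.mulVecLin (aeval A q * B))
  have hK : ∀ q : ℝ[X], K q = ⊤ → α ∣ q := by
    intro q hq
    have h1 : aeval A q * B = 0 := by
      have h2 := LinearMap.ker_eq_top.1 hq
      rw [← Matrix.toLin'_apply'] at h2
      exact (LinearEquiv.map_eq_zero_iff _).1 h2
    refine minpoly.dvd ℝ A ?_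
    ext i j
    have h3 : (Pi.single i 1 : ι → ℝ) ᵥ* aeval A q = 0 := by
      refine hAB _ fun t => ?_
      have hc : A ^ t * aeval A q = aeval A q * A ^ t := by
        have : A ^ t = aeval A (Polynomial.X ^ t : ℝ[X]) := by simp
        rw [this, ← map_mul, mul_comm, map_mul]
      rw [Matrix.vecMul_vecMul, ← Matrix.mul_assoc, ← hc, Matrix.mul_assoc, h1, Matrix.mul_zero,
        Matrix.vecMul_zero]
    have := congrFun h3 j
    simpa using this
  -- The bad directions are the kernels of `(α / p)(A) B` for the prime factors `p` of `α`.
  -- Controllability makes each of them proper, and finitely many proper subspaces do not cover the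
  -- space. Adding `⊥` forces `g ≠ 0`.
  let s : Finset (Submodule ℝ (κ → ℝ)) :=
    insert ⊥ ((UniqueFactorizationMonoid.normalizedFactors α).toFinset.image fun p => K (α / p))
  have hs : ⊤ ∉ s := by
    rw [Finset.mem_insert, not_or]
    refine ⟨top_ne_bot, ?_⟩
    rw [Finset.mem_image]
    rintro ⟨p, hp, hpt⟩
    rw [Multiset.mem_toFinset] at hp
    have hirr := UniqueFactorizationMonoid.irreducible_of_normalized_factor p hp
    have hdvd := UniqueFactorizationMonoid.dvd_of_mem_normalizedFactors hp
    have h1 := hK _ hpt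
    have h2 : p * (α / p) = α := EuclideanDomain.mul_div_cancel' hirr.ne_zero hdvd
    obtain ⟨r, hr⟩ := h1
    have h3 : α * (p * r) = α * 1 := by
      calc α * (p * r) = p * (α * r) := by ring
        _ = α * 1 := by rw [← hr, h2, mul_one]
    exact hirr.not_isUnit (IsUnit.of_mul_eq_one r (mul_left_cancel₀ hα0 h3))
  have hne := Subspace.biUnion_ne_univ_of_top_notMem (k := ℝ) hs
  obtain ⟨g, hg⟩ := (Set.ne_univ_iff_exists_notMem _).1 hne
  simp only [Set.mem_iUnion, not_exists, SetLike.mem_coe] at hg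
  refine ⟨g, fun h0 => hg ⊥ (Finset.mem_insert_self _ _) (by simp [h0]), fun r hr => ?_⟩
  -- The gcd with `α` also annihilates `B g`. If it were a proper divisor of `α`, it would divide
  -- some `α / q` with `q` prime, and `g` would be bad.
  set d := EuclideanDomain.gcd α r with hd
  have hdb : aeval A d *ᵥ (B *ᵥ g) = 0 := by
    rw [hd, EuclideanDomain.gcd_eq_gcd_ab, map_add, map_mul, map_mul, hα, minpoly.aeval, zero_mul,
      zero_add, ← map_mul, mul_comm, map_mul, ← Matrix.mulVec_mulVec, hr, Matrix.mulVec_zero]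
  obtain ⟨e, he⟩ : d ∣ α := EuclideanDomain.gcd_dvd_left α r
  have hdr : d ∣ r := EuclideanDomain.gcd_dvd_right α r
  by_cases hu : IsUnit e
  · exact (he ▸ (hu.mul_right_dvd).2 hdr)
  · exfalso
    have he0 : e ≠ 0 := fun h => hα0 (by rw [he, h, mul_zero])
    obtain ⟨p, hp, hpe⟩ := WfDvdMonoid.exists_irreducible_factor hu he0
    obtain ⟨q, hq, hpq⟩ := UniqueFactorizationMonoid.exists_mem_normalizedFactors_of_dvd hα0 hp
      (hpe.trans ⟨d, by rw [he, mul_comm]⟩)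
    obtain ⟨e', he'⟩ : q ∣ e := hpq.symm.dvd.trans hpe
    have hq0 : q ≠ 0 := fun h => he0 (by rw [he', h, zero_mul])
    refine hg (K (α / q)) (Finset.mem_insert_of_mem
      (Finset.mem_image_of_mem _ (Multiset.mem_toFinset.2 hq))) ?_
    have h1 : α / q = e' * d := by
      rw [he, he', show d * (q * e') = q * (e' * d) by ring,
        mul_div_cancel_left₀ _ hq0]
    rw [LinearMap.mem_ker, Matrix.mulVecLin_apply, h1, map_mul, ← Matrix.mulVec_mulVec,
      ← Matrix.mulVec_mulVec, hdb, Matrix.mulVec_zero]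

/-- `W` sends `p(A₁) b₁` to `p(A₂) b₂`. This is well defined: as `b₁` is cyclic, a polynomial
annihilating `b₁` annihilates `A₁`, so it is a multiple of the minimal polynomial and kills `A₂`. -/
theorem exists_intertwining {A₁ : Matrix ι₁ ι₁ ℝ} {A₂ : Matrix ι₂ ι₂ ℝ} {b₁ : ι₁ → ℝ}
    (h₁ : IsCyclicVector A₁ b₁) (h : aeval A₂ (minpoly ℝ A₁) = 0) (b₂ : ι₂ → ℝ) :
    ∃ W : Matrix ι₂ ι₁ ℝ, W * A₁ = A₂ * W ∧ W *ᵥ b₁ = b₂ := by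
  let φ : ℝ[X] →ₗ[ℝ] (ι₁ → ℝ) :=
    { toFun := fun p => aeval A₁ p *ᵥ b₁
      map_add' := fun p q => by simp [Matrix.add_mulVec]
      map_smul' := fun c p => by simp [Matrix.smul_mulVec] }
  let ψ : ℝ[X] →ₗ[ℝ] (ι₂ → ℝ) :=
    { toFun := fun p => aeval A₂ p *ᵥ b₂
      map_add' := fun p q => by simp [Matrix.add_mulVec]
      map_smul' := fun c p => by simp [Matrix.smul_mulVec] }
  have hker : ∀ p, φ p = 0 → ψ p = 0 := by
    intro p hp
    have h1 : aeval A₁ p = 0 := by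
      refine Matrix.toLin'.injective (LinearMap.ext fun x => ?_)
      obtain ⟨q, rfl⟩ := h₁ x
      rw [Matrix.toLin'_apply, Matrix.mulVec_mulVec, ← map_mul, mul_comm, map_mul,
        ← Matrix.mulVec_mulVec]
      have : aeval A₁ p *ᵥ b₁ = 0 := hp
      rw [this]; simp
    obtain ⟨r, hr⟩ := minpoly.dvd ℝ A₁ h1
    change aeval A₂ p *ᵥ b₂ = 0
    rw [hr, map_mul, h, zero_mul, Matrix.zero_mulVec]
  -- Since `ker φ ⊆ ker ψ`, the composite `ψ ∘ σ` does not depend on the chosen section `σ`.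
  obtain ⟨σ, hσ⟩ := φ.exists_rightInverse_of_surjective (LinearMap.range_eq_top.2 h₁)
  have hσ' : ∀ x, φ (σ x) = x := fun x => LinearMap.congr_fun hσ x
  have hW : ∀ p, ψ (σ (φ p)) = ψ p := by
    intro p
    rw [← sub_eq_zero, ← map_sub]
    exact hker _ (by rw [map_sub, hσ', sub_self])
  have hXφ : ∀ p, A₁ *ᵥ φ p = φ (Polynomial.X * p) := by
    intro p
    change A₁ *ᵥ (aeval A₁ p *ᵥ b₁) = aeval A₁ (Polynomial.X * p) *ᵥ b₁
    rw [map_mul, aeval_X, Matrix.mulVec_mulVec]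
  have hXψ : ∀ p, A₂ *ᵥ ψ p = ψ (Polynomial.X * p) := by
    intro p
    change A₂ *ᵥ (aeval A₂ p *ᵥ b₂) = aeval A₂ (Polynomial.X * p) *ᵥ b₂
    rw [map_mul, aeval_X, Matrix.mulVec_mulVec]
  refine ⟨LinearMap.toMatrix' (ψ ∘ₗ σ), ?_, ?_⟩
  · refine Matrix.toLin'.injective (LinearMap.ext fun x => ?_)
    obtain ⟨p, rfl⟩ := h₁ x
    change Matrix.toLin' _ (φ p) = Matrix.toLin' _ (φ p)
    rw [Matrix.toLin'_mul_apply, Matrix.toLin'_mul_apply, Matrix.toLin'_toMatrix',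
      Matrix.toLin'_apply, Matrix.toLin'_apply, hXφ, LinearMap.comp_apply, LinearMap.comp_apply,
      hW, hW, hXψ]
  · have h1 : b₁ = φ 1 := by change b₁ = aeval A₁ 1 *ᵥ b₁; simp
    have h2 : b₂ = ψ 1 := by change b₂ = aeval A₂ 1 *ᵥ b₂; simp
    rw [← Matrix.toLin'_apply, Matrix.toLin'_toMatrix', LinearMap.comp_apply, h1, hW, ← h2]

end Controllability

/-! ### Several inputs: triangularization along a chain of cyclic blocks. -/

section MultiInput

set_option linter.unusedSectionVars false

variable {ι ι' ι₁ ι₂ κ κ' : Type} [Fintype ι] [DecidableEq ι] [Fintype ι'] [DecidableEq ι']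
  [Fintype ι₁] [DecidableEq ι₁] [Fintype ι₂] [DecidableEq ι₂] [Fintype κ] [DecidableEq κ]
  [Fintype κ'] [DecidableEq κ']

theorem pow_mul_of_intertwining {A : Matrix ι ι ℝ} {A' : Matrix ι' ι' ℝ} {S : Matrix ι ι' ℝ}
    (h : A * S = S * A') (i : ℕ) : A ^ i * S = S * A' ^ i := by
  have := aeval_similar h (Polynomial.X ^ i)
  simpa using this

theorem IsControllable.similar {A : Matrix ι ι ℝ} {A' : Matrix ι' ι' ℝ} {B : Matrix ι κ ℝ}
    {B' : Matrix ι' κ ℝ} (H : IsControllable A B) {S : Matrix ι ι' ℝ} {S' : Matrix ι' ι ℝ}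
    (hS' : S' * S = 1) (hA : A * S = S * A') (hB : B = S * B') :
    IsControllable A' B' := by
  intro v hv
  have h1 : v ᵥ* S' = 0 := by
    refine H _ fun i => ?_
    have : S' * (A ^ i * B) = A' ^ i * B' := by
      rw [hB, ← Matrix.mul_assoc (A ^ i), pow_mul_of_intertwining hA, ← Matrix.mul_assoc,
        ← Matrix.mul_assoc, hS', Matrix.one_mul]
    rw [Matrix.vecMul_vecMul, this, hv i]
  have h2 := congrArg (fun u => u ᵥ* S) h1
  simpa [Matrix.vecMul_vecMul, hS'] using h2

theorem IsControllable.mul_right {A : Matrix ι ι ℝ} {B : Matrix ι κ ℝ} (H : IsControllable A B)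
    {G : Matrix κ κ' ℝ} {G' : Matrix κ' κ ℝ} (hG : G * G' = 1) : IsControllable A (B * G) := by
  intro v hv
  refine H v fun i => ?_
  have h1 := congrArg (fun u => u ᵥ* G') (hv i)
  simpa [Matrix.vecMul_vecMul, Matrix.mul_assoc, hG] using h1

theorem IsControllable.of_fromBlocks_left {A₁ : Matrix ι₁ ι₁ ℝ} {A₂ : Matrix ι₂ ι₂ ℝ}
    {B₁ : Matrix ι₁ κ ℝ} {B₂ : Matrix ι₂ κ ℝ}
    (H : IsControllable (fromBlocks A₁ 0 0 A₂) (fromRows B₁ B₂)) : IsControllable A₁ B₁ := by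
  intro v hv
  have h1 : Sum.elim v (0 : ι₂ → ℝ) = 0 := by
    refine H _ fun i => ?_
    rw [fromBlocks_diagonal_pow, fromBlocks_mul_fromRows, vecMul_fromRows]
    simp [hv i]
  ext i
  exact congrFun h1 (Sum.inl i)

theorem IsControllable.of_fromBlocks_right {A₁ : Matrix ι₁ ι₁ ℝ} {A₂ : Matrix ι₂ ι₂ ℝ}
    {B₁₁ : Matrix ι₁ κ ℝ} {B₁₂ : Matrix ι₁ κ' ℝ} {B₂₂ : Matrix ι₂ κ' ℝ}
    (H : IsControllable (fromBlocks A₁ 0 0 A₂) (fromBlocks B₁₁ B₁₂ 0 B₂₂)) :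
    IsControllable A₂ B₂₂ := by
  intro v hv
  have h1 : Sum.elim (0 : ι₁ → ℝ) v = 0 := by
    refine H _ fun i => ?_
    rw [fromBlocks_diagonal_pow, fromBlocks_multiply, vecMul_fromBlocks]
    ext (j | j) <;> simp [hv i]
  ext i
  exact congrFun h1 (Sum.inr i)

/-- An automorphism that carries a basis vector to `g` completes `g` to an invertible matrix. -/
theorem exists_invertible_col {m : ℕ} {g : Fin (m + 1) → ℝ} (hg : g ≠ 0) :
    ∃ (G : Matrix (Fin (m + 1)) (Unit ⊕ Fin m) ℝ) (G' : Matrix (Unit ⊕ Fin m) (Fin (m + 1)) ℝ),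
      G * G' = 1 ∧ G' * G = 1 ∧ ∀ i, G i (Sum.inl ()) = g i := by
  obtain ⟨f, hf⟩ := SeparatingDual.exists_continuousLinearEquiv_apply_eq (R := ℝ)
    (x := (Pi.single 0 1 : Fin (m + 1) → ℝ)) (y := g)
    (by intro h; simpa using congrFun h 0) hg
  let f' : (Fin (m + 1) → ℝ) ≃ₗ[ℝ] (Fin (m + 1) → ℝ) := f.toLinearEquiv
  let e : Unit ⊕ Fin m ≃ Fin (m + 1) :=
    ((finSuccEquiv m).trans ((Equiv.optionEquivSumPUnit (Fin m)).trans (Equiv.sumComm _ _))).symm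
  have h1 : LinearMap.toMatrix' (f' : (Fin (m + 1) → ℝ) →ₗ[ℝ] (Fin (m + 1) → ℝ)) *
      LinearMap.toMatrix' (f'.symm : (Fin (m + 1) → ℝ) →ₗ[ℝ] (Fin (m + 1) → ℝ)) = 1 := by
    rw [← LinearMap.toMatrix'_comp]; simp
  have h2 := mul_eq_one_comm.1 h1
  refine ⟨(LinearMap.toMatrix' (f' : (Fin (m + 1) → ℝ) →ₗ[ℝ] (Fin (m + 1) → ℝ))).submatrix id e,
    (LinearMap.toMatrix' (f'.symm : (Fin (m + 1) → ℝ) →ₗ[ℝ] (Fin (m + 1) → ℝ))).submatrix e id,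
    ?_, ?_, ?_⟩
  · rw [Matrix.submatrix_mul_equiv, h1]; simp
  · rw [← Matrix.submatrix_mul _ _ _ _ _ Function.bijective_id, h2]; simp
  · intro i
    have he : e (Sum.inl ()) = 0 := by simp [e]
    rw [Matrix.submatrix_apply, he, LinearMap.toMatrix'_apply]
    exact congrFun hf i

/-- A generic input direction `g` drives `A₁` cyclically. The shear by an intertwiner `W` commutes
with the state matrix and removes this input from the second block. The input matrix becomes block
upper triangular, and the remaining `m` inputs control `A₂`. -/
theorem inputRiccatiFeasible_fromBlocks {m : ℕ} {A₁ : Matrix ι₁ ι₁ ℝ} {A₂ : Matrix ι₂ ι₂ ℝ}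
    (hcyc : IsCyclicMatrix A₁)
    (hroot : ∀ z : ℂ, (A₁.charpoly.map Complex.ofRealHom).IsRoot z → 0 ≤ z.re)
    (hann : aeval A₂ (minpoly ℝ A₁) = 0) {B : Matrix (ι₁ ⊕ ι₂) (Fin (m + 1)) ℝ}
    (hB : IsControllable (fromBlocks A₁ 0 0 A₂) B) {h₂ : Fin m → ℝ}
    (ih : ∀ B₂ : Matrix ι₂ (Fin m) ℝ, IsControllable A₂ B₂ → InputRiccatiFeasible A₂ B₂ h₂)
    {h₁ : ℝ} (hh : 2 * A₁.trace < h₁) :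
    InputRiccatiFeasible (fromBlocks A₁ 0 0 A₂) B (Fin.cons h₁ h₂ : Fin (m + 1) → ℝ) := by
  have hB1 : IsControllable A₁ B.toRows₁ :=
    IsControllable.of_fromBlocks_left (B₂ := B.toRows₂) (by rwa [fromRows_toRows])
  obtain ⟨g, hg0, hg⟩ := exists_annihilator_eq_minpoly hB1
  have hcv := isCyclicVector_of_annihilator hcyc hg
  obtain ⟨G, G', hG, hG', hGg⟩ := exists_invertible_col hg0
  obtain ⟨W, hW, hWb⟩ := exists_intertwining hcv hann (B.toRows₂ *ᵥ g)
  set b := B.toRows₁ *ᵥ g with hb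
  let S : Matrix (ι₁ ⊕ ι₂) (ι₁ ⊕ ι₂) ℝ := fromBlocks 1 0 W 1
  let S' : Matrix (ι₁ ⊕ ι₂) (ι₁ ⊕ ι₂) ℝ := fromBlocks 1 0 (-W) 1
  have hS : S * S' = 1 := by simp [S, S', fromBlocks_multiply]
  have hS' : S' * S = 1 := by simp [S, S', fromBlocks_multiply]
  have hAS : fromBlocks A₁ 0 0 A₂ * S = S * fromBlocks A₁ 0 0 A₂ := by
    simp [S, fromBlocks_multiply, hW]
  let B₁₂ : Matrix ι₁ (Fin m) ℝ := (B * G).toBlocks₁₂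
  let B₂₂ : Matrix ι₂ (Fin m) ℝ := (B * G).toBlocks₂₂ - W * B₁₂
  have hBG : B * G = S * fromBlocks (replicateCol Unit b) B₁₂ 0 B₂₂ := by
    have h1 : (B * G).toBlocks₁₁ = replicateCol Unit b := by
      ext i j
      simp [Matrix.toBlocks₁₁, Matrix.mul_apply, hb, mulVec, dotProduct, hGg]
    have h2 : (B * G).toBlocks₂₁ = W * replicateCol Unit b := by
      rw [← Matrix.replicateCol_mulVec, hWb]
      ext i j
      simp [Matrix.toBlocks₂₁, Matrix.mul_apply, mulVec, dotProduct, hGg]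
    rw [← fromBlocks_toBlocks (B * G), h1, h2, fromBlocks_multiply]
    simp [B₁₂, B₂₂]
  have hc := ((hB.mul_right hG).similar hS' hAS hBG).of_fromBlocks_right
  have hf := InputRiccatiFeasible.fromBlocks_upper (riccatiFeasible_of_cyclicVector hcv hroot hh)
    (ih _ hc) B₁₂
  have hf' := (InputRiccatiFeasible.of_mul hG hG' (hf.similar hS hAS hBG)).reindex
    ((finSuccEquiv m).trans ((Equiv.optionEquivSumPUnit (Fin m)).trans (Equiv.sumComm _ _)))
  convert hf' using 1
  ext i
  refine Fin.cases ?_ (fun i => ?_) i <;> simp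

theorem inputRiccatiFeasible_of_submatrix {A : Matrix ι ι ℝ} {B : Matrix ι κ ℝ} {h : κ' → ℝ}
    (e : ι' ≃ ι) (H : InputRiccatiFeasible (A.submatrix e e) (B.submatrix e id) h) :
    InputRiccatiFeasible A B h := by
  refine H.similar (S := (1 : Matrix ι ι ℝ).submatrix id e)
    (S' := (1 : Matrix ι ι ℝ).submatrix e id) ?_ ?_ ?_
  · rw [Matrix.submatrix_mul_equiv]; simp
  · rw [Matrix.submatrix_mul_equiv, Matrix.one_mul]
    ext i j; simp [Matrix.mul_apply, Matrix.one_apply]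
  · rw [Matrix.submatrix_mul_equiv, Matrix.one_mul, Matrix.submatrix_id_id]

theorem IsControllable.submatrix {A : Matrix ι ι ℝ} {B : Matrix ι κ ℝ} (H : IsControllable A B)
    (e : ι' ≃ ι) : IsControllable (A.submatrix e e) (B.submatrix e id) := by
  refine H.similar (S := (1 : Matrix ι ι ℝ).submatrix id e)
    (S' := (1 : Matrix ι ι ℝ).submatrix e id) ?_ ?_ ?_
  · rw [← Matrix.submatrix_mul _ _ _ _ _ Function.bijective_id]; simp
  · rw [Matrix.submatrix_mul_equiv, Matrix.one_mul]
    ext i j; simp [Matrix.mul_apply, Matrix.one_apply]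
  · rw [Matrix.submatrix_mul_equiv, Matrix.one_mul, Matrix.submatrix_id_id]

/-- The first block of a block index against the others. -/
def sigmaFinSucc {k : ℕ} (d : Fin (k + 1) → ℕ) :
    Fin (d 0) ⊕ (Σ i : Fin k, Fin (d i.succ)) ≃ Σ i, Fin (d i) where
  toFun := Sum.elim (fun a => ⟨0, a⟩) fun x => ⟨x.1.succ, x.2⟩
  invFun := fun x => Fin.cases (motive := fun i => Fin (d i) →
    Fin (d 0) ⊕ (Σ i : Fin k, Fin (d i.succ))) Sum.inl (fun i a => Sum.inr ⟨i, a⟩) x.1 x.2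
  left_inv := by rintro (a | ⟨i, a⟩) <;> rfl
  right_inv := by
    rintro ⟨i, a⟩
    induction i using Fin.cases <;> rfl

theorem blockDiagonal_submatrix_sigmaFinSucc {k : ℕ} {d : Fin (k + 1) → ℕ}
    (A : ∀ i, Matrix (Fin (d i)) (Fin (d i)) ℝ) :
    (blockDiagonal' A).submatrix (sigmaFinSucc d) (sigmaFinSucc d) =
      fromBlocks (A 0) 0 0 (blockDiagonal' fun i : Fin k => A i.succ) := by
  ext (a | ⟨i, a⟩) (b | ⟨j, b⟩)
  · simp [sigmaFinSucc, blockDiagonal'_apply_eq]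
  · simp only [submatrix_apply, sigmaFinSucc, Equiv.coe_fn_mk, Sum.elim_inl, Sum.elim_inr,
      fromBlocks_apply₁₂, Matrix.zero_apply]
    exact blockDiagonal'_apply_ne _ _ _ (Fin.succ_ne_zero j).symm
  · simp only [submatrix_apply, sigmaFinSucc, Equiv.coe_fn_mk, Sum.elim_inl, Sum.elim_inr,
      fromBlocks_apply₂₁, Matrix.zero_apply]
    exact blockDiagonal'_apply_ne _ _ _ (Fin.succ_ne_zero i)
  · simp only [submatrix_apply, sigmaFinSucc, Equiv.coe_fn_mk, Sum.elim_inr, fromBlocks_apply₂₂]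
    by_cases hij : i = j
    · subst hij; rw [blockDiagonal'_apply_eq, blockDiagonal'_apply_eq]
    · rw [blockDiagonal'_apply_ne _ _ _ hij,
        blockDiagonal'_apply_ne _ _ _ (fun h => hij (Fin.succ_injective _ h))]

theorem aeval_blockDiagonal {k : ℕ} {d : Fin k → ℕ} (A : ∀ i, Matrix (Fin (d i)) (Fin (d i)) ℝ)
    (p : ℝ[X]) : aeval (blockDiagonal' A) p = blockDiagonal' fun i => aeval (A i) p := by
  induction p using Polynomial.induction_on' with
  | add p q hp hq =>
    simp only [map_add, hp, hq]
    rw [← blockDiagonal'_add]; rfl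
  | monomial n a =>
    simp only [aeval_monomial, Algebra.algebraMap_eq_smul_one, Matrix.smul_mul, Matrix.one_mul]
    rw [← blockDiagonal'_pow, ← blockDiagonal'_smul]; rfl

/-- A controllable system whose state matrix is a chain of cyclic blocks without stable modes can
be controlled with the `i`-th input power close to twice the trace of the `i`-th block. -/
theorem inputRiccatiFeasible_blockDiagonal {δ : ℝ} (hδ : 0 < δ) : ∀ (k : ℕ) (d : Fin k → ℕ)
    (A : ∀ i, Matrix (Fin (d i)) (Fin (d i)) ℝ) (_ : ∀ i, IsCyclicMatrix (A i))
    (_ : ∀ i j, i < j → aeval (A j) (minpoly ℝ (A i)) = 0)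
    (_ : ∀ i, ∀ z : ℂ, ((A i).charpoly.map Complex.ofRealHom).IsRoot z → 0 ≤ z.re) (m : ℕ)
    (B : Matrix (Σ i, Fin (d i)) (Fin m) ℝ) (_ : IsControllable (blockDiagonal' A) B),
    InputRiccatiFeasible (blockDiagonal' A) B
      (fun j : Fin m => (if h : (j : ℕ) < k then 2 * (A ⟨j, h⟩).trace else 0) + δ) := by
  intro k
  induction k with
  | zero =>
    intro d A _ _ _ m B _
    exact ⟨1, 1, by simp, by simp, riccatiFeasible_of_isEmpty _ _ (by simpa using fun _ => hδ)⟩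
  | succ k ih =>
    intro d A hcyc hann hroot m B hB
    cases m with
    | zero =>
      -- Without inputs every row vector is annihilated, so controllability leaves no states.
      have : IsEmpty (Σ i, Fin (d i)) := by
        by_contra hne
        rw [not_isEmpty_iff] at hne
        obtain ⟨x⟩ := hne
        have := hB (fun _ => 1) fun i => Subsingleton.elim _ _
        exact one_ne_zero (congrFun this x)
      exact ⟨1, 1, by simp, by simp, riccatiFeasible_of_isEmpty _ _ fun i => i.elim0⟩
    | succ m =>
      refine inputRiccatiFeasible_of_submatrix (sigmaFinSucc d) ?_
      have hB' := hB.submatrix (sigmaFinSucc d)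
      rw [blockDiagonal_submatrix_sigmaFinSucc] at hB' ⊢
      have h1 := inputRiccatiFeasible_fromBlocks (hcyc 0) (hroot 0) (by
        rw [aeval_blockDiagonal]
        have : (fun i : Fin k => aeval (A i.succ) (minpoly ℝ (A 0))) = 0 :=
          funext fun i => hann 0 i.succ (Fin.succ_pos i)
        rw [this, blockDiagonal'_zero]) hB' (fun B₂ hB₂ => ih (fun i => d i.succ)
          (fun i => A i.succ) (fun i => hcyc _) (fun i j hij => hann _ _ (Fin.succ_lt_succ_iff.2 hij))
          (fun i => hroot _) m B₂ hB₂) (h₁ := 2 * (A 0).trace + δ) (by linarith)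
      convert h1 using 1
      ext j
      refine Fin.cases ?_ (fun j => ?_) j
      · simp
        rfl
      · simp only [Fin.cons_succ, Fin.val_succ, Nat.add_lt_add_iff_right]
        rfl

end MultiInput

/-! ### Separating stable and antistable modes. -/

section Splitting

set_option linter.unusedSectionVars false

/-- An irreducible real polynomial with root `z` divides `(x - z)(x - z̄)`, so it lies entirely on
one side of the imaginary axis. -/
theorem re_eq_of_irreducible {p : ℝ[X]} (hp : Irreducible p) {z w : ℂ}
    (hz : (p.map Complex.ofRealHom).IsRoot z) (hw : (p.map Complex.ofRealHom).IsRoot w) :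
    w.re = z.re := by
  let q : ℝ[X] := X ^ 2 - C (2 * z.re) * X + C (Complex.normSq z)
  have hq : ∀ x : ℂ, aeval x q = (x - z) * (x - (starRingEnd ℂ) z) := by
    intro x
    have h1 : ((2 * z.re : ℝ) : ℂ) = z + (starRingEnd ℂ) z := by
      rw [Complex.add_conj]
    have h2 : ((Complex.normSq z : ℝ) : ℂ) = z * (starRingEnd ℂ) z := (Complex.mul_conj z).symm
    have h3 : aeval x q = x ^ 2 - ((2 * z.re : ℝ) : ℂ) * x + ((Complex.normSq z : ℝ) : ℂ) := by
      simp [q]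
    rw [h3, h1, h2]
    ring
  have hz' : aeval z p = 0 := by rw [aeval_def, ← eval_map]; exact hz
  have hw' : aeval w p = 0 := by rw [aeval_def, ← eval_map]; exact hw
  have h1 : p ∣ q := by
    have hint : IsIntegral ℝ z := Algebra.IsIntegral.isIntegral z
    have h2 := (minpoly.irreducible hint).associated_of_dvd hp (minpoly.dvd ℝ z hz')
    exact h2.symm.dvd.trans (minpoly.dvd ℝ z (by rw [hq]; simp))
  obtain ⟨r, hr⟩ := h1
  have h3 : (w - z) * (w - (starRingEnd ℂ) z) = 0 := by
    rw [← hq, hr, map_mul, hw', zero_mul]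
  rcases mul_eq_zero.1 h3 with h | h
  · rw [sub_eq_zero.1 h]
  · rw [sub_eq_zero.1 h, Complex.conj_re]

/-- Every real polynomial factors into a stable and an antistable polynomial. -/
theorem exists_stable_factorization (f : ℝ[X]) (hf : f ≠ 0) : ∃ p q : ℝ[X], f = p * q ∧
    (∀ z : ℂ, (p.map Complex.ofRealHom).IsRoot z → z.re < 0) ∧
    (∀ z : ℂ, (q.map Complex.ofRealHom).IsRoot z → 0 ≤ z.re) := by
  induction f using WfDvdMonoid.induction_on_irreducible with
  | zero => exact absurd rfl hf
  | unit u hu =>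
    obtain ⟨c, hc, rfl⟩ := Polynomial.isUnit_iff.1 hu
    refine ⟨1, C c, by simp, ?_, ?_⟩
    · intro z hz; simp [IsRoot] at hz
    · intro z hz
      simp only [IsRoot, Polynomial.map_C, eval_C] at hz
      exact absurd (by simpa using hz) hc.ne_zero
  | mul a i ha hi ih =>
    obtain ⟨p, q, hpq, hp, hq⟩ := ih ha
    have hmul : ∀ (r s : ℝ[X]) (z : ℂ), ((r * s).map Complex.ofRealHom).IsRoot z →
        (r.map Complex.ofRealHom).IsRoot z ∨ (s.map Complex.ofRealHom).IsRoot z := by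
      intro r s z hz
      rwa [Polynomial.map_mul, root_mul] at hz
    by_cases h : ∃ z : ℂ, (i.map Complex.ofRealHom).IsRoot z ∧ z.re < 0
    · obtain ⟨z, hz, hz0⟩ := h
      refine ⟨i * p, q, by rw [hpq, mul_assoc], fun w hw => ?_, hq⟩
      rcases hmul _ _ _ hw with hw | hw
      · rw [re_eq_of_irreducible hi hz hw]; exact hz0
      · exact hp w hw
    · push Not at h
      refine ⟨p, i * q, by rw [hpq]; ring, hp, fun w hw => ?_⟩
      rcases hmul _ _ _ hw with hw | hw
      · exact h w hw
      · exact hq w hw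

variable {ι : Type} [Fintype ι] [DecidableEq ι]

/-- A pair of complementary invariant subspaces block diagonalizes the matrix. -/
theorem exists_blocks_of_isCompl (A : Matrix ι ι ℝ) {U W : Submodule ℝ (ι → ℝ)}
    (hUW : IsCompl U W) (hU : ∀ x ∈ U, A *ᵥ x ∈ U) (hW : ∀ x ∈ W, A *ᵥ x ∈ W) :
    ∃ (s u : ℕ) (A₁ : Matrix (Fin s) (Fin s) ℝ) (A₂ : Matrix (Fin u) (Fin u) ℝ)
      (S₁ : Matrix ι (Fin s) ℝ) (S₂ : Matrix ι (Fin u) ℝ) (T₁ : Matrix (Fin s) ι ℝ)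
      (T₂ : Matrix (Fin u) ι ℝ), fromCols S₁ S₂ * fromRows T₁ T₂ = 1 ∧
      fromRows T₁ T₂ * fromCols S₁ S₂ = 1 ∧ A * S₁ = S₁ * A₁ ∧ A * S₂ = S₂ * A₂ ∧
      (∀ y, S₁ *ᵥ y ∈ U) ∧ (∀ y, S₂ *ᵥ y ∈ W) ∧ s = Module.finrank ℝ U := by
  have key : ∀ V : Submodule ℝ (ι → ℝ), (∀ x ∈ V, A *ᵥ x ∈ V) →
      ∃ (A' : Matrix (Fin (Module.finrank ℝ V)) (Fin (Module.finrank ℝ V)) ℝ),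
        A * (Matrix.of fun i a => (Module.finBasis ℝ V a : ι → ℝ) i) =
          (Matrix.of fun i a => (Module.finBasis ℝ V a : ι → ℝ) i) * A' := by
    intro V hV
    let g : V →ₗ[ℝ] V := (Matrix.toLin' A).restrict (p := V) (q := V) (by simpa using hV)
    refine ⟨LinearMap.toMatrix (Module.finBasis ℝ V) (Module.finBasis ℝ V) g, ?_⟩
    ext i a
    have h1 := (Module.finBasis ℝ V).sum_repr (g (Module.finBasis ℝ V a))
    have h2 := congrArg (fun v : V => (v : ι → ℝ) i) h1
    simp only [Submodule.coe_sum, Submodule.coe_smul, Finset.sum_apply, Pi.smul_apply,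
      smul_eq_mul] at h2
    rw [Matrix.mul_apply, Matrix.mul_apply]
    simp only [Matrix.of_apply, LinearMap.toMatrix_apply]
    have h3 : ((g (Module.finBasis ℝ V a) : V) : ι → ℝ) i =
        ∑ j, A i j * (Module.finBasis ℝ V a : ι → ℝ) j := rfl
    rw [← h3, ← h2]
    exact Finset.sum_congr rfl fun c _ => mul_comm _ _
  have hmem : ∀ (V : Submodule ℝ (ι → ℝ)) (y : Fin (Module.finrank ℝ V) → ℝ),
      (Matrix.of fun i a => (Module.finBasis ℝ V a : ι → ℝ) i) *ᵥ y ∈ V := by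
    intro V y
    have : (Matrix.of fun i a => (Module.finBasis ℝ V a : ι → ℝ) i) *ᵥ y =
        ((∑ a, y a • Module.finBasis ℝ V a : V) : ι → ℝ) := by
      ext i
      simp [mulVec, dotProduct, mul_comm]
    rw [this]
    exact Subtype.coe_prop _
  obtain ⟨A₁, hA₁⟩ := key U hU
  obtain ⟨A₂, hA₂⟩ := key W hW
  let b := ((Module.finBasis ℝ U).prod (Module.finBasis ℝ W)).map
    (Submodule.prodEquivOfIsCompl U W hUW)
  let S : Matrix ι (Fin (Module.finrank ℝ U) ⊕ Fin (Module.finrank ℝ W)) ℝ :=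
    (Pi.basisFun ℝ ι).toMatrix b
  let T : Matrix (Fin (Module.finrank ℝ U) ⊕ Fin (Module.finrank ℝ W)) ι ℝ :=
    b.toMatrix (Pi.basisFun ℝ ι)
  have hST : S * T = 1 := (Pi.basisFun ℝ ι).toMatrix_mul_toMatrix_flip b
  have hTS : T * S = 1 := b.toMatrix_mul_toMatrix_flip (Pi.basisFun ℝ ι)
  have hS : S = fromCols (Matrix.of fun i a => (Module.finBasis ℝ U a : ι → ℝ) i)
      (Matrix.of fun i a => (Module.finBasis ℝ W a : ι → ℝ) i) := by
    ext i (a | a) <;> simp [S, b, Module.Basis.toMatrix_apply]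
  refine ⟨_, _, A₁, A₂, _, _, T.toRows₁, T.toRows₂, ?_, ?_, hA₁, hA₂, hmem U, hmem W, rfl⟩
  · rw [fromRows_toRows, ← hS, hST]
  · rw [fromRows_toRows, ← hS, hTS]

theorem aeval_fromBlocks {ι₁ ι₂ : Type} [Fintype ι₁] [DecidableEq ι₁] [Fintype ι₂] [DecidableEq ι₂]
    (A₁ : Matrix ι₁ ι₁ ℝ) (A₂ : Matrix ι₂ ι₂ ℝ) (p : ℝ[X]) :
    aeval (fromBlocks A₁ 0 0 A₂) p = fromBlocks (aeval A₁ p) 0 0 (aeval A₂ p) := by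
  induction p using Polynomial.induction_on' with
  | add p q hp hq => simp [hp, hq, fromBlocks_add]
  | monomial n a =>
    simp [aeval_monomial, Algebra.algebraMap_eq_smul_one, fromBlocks_diagonal_pow,
      fromBlocks_smul]

theorem mul_fromCols_eq {ι₁ ι₂ : Type} [Fintype ι₁] [DecidableEq ι₁] [Fintype ι₂] [DecidableEq ι₂]
    {A : Matrix ι ι ℝ} {A₁ : Matrix ι₁ ι₁ ℝ} {A₂ : Matrix ι₂ ι₂ ℝ} {S₁ : Matrix ι ι₁ ℝ}
    {S₂ : Matrix ι ι₂ ℝ} (h₁ : A * S₁ = S₁ * A₁) (h₂ : A * S₂ = S₂ * A₂) :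
    A * fromCols S₁ S₂ = fromCols S₁ S₂ * fromBlocks A₁ 0 0 A₂ := by
  rw [mul_fromCols, fromCols_mul_fromBlocks, h₁, h₂]
  simp

/-- The kernels of the coprime stable and antistable factors of the characteristic polynomial are
complementary invariant subspaces. -/
theorem exists_stable_splitting {d : ℕ} {A : Matrix (Fin d) (Fin d) ℝ} (hA : IsCyclicMatrix A) :
    ∃ (s u : ℕ) (A₁ : Matrix (Fin s) (Fin s) ℝ) (A₂ : Matrix (Fin u) (Fin u) ℝ)
      (S₁ : Matrix (Fin d) (Fin s) ℝ) (S₂ : Matrix (Fin d) (Fin u) ℝ)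
      (T₁ : Matrix (Fin s) (Fin d) ℝ) (T₂ : Matrix (Fin u) (Fin d) ℝ),
      fromCols S₁ S₂ * fromRows T₁ T₂ = 1 ∧ fromRows T₁ T₂ * fromCols S₁ S₂ = 1 ∧
      A * S₁ = S₁ * A₁ ∧ A * S₂ = S₂ * A₂ ∧ IsHurwitz A₁ ∧
      (∀ z : ℂ, (A₂.charpoly.map Complex.ofRealHom).IsRoot z → 0 ≤ z.re) ∧
      IsCyclicMatrix A₂ ∧ topEntropy A = A₂.trace ∧
      minpoly ℝ A ∣ minpoly ℝ A₁ * minpoly ℝ A₂ := by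
  obtain ⟨p, q, hpq, hp, hq⟩ := exists_stable_factorization A.charpoly A.charpoly_monic.ne_zero
  have hcop : IsCoprime p q := isCoprime_of_roots fun z hz hz' =>
    absurd (hp z hz) (not_lt.2 (hq z hz'))
  let f : Module.End ℝ (Fin d → ℝ) := Matrix.toLin' A
  have hf : ∀ r : ℝ[X], aeval f r = Matrix.toLin' (aeval A r) := fun r =>
    Polynomial.aeval_algHom_apply (Matrix.toLinAlgEquiv' (R := ℝ) (n := Fin d)) A r
  have hcompl : IsCompl (LinearMap.ker (aeval f p)) (LinearMap.ker (aeval f q)) := by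
    refine ⟨Polynomial.disjoint_ker_aeval_of_isCoprime f hcop, ?_⟩
    rw [codisjoint_iff, Polynomial.sup_ker_aeval_eq_ker_aeval_mul_of_coprime f hcop, ← hpq, hf,
      Matrix.aeval_self_charpoly]
    simp
  have hinv : ∀ r : ℝ[X], ∀ x ∈ LinearMap.ker (aeval f r), A *ᵥ x ∈ LinearMap.ker (aeval f r) := by
    intro r x hx
    rw [LinearMap.mem_ker, hf, Matrix.toLin'_apply] at hx ⊢
    have : aeval A r * A = A * aeval A r := by
      nth_rewrite 2 [← aeval_X (R := ℝ) A]
      nth_rewrite 3 [← aeval_X (R := ℝ) A]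
      rw [← map_mul, mul_comm, map_mul]
    rw [Matrix.mulVec_mulVec, this, ← Matrix.mulVec_mulVec, hx, Matrix.mulVec_zero]
  obtain ⟨s, u, A₁, A₂, S₁, S₂, T₁, T₂, hST, hTS, h₁, h₂, hU, hW, -⟩ :=
    exists_blocks_of_isCompl A hcompl (hinv p) (hinv q)
  have hsim := mul_fromCols_eq h₁ h₂
  have hTS' := hTS
  rw [fromRows_mul_fromCols, ← fromBlocks_one, fromBlocks_inj] at hTS'
  obtain ⟨e11, e12, e21, e22⟩ := hTS'
  have hp1 : aeval A₁ p = 0 := by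
    have h3 : aeval A p * S₁ = 0 := by
      refine Matrix.toLin'.injective (LinearMap.ext fun y => ?_)
      have := hU y
      rw [LinearMap.mem_ker, hf, Matrix.toLin'_apply] at this
      rw [Matrix.toLin'_apply, ← Matrix.mulVec_mulVec, this]; simp
    rw [aeval_similar h₁] at h3
    have := congrArg (fun Y => T₁ * Y) h3
    simpa [← Matrix.mul_assoc, e11] using this
  have hq2 : aeval A₂ q = 0 := by
    have h3 : aeval A q * S₂ = 0 := by
      refine Matrix.toLin'.injective (LinearMap.ext fun y => ?_)
      have := hW y
      rw [LinearMap.mem_ker, hf, Matrix.toLin'_apply] at this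
      rw [Matrix.toLin'_apply, ← Matrix.mulVec_mulVec, this]; simp
    rw [aeval_similar h₂] at h3
    have := congrArg (fun Y => T₂ * Y) h3
    simpa [← Matrix.mul_assoc, e22] using this
  have hH : IsHurwitz A₁ := by
    rw [isHurwitz_iff_charpoly]
    exact fun z hz => hp z (isRoot_of_isRoot_charpoly hp1 hz)
  have hroot : ∀ z : ℂ, (A₂.charpoly.map Complex.ofRealHom).IsRoot z → 0 ≤ z.re :=
    fun z hz => hq z (isRoot_of_isRoot_charpoly hq2 hz)
  have hchar : A.charpoly = A₁.charpoly * A₂.charpoly := by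
    have h3 := charpoly_similar A (fromCols S₁ S₂) (fromRows T₁ T₂) hST hTS
    rw [Matrix.mul_assoc, hsim, ← Matrix.mul_assoc, hTS, Matrix.one_mul,
      Matrix.charpoly_fromBlocks_zero₂₁] at h3
    exact h3.symm
  have hdvd : minpoly ℝ A ∣ minpoly ℝ A₁ * minpoly ℝ A₂ := by
    refine minpoly.dvd ℝ A ?_
    have h3 := aeval_similar hsim (minpoly ℝ A₁ * minpoly ℝ A₂)
    have h4 : aeval (fromBlocks A₁ 0 0 A₂) (minpoly ℝ A₁ * minpoly ℝ A₂) = 0 := by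
      rw [aeval_fromBlocks, map_mul, map_mul, minpoly.aeval, minpoly.aeval, zero_mul, mul_zero,
        fromBlocks_zero]
    rw [h4, Matrix.mul_zero] at h3
    rw [← Matrix.mul_one (aeval A _), ← hST, ← Matrix.mul_assoc, h3, Matrix.zero_mul]
  refine ⟨s, u, A₁, A₂, S₁, S₂, T₁, T₂, hST, hTS, h₁, h₂, hH, hroot, ?_, ?_, hdvd⟩
  -- Degree count: the two minimal polynomials have degrees at most `s` and `u`, while their product
  -- is a multiple of a polynomial of degree `s + u`. Both bounds are therefore attained.
  · have hdeg : ∀ {t : ℕ} (Y : Matrix (Fin t) (Fin t) ℝ), (minpoly ℝ Y).natDegree ≤ t := by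
      intro t Y
      have := Polynomial.natDegree_le_of_dvd (Matrix.minpoly_dvd_charpoly Y) Y.charpoly_monic.ne_zero
      rwa [Matrix.charpoly_natDegree_eq_dim, Fintype.card_fin] at this
    have hne : ∀ {t : ℕ} (Y : Matrix (Fin t) (Fin t) ℝ), minpoly ℝ Y ≠ 0 := fun Y =>
      minpoly.ne_zero (Algebra.IsIntegral.isIntegral Y)
    have h4 := Polynomial.natDegree_le_of_dvd hdvd (mul_ne_zero (hne A₁) (hne A₂))
    rw [Polynomial.natDegree_mul (hne A₁) (hne A₂), hA] at h4
    have h5 : Fintype.card (Fin d) = Fintype.card (Fin s ⊕ Fin u) :=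
      Matrix.square_of_invertible _ _ hST hTS
    have h6 := hdeg A₁
    have h7 := hdeg A₂
    simp only [Fintype.card_fin, Fintype.card_sum] at h4 h5
    rw [IsCyclicMatrix, Fintype.card_fin]
    omega
  · rw [topEntropy_eq, hchar, rightRootSum_mul A₁.charpoly_monic.ne_zero A₂.charpoly_monic.ne_zero,
      ← topEntropy_eq A₁, topEntropy_eq_zero hH, zero_add, rightRootSum_eq_trace A₂ hroot]

end Splitting

/-! ### From a stabilizable plant to its controllable antistable chain. -/

section Reduction

set_option linter.unusedSectionVars false

variable {ι ι' κ : Type} [Fintype ι] [DecidableEq ι] [Fintype ι'] [DecidableEq ι']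
  [Fintype κ] [DecidableEq κ]

theorem aeval_mul_aeval_eq_one {M : Matrix ι ι ℝ} {p q : ℝ[X]} (hpq : IsCoprime p q)
    (hq : aeval M q = 0) : ∃ r : ℝ[X], aeval M p * aeval M r = 1 := by
  obtain ⟨a, b, h⟩ := hpq
  refine ⟨a, ?_⟩
  have := congrArg (aeval M) h
  rwa [map_add, map_mul, map_mul, hq, mul_zero, add_zero, map_one, ← map_mul, mul_comm a,
    map_mul] at this

theorem exists_isRoot_of_isRoot_charpoly_blockDiagonal {k : ℕ} {d : Fin k → ℕ}
    (A : ∀ i, Matrix (Fin (d i)) (Fin (d i)) ℝ) {z : ℂ}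
    (hz : ((blockDiagonal' A).charpoly.map Complex.ofRealHom).IsRoot z) :
    ∃ i, ((A i).charpoly.map Complex.ofRealHom).IsRoot z := by
  have h1 : aeval (blockDiagonal' A) (∏ i, (A i).charpoly) = 0 := by
    rw [aeval_blockDiagonal]
    have : (fun i => aeval (A i) (∏ i, (A i).charpoly)) = 0 := by
      funext i
      rw [← Finset.mul_prod_erase _ _ (Finset.mem_univ i), map_mul, Matrix.aeval_self_charpoly,
        zero_mul]
      rfl
    rw [this, blockDiagonal'_zero]
  have h2 := isRoot_of_isRoot_charpoly h1 hz
  rw [Polynomial.map_prod, Polynomial.isRoot_prod] at h2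
  obtain ⟨i, -, hi⟩ := h2
  exact ⟨i, hi⟩

/-- The antistable part of a stabilizable system is controllable. -/
theorem isControllable_of_isHurwitz {A : Matrix ι ι ℝ} {B : Matrix ι κ ℝ} {F : Matrix κ ι ℝ}
    (hF : IsHurwitz (A + B * F)) {A₂ : Matrix ι' ι' ℝ} {S : Matrix ι ι' ℝ} {T : Matrix ι' ι ℝ}
    (hTS : T * S = 1) (hT : T * A = A₂ * T)
    (hroot : ∀ z : ℂ, (A₂.charpoly.map Complex.ofRealHom).IsRoot z → 0 ≤ z.re) :
    IsControllable A₂ (T * B) := by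
  intro v hv
  -- Along `v` the feedback is invisible, so the closed loop acts through `A₂`. Its characteristic
  -- polynomial at `A₂` then annihilates `v`, yet it is invertible there because no antistable
  -- eigenvalue is a root.
  have h1 : ∀ i : ℕ, v ᵥ* (T * (A + B * F) ^ i) = v ᵥ* (A₂ ^ i * T) := by
    intro i
    induction i with
    | zero => simp
    | succ i ih =>
      rw [pow_succ, ← Matrix.mul_assoc, ← Matrix.vecMul_vecMul, ih, Matrix.vecMul_vecMul,
        Matrix.mul_add, Matrix.vecMul_add, pow_succ, Matrix.mul_assoc, Matrix.mul_assoc,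
        Matrix.mul_assoc, hT]
      have h2 : A₂ ^ i * (T * (B * F)) = (A₂ ^ i * (T * B)) * F := by
        simp only [Matrix.mul_assoc]
      rw [h2, ← Matrix.vecMul_vecMul v _ F, hv i, Matrix.zero_vecMul, add_zero]
  have h2 : ∀ p : ℝ[X], v ᵥ* (T * aeval (A + B * F) p) = v ᵥ* (aeval A₂ p * T) := by
    intro p
    induction p using Polynomial.induction_on' with
    | add p q hp hq =>
      simp only [map_add, Matrix.mul_add, Matrix.add_mul, Matrix.vecMul_add, hp, hq]
    | monomial n a =>
      simp only [aeval_monomial, Algebra.algebraMap_eq_smul_one, Matrix.smul_mul, Matrix.one_mul,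
        Matrix.mul_smul, Matrix.vecMul_smul, h1]
  have h3 := h2 (A + B * F).charpoly
  rw [Matrix.aeval_self_charpoly, Matrix.mul_zero, Matrix.vecMul_zero] at h3
  have h4 : v ᵥ* aeval A₂ (A + B * F).charpoly = 0 := by
    have := congrArg (fun w => w ᵥ* S) h3.symm
    simpa [Matrix.vecMul_vecMul, Matrix.mul_assoc, hTS] using this
  obtain ⟨r, hr⟩ := aeval_mul_aeval_eq_one (M := A₂) (p := (A + B * F).charpoly)
    (q := A₂.charpoly) (isCoprime_of_roots fun z hz hz' =>
      absurd ((isHurwitz_iff_charpoly _).1 hF z hz) (not_lt.2 (hroot z hz')))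
    (Matrix.aeval_self_charpoly A₂)
  have h5 := congrArg (fun w => w ᵥ* aeval A₂ r) h4
  simpa only [Matrix.vecMul_vecMul, hr, Matrix.vecMul_one, Matrix.zero_vecMul] using h5

theorem CyclicDecomposition.minpoly_dvd_of_le {n : ℕ} {A : Matrix (Fin n) (Fin n) ℝ}
    (D : CyclicDecomposition A) (i j : Fin D.k) (h : i ≤ j) :
    minpoly ℝ (D.block j) ∣ minpoly ℝ (D.block i) := by
  rw [← charpoly_eq_minpoly (D.cyclic i), ← charpoly_eq_minpoly (D.cyclic j)]
  exact D.charpoly_dvd i j h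

/-- A stabilizable system can be controlled with the `i`-th input power close to twice the
topological entropy of the `i`-th block of a cyclic decomposition. -/
theorem CyclicDecomposition.inputRiccatiFeasible {n m : ℕ} {A : Matrix (Fin n) (Fin n) ℝ}
    {B : Matrix (Fin n) (Fin m) ℝ} (D : CyclicDecomposition A) (hAB : IsStabilizable A B) {δ : ℝ}
    (hδ : 0 < δ) : InputRiccatiFeasible A B (fun j : Fin m => 2 * D.entropyVector m j + δ) := by
  obtain ⟨F, hF⟩ := hAB
  choose s u A₁ A₂ S₁ S₂ T₁ T₂ hST hTS h₁ h₂ hH hroot hcyc hent hdvd using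
    fun i => exists_stable_splitting (D.cyclic i)
  have hTS' : ∀ i, T₁ i * S₁ i = 1 ∧ T₁ i * S₂ i = 0 ∧ T₂ i * S₁ i = 0 ∧ T₂ i * S₂ i = 1 := by
    intro i
    have := hTS i
    rwa [fromRows_mul_fromCols, ← fromBlocks_one, fromBlocks_inj] at this
  have hST' : ∀ i, S₁ i * T₁ i + S₂ i * T₂ i = 1 := by
    intro i
    have := hST i
    rwa [fromCols_mul_fromRows] at this
  let V₁ := D.S * blockDiagonal' S₁
  let V₂ := D.S * blockDiagonal' S₂
  let W₁ := blockDiagonal' T₁ * D.Sinv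
  let W₂ := blockDiagonal' T₂ * D.Sinv
  have hAS : A * D.S = D.S * blockDiagonal' D.block := by
    rw [← D.conj_eq, ← Matrix.mul_assoc, ← Matrix.mul_assoc, D.S_mul_Sinv, Matrix.one_mul]
  have hV₁ : A * V₁ = V₁ * blockDiagonal' A₁ := by
    rw [← Matrix.mul_assoc, hAS, Matrix.mul_assoc, Matrix.mul_assoc, ← blockDiagonal'_mul,
      ← blockDiagonal'_mul]
    simp only [h₁]
  have hV₂ : A * V₂ = V₂ * blockDiagonal' A₂ := by
    rw [← Matrix.mul_assoc, hAS, Matrix.mul_assoc, Matrix.mul_assoc, ← blockDiagonal'_mul,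
      ← blockDiagonal'_mul]
    simp only [h₂]
  have hVW : fromCols V₁ V₂ * fromRows W₁ W₂ = 1 := by
    have : V₁ * W₁ + V₂ * W₂ = D.S * ((blockDiagonal' S₁ * blockDiagonal' T₁ +
        blockDiagonal' S₂ * blockDiagonal' T₂) * D.Sinv) := by
      simp only [V₁, V₂, W₁, W₂, Matrix.mul_add, Matrix.add_mul, Matrix.mul_assoc]
    rw [fromCols_mul_fromRows, this, ← blockDiagonal'_mul, ← blockDiagonal'_mul,
      ← blockDiagonal'_add]
    have h : ((fun i => S₁ i * T₁ i) + fun i => S₂ i * T₂ i) = 1 := funext hST'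
    rw [h, blockDiagonal'_one, Matrix.one_mul, D.S_mul_Sinv]
  have hprod : ∀ {a b : Fin D.k → ℕ} (Y : ∀ i, Matrix (Fin (a i)) (Fin (D.dim i)) ℝ)
      (Z : ∀ i, Matrix (Fin (D.dim i)) (Fin (b i)) ℝ),
      blockDiagonal' Y * D.Sinv * (D.S * blockDiagonal' Z) = blockDiagonal' fun i => Y i * Z i := by
    intro a b Y Z
    rw [Matrix.mul_assoc, ← Matrix.mul_assoc D.Sinv, D.Sinv_mul_S, Matrix.one_mul,
      ← blockDiagonal'_mul]
  have hW₂V₂ : W₂ * V₂ = 1 := by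
    rw [hprod, ← blockDiagonal'_one]
    exact congrArg _ (funext fun i => (hTS' i).2.2.2)
  have hW₂V₁ : W₂ * V₁ = 0 := by
    rw [hprod, ← blockDiagonal'_zero]
    exact congrArg _ (funext fun i => (hTS' i).2.2.1)
  have hsim := mul_fromCols_eq hV₁ hV₂
  have hW₂ : W₂ * A = blockDiagonal' A₂ * W₂ := by
    have h3 := congrArg (fun Y => W₂ * Y * fromRows W₁ W₂) hsim
    simp only [Matrix.mul_assoc, hVW, Matrix.mul_one] at h3
    rw [h3, fromBlocks_mul_fromRows, fromCols_mul_fromRows]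
    simp only [Matrix.zero_mul, add_zero, zero_add, Matrix.mul_add]
    rw [← Matrix.mul_assoc W₂ V₁, hW₂V₁, ← Matrix.mul_assoc W₂ V₂, hW₂V₂, Matrix.zero_mul, zero_add,
      Matrix.one_mul]
  have hH' : IsHurwitz (blockDiagonal' A₁) := by
    rw [isHurwitz_iff_charpoly]
    intro z hz
    obtain ⟨i, hi⟩ := exists_isRoot_of_isRoot_charpoly_blockDiagonal A₁ hz
    exact (isHurwitz_iff_charpoly _).1 (hH i) z hi
  have hroot' : ∀ z : ℂ, ((blockDiagonal' A₂).charpoly.map Complex.ofRealHom).IsRoot z →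
      0 ≤ z.re := by
    intro z hz
    obtain ⟨i, hi⟩ := exists_isRoot_of_isRoot_charpoly_blockDiagonal A₂ hz
    exact hroot i z hi
  -- The product of the two minimal polynomials of block `i` kills block `j`. Its stable factor is
  -- invertible at the antistable `A₂ j`, so the antistable factor vanishes there.
  have hann : ∀ i j, i < j → aeval (A₂ j) (minpoly ℝ (A₂ i)) = 0 := by
    intro i j hij
    have h3 : aeval (D.block j) (minpoly ℝ (A₁ i) * minpoly ℝ (A₂ i)) = 0 := by
      obtain ⟨r, hr⟩ := (D.minpoly_dvd_of_le i j hij.le).trans (hdvd i)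
      rw [hr, map_mul, minpoly.aeval, zero_mul]
    have h4 := aeval_similar (h₂ j) (minpoly ℝ (A₁ i) * minpoly ℝ (A₂ i))
    rw [h3, Matrix.zero_mul] at h4
    have h5 : aeval (A₂ j) (minpoly ℝ (A₁ i) * minpoly ℝ (A₂ i)) = 0 := by
      rw [← Matrix.one_mul (aeval (A₂ j) _), ← (hTS' j).2.2.2, Matrix.mul_assoc, ← h4,
        Matrix.mul_zero]
    obtain ⟨r, hr⟩ := aeval_mul_aeval_eq_one (M := A₂ j) (p := minpoly ℝ (A₁ i))
      (q := (A₂ j).charpoly) (isCoprime_of_roots fun z hz hz' => by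
        obtain ⟨q, hq⟩ := Matrix.minpoly_dvd_charpoly (A₁ i)
        have : ((A₁ i).charpoly.map Complex.ofRealHom).IsRoot z := by
          rw [hq, Polynomial.map_mul, root_mul]; exact Or.inl hz
        exact absurd ((isHurwitz_iff_charpoly _).1 (hH i) z this) (not_lt.2 (hroot j z hz')))
      (Matrix.aeval_self_charpoly (A₂ j))
    have h6 := congrArg (fun Y => aeval (A₂ j) r * Y) h5
    simp only [map_mul, ← Matrix.mul_assoc, mul_eq_one_comm.1 hr, Matrix.one_mul,
      Matrix.mul_zero] at h6
    exact h6
  have hcontr : IsControllable (blockDiagonal' A₂) (W₂ * B) :=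
    isControllable_of_isHurwitz hF hW₂V₂ hW₂ hroot'
  have h7 := inputRiccatiFeasible_blockDiagonal hδ D.k u A₂ hcyc hann hroot m _ hcontr
  have h8 := (h7.fromRows_of_isHurwitz hH' (W₁ * B)).similar hVW hsim (B := B) (by
    rw [← fromRows_mul, ← Matrix.mul_assoc, hVW, Matrix.one_mul])
  convert h8 using 2 with j
  unfold CyclicDecomposition.entropyVector
  congr 1
  split_ifs with h
  · rw [hent]
  · simp

end Reduction

/-! ### Existence of cyclic decompositions. -/

section Existence

set_option linter.unusedSectionVars false

variable {n : ℕ}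

/-- A matrix splits into a cyclic block carrying its minimal polynomial and a complement. -/
theorem exists_cyclic_splitting [NeZero n] (A : Matrix (Fin n) (Fin n) ℝ) :
    ∃ (s u : ℕ) (A₁ : Matrix (Fin s) (Fin s) ℝ) (A₂ : Matrix (Fin u) (Fin u) ℝ)
      (S₁ : Matrix (Fin n) (Fin s) ℝ) (S₂ : Matrix (Fin n) (Fin u) ℝ)
      (T₁ : Matrix (Fin s) (Fin n) ℝ) (T₂ : Matrix (Fin u) (Fin n) ℝ),
      fromCols S₁ S₂ * fromRows T₁ T₂ = 1 ∧ fromRows T₁ T₂ * fromCols S₁ S₂ = 1 ∧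
      A * S₁ = S₁ * A₁ ∧ A * S₂ = S₂ * A₂ ∧ 0 < s ∧ s + u = n ∧ IsCyclicMatrix A₁ ∧
      minpoly ℝ A₁ = minpoly ℝ A ∧ minpoly ℝ A₂ ∣ minpoly ℝ A := by
  have hint : ∀ {t : ℕ} (Y : Matrix (Fin t) (Fin t) ℝ), (minpoly ℝ Y).Monic := fun Y =>
    minpoly.monic (Algebra.IsIntegral.isIntegral Y)
  -- With the identity as input matrix the pair is trivially controllable.
  obtain ⟨b, -, hb⟩ := exists_annihilator_eq_minpoly (A := A) (B := (1 : Matrix (Fin n) (Fin n) ℝ))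
    (fun v hv => by simpa using hv 0)
  simp only [Matrix.one_mulVec] at hb
  set α := minpoly ℝ A with hα
  have hαm : α.Monic := hint A
  set d := α.natDegree with hd
  have hd0 : 0 < d := minpoly.natDegree_pos (Algebra.IsIntegral.isIntegral A)
  have hmem : ∀ {p : ℝ[X]}, p ∈ degreeLT ℝ d ↔ p.degree < α.degree := by
    intro p
    rw [mem_degreeLT, hd, degree_eq_natDegree hαm.ne_zero]
  have hred : ∀ p : ℝ[X], ∃ q ∈ degreeLT ℝ d, aeval A p = aeval A q := fun p =>
    ⟨p %ₘ α, hmem.2 (degree_modByMonic_lt _ hαm),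
      (aeval_modByMonic_eq_self_of_root (minpoly.aeval ℝ A)).symm⟩
  let φ : degreeLT ℝ d →ₗ[ℝ] (Fin n → ℝ) :=
    { toFun := fun p => aeval A (p : ℝ[X]) *ᵥ b
      map_add' := fun p q => by simp [Matrix.add_mulVec]
      map_smul' := fun c p => by simp [Matrix.smul_mulVec] }
  have hφ : Function.Injective φ := by
    rw [← LinearMap.ker_eq_bot, LinearMap.ker_eq_bot']
    intro p hp
    refine Subtype.ext (Polynomial.eq_zero_of_dvd_of_degree_lt (hb _ hp) (hmem.1 p.2))
  obtain ⟨g, hg⟩ := LinearMap.exists_leftInverse_of_injective φ (LinearMap.ker_eq_bot.2 hφ)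
  -- `c` reads off the coefficient of degree `d - 1` of `p` from `p(A) b`. The complement is the set
  -- of `x` with `c (p(A) x) = 0` for all `p`, which is invariant.
  let c : (Fin n → ℝ) →ₗ[ℝ] ℝ := (lcoeff ℝ (d - 1)) ∘ₗ (degreeLT ℝ d).subtype ∘ₗ g
  have hc : ∀ p ∈ degreeLT ℝ d, c (aeval A p *ᵥ b) = p.coeff (d - 1) := by
    intro p hp
    have := LinearMap.congr_fun hg ⟨p, hp⟩
    change g (aeval A p *ᵥ b) = _ at this
    simp only [c, LinearMap.comp_apply, this]
    rfl
  let Ψ : (Fin n → ℝ) →ₗ[ℝ] (degreeLT ℝ d →ₗ[ℝ] ℝ) := LinearMap.mk₂ ℝ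
    (fun x (p : degreeLT ℝ d) => c (aeval A (p : ℝ[X]) *ᵥ x))
    (fun x y p => by simp [Matrix.mulVec_add]) (fun r x p => by simp [Matrix.mulVec_smul])
    (fun x p q => by simp [Matrix.add_mulVec]) (fun r x p => by simp [Matrix.smul_mulVec])
  have hfin : Module.finrank ℝ (degreeLT ℝ d) = d := by
    rw [(degreeLTEquiv ℝ d).finrank_eq, Module.finrank_fin_fun]
  have : FiniteDimensional ℝ (degreeLT ℝ d) := (degreeLTEquiv ℝ d).symm.finiteDimensional
  let U := LinearMap.range φ
  let W := LinearMap.ker Ψ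
  have hUfin : Module.finrank ℝ U = d := by
    rw [LinearMap.finrank_range_of_inj hφ, hfin]
  have hmemU : ∀ p : ℝ[X], aeval A p *ᵥ b ∈ U := by
    intro p
    obtain ⟨q, hq, hpq⟩ := hred p
    exact ⟨⟨q, hq⟩, by rw [hpq]; rfl⟩
  have hmemW : ∀ x, x ∈ W ↔ ∀ p : ℝ[X], c (aeval A p *ᵥ x) = 0 := by
    intro x
    refine ⟨fun hx p => ?_, fun hx => LinearMap.ext fun p => hx p⟩
    obtain ⟨q, hq, hpq⟩ := hred p
    rw [hpq]
    exact LinearMap.congr_fun hx ⟨q, hq⟩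
  have hX : ∀ p : ℝ[X], aeval A p * A = aeval A (p * X) := fun p => by simp
  have hX' : ∀ p : ℝ[X], A * aeval A p = aeval A (X * p) := fun p => by simp
  have hdisj : Disjoint U W := by
    rw [Submodule.disjoint_def]
    rintro _ ⟨p, rfl⟩ hp
    by_contra hne
    have hp0 : (p : ℝ[X]) ≠ 0 := by
      intro h
      exact hne (by change aeval A (p : ℝ[X]) *ᵥ b = 0; simp [h])
    have hlt : (p : ℝ[X]).natDegree < d :=
      (natDegree_lt_iff_degree_lt hp0).2 (mem_degreeLT.1 p.2)
    -- Multiplying by this power of `X` raises the degree to exactly `d - 1`, so `c` returns the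
    -- leading coefficient of `p`.
    have h1 := (hmemW _).1 hp (X ^ (d - 1 - (p : ℝ[X]).natDegree))
    change c (_ *ᵥ (aeval A (p : ℝ[X]) *ᵥ b)) = 0 at h1
    rw [Matrix.mulVec_mulVec, ← map_mul, hc] at h1
    · have h2 : d - 1 = (p : ℝ[X]).natDegree + (d - 1 - (p : ℝ[X]).natDegree) := by omega
      nth_rewrite 2 [h2] at h1
      rw [coeff_X_pow_mul] at h1
      exact hp0 (leadingCoeff_eq_zero.1 h1)
    · rw [mem_degreeLT, degree_mul, degree_X_pow, degree_eq_natDegree hp0]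
      norm_cast
      omega
  have hcompl : IsCompl U W := by
    -- `W` is cut out by `d` linear conditions, so its dimension is at least `n - d`, and
    -- disjointness from `U` suffices.
    refine (Submodule.isCompl_iff_disjoint U W ?_).2 hdisj
    have h1 := LinearMap.finrank_range_add_finrank_ker Ψ
    have h2 := Submodule.finrank_le (LinearMap.range Ψ)
    have h3 : Module.finrank ℝ (degreeLT ℝ d →ₗ[ℝ] ℝ) = d := by
      rw [Module.finrank_linearMap, hfin, Module.finrank_self, mul_one]
    have h4 : Module.finrank ℝ W = Module.finrank ℝ (LinearMap.ker Ψ) := rfl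
    omega
  obtain ⟨s, u, A₁, A₂, S₁, S₂, T₁, T₂, hST, hTS, h₁, h₂, hU, hW, hs⟩ :=
    exists_blocks_of_isCompl A hcompl (by
      rintro _ ⟨p, rfl⟩
      change A *ᵥ (aeval A (p : ℝ[X]) *ᵥ b) ∈ U
      rw [Matrix.mulVec_mulVec, hX']
      exact hmemU _) (by
      intro x hx
      rw [hmemW] at hx ⊢
      intro p
      rw [Matrix.mulVec_mulVec, hX]
      exact hx _)
  have hTS' := hTS
  rw [fromRows_mul_fromCols, ← fromBlocks_one, fromBlocks_inj] at hTS'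
  obtain ⟨e11, e12, e21, e22⟩ := hTS'
  have hkill : ∀ {t : ℕ} {Y : Matrix (Fin t) (Fin t) ℝ} {S : Matrix (Fin n) (Fin t) ℝ}
      {T : Matrix (Fin t) (Fin n) ℝ}, T * S = 1 → A * S = S * Y → minpoly ℝ Y ∣ α := by
    intro t Y S T hTS hY
    refine minpoly.dvd ℝ Y ?_
    have h3 := aeval_similar hY α
    rw [minpoly.aeval, Matrix.zero_mul] at h3
    rw [← Matrix.one_mul (aeval Y _), ← hTS, Matrix.mul_assoc, ← h3, Matrix.mul_zero]
  have hbU : S₁ *ᵥ (T₁ *ᵥ b) = b := by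
    have h3 : S₁ *ᵥ (T₁ *ᵥ b) + S₂ *ᵥ (T₂ *ᵥ b) = b := by
      rw [Matrix.mulVec_mulVec, Matrix.mulVec_mulVec, ← Matrix.add_mulVec, ← fromCols_mul_fromRows,
        hST, Matrix.one_mulVec]
    have h4 : S₂ *ᵥ (T₂ *ᵥ b) ∈ U := by
      rw [← eq_sub_iff_add_eq'] at h3
      rw [h3]
      exact U.sub_mem (by simpa using hmemU 1) (hU _)
    rwa [Submodule.disjoint_def.1 hdisj _ h4 (hW _), add_zero] at h3
  have hmin : minpoly ℝ A₁ = α := by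
    refine Polynomial.eq_of_monic_of_associated (hint A₁) hαm
      (associated_of_dvd_dvd (hkill e11 h₁) (hb _ ?_))
    rw [← hbU, Matrix.mulVec_mulVec, aeval_similar h₁, minpoly.aeval, Matrix.mul_zero,
      Matrix.zero_mulVec]
  have h5 : Fintype.card (Fin n) = Fintype.card (Fin s ⊕ Fin u) :=
    Matrix.square_of_invertible _ _ hST hTS
  simp only [Fintype.card_fin, Fintype.card_sum] at h5
  refine ⟨s, u, A₁, A₂, S₁, S₂, T₁, T₂, hST, hTS, h₁, h₂, by omega, h5.symm, ?_, hmin,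
    hkill e22 h₂⟩
  rw [IsCyclicMatrix, hmin, Fintype.card_fin, hs, hUfin]

theorem nonempty_cyclicDecomposition : ∀ (n : ℕ) (A : Matrix (Fin n) (Fin n) ℝ),
    Nonempty (CyclicDecomposition A) := by
  intro n
  induction n using Nat.strong_induction_on with
  | _ n ih =>
  intro A
  rcases Nat.eq_zero_or_pos n with rfl | hn
  · exact ⟨{
      k := 0
      dim := Fin.elim0
      dim_pos := fun i => i.elim0
      block := fun i => i.elim0
      S := 0
      Sinv := 0
      S_mul_Sinv := Subsingleton.elim _ _
      Sinv_mul_S := Subsingleton.elim _ _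
      conj_eq := Subsingleton.elim _ _
      cyclic := fun i => i.elim0
      minpoly_first := fun h => absurd h (lt_irrefl 0)
      minpoly_dvd := fun i h => absurd h (Nat.not_lt_zero _) }⟩
  · have : NeZero n := ⟨hn.ne'⟩
    obtain ⟨s, u, A₁, A₂, S₁, S₂, T₁, T₂, hST, hTS, h₁, h₂, hs, hsu, hcyc, hmin, hdvd⟩ :=
      exists_cyclic_splitting A
    obtain ⟨D⟩ := ih u (by omega) A₂
    let dim : Fin (D.k + 1) → ℕ := Fin.cons s D.dim
    let block : ∀ i, Matrix (Fin (dim i)) (Fin (dim i)) ℝ :=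
      Fin.cons (α := fun i => Matrix (Fin (dim i)) (Fin (dim i)) ℝ) A₁ D.block
    let V : Matrix (Fin n) (Fin s ⊕ Σ i, Fin (D.dim i)) ℝ := fromCols S₁ (S₂ * D.S)
    let V' : Matrix (Fin s ⊕ Σ i, Fin (D.dim i)) (Fin n) ℝ := fromRows T₁ (D.Sinv * T₂)
    let e : Fin s ⊕ (Σ i, Fin (D.dim i)) ≃ Σ i, Fin (dim i) := sigmaFinSucc dim
    have hD : A₂ * D.S = D.S * blockDiagonal' D.block := by
      rw [← D.conj_eq, ← Matrix.mul_assoc, ← Matrix.mul_assoc, D.S_mul_Sinv, Matrix.one_mul]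
    have hVV' : V * V' = 1 := by
      rw [fromCols_mul_fromRows, Matrix.mul_assoc, ← Matrix.mul_assoc D.S, D.S_mul_Sinv,
        Matrix.one_mul, ← fromCols_mul_fromRows, hST]
    have hV'V : V' * V = 1 := by
      have hTS' := hTS
      rw [fromRows_mul_fromCols, ← fromBlocks_one, fromBlocks_inj] at hTS'
      obtain ⟨e11, e12, e21, e22⟩ := hTS'
      rw [fromRows_mul_fromCols, ← fromBlocks_one, fromBlocks_inj]
      refine ⟨e11, by rw [← Matrix.mul_assoc, e12, Matrix.zero_mul],
        by rw [Matrix.mul_assoc, e21, Matrix.mul_zero], ?_⟩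
      rw [Matrix.mul_assoc, ← Matrix.mul_assoc T₂, e22, Matrix.one_mul, D.Sinv_mul_S]
    have hAV : A * V = V * fromBlocks A₁ 0 0 (blockDiagonal' D.block) :=
      mul_fromCols_eq h₁ (by rw [← Matrix.mul_assoc, h₂, Matrix.mul_assoc, hD, Matrix.mul_assoc])
    have hblock : (blockDiagonal' block).submatrix e e =
        fromBlocks A₁ 0 0 (blockDiagonal' D.block) :=
      blockDiagonal_submatrix_sigmaFinSucc block
    exact ⟨{
      k := D.k + 1
      dim := dim
      dim_pos := Fin.cases hs D.dim_pos
      block := block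
      S := V.submatrix id e.symm
      Sinv := V'.submatrix e.symm id
      S_mul_Sinv := by rw [Matrix.submatrix_mul_equiv, hVV', Matrix.submatrix_id_id]
      Sinv_mul_S := by
        rw [← Matrix.submatrix_mul _ _ _ _ _ Function.bijective_id, hV'V,
          Matrix.submatrix_one_equiv]
      conj_eq := by
        have h3 : V' * A * V = fromBlocks A₁ 0 0 (blockDiagonal' D.block) := by
          rw [Matrix.mul_assoc, hAV, ← Matrix.mul_assoc, hV'V, Matrix.one_mul]
        rw [← Matrix.submatrix_id_id A, ← Matrix.submatrix_mul _ _ _ _ _ Function.bijective_id,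
          ← Matrix.submatrix_mul _ _ _ _ _ Function.bijective_id, h3, ← hblock,
          Matrix.submatrix_submatrix]
        simp
      cyclic := Fin.cases hcyc D.cyclic
      minpoly_first := fun _ => hmin
      minpoly_dvd := by
        intro i h
        rcases i with _ | i
        · have h4 := D.minpoly_first (by omega)
          change minpoly ℝ (D.block ⟨0, _⟩) ∣ minpoly ℝ A₁
          rw [h4, hmin]
          exact hdvd
        · exact D.minpoly_dvd i (by omega) }⟩

end Existence

/-! ### A Schur–Horn theorem by Givens rotations. -/

section SchurHorn

theorem exists_sq_convex_combination {a b x : ℝ} (ha : a ≤ x) (hb : x < b) :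
    ∃ p q : ℝ, p ^ 2 + q ^ 2 = 1 ∧ p ^ 2 * a + q ^ 2 * b = x := by
  have hab : 0 < b - a := by linarith
  refine ⟨√((b - x) / (b - a)), √((x - a) / (b - a)), ?_, ?_⟩ <;>
  rw [Real.sq_sqrt (div_nonneg (by linarith) hab.le), Real.sq_sqrt (div_nonneg (by linarith) hab.le)]
    <;> field_simp <;> ring

/-- A Givens rotation in the coordinates `a`, `a + 1` puts a diagonal matrix into bordered form. -/
theorem exists_givens {l : ℕ} (a : Fin l) {p q : ℝ} (hpq : p ^ 2 + q ^ 2 = 1) :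
    ∃ (r : Fin (l + 1) → ℝ) (f : Matrix (Fin l) (Fin (l + 1)) ℝ), r ⬝ᵥ r = 1 ∧ f *ᵥ r = 0 ∧
      f * fᵀ = 1 ∧ ∀ h : ℕ → ℝ, (∑ j, r j ^ 2 * h j = p ^ 2 * h a + q ^ 2 * h (a + 1)) ∧
      f * diagonal (fun j : Fin (l + 1) => h j) * fᵀ = diagonal fun b : Fin l =>
        if b < a then h b else if b = a then q ^ 2 * h a + p ^ 2 * h (a + 1) else h (b + 1) := by
  let u : Fin l → ℝ := fun b => if b = a then p else 0
  let w : Fin l → ℝ := fun b => if b = a then -q else 1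
  -- `r` is `(p, q)` in the coordinates `a`, `a + 1`. Row `a` of `f` is the orthogonal vector `(-q,
  -- p)`, and its other rows are the remaining coordinate vectors.
  let r : Fin (l + 1) → ℝ := a.succ.insertNth q (Pi.single a p : Fin l → ℝ)
  let f : Matrix (Fin l) (Fin (l + 1)) ℝ :=
    Matrix.of fun b => a.succ.insertNth (u b) (Pi.single b (w b) : Fin l → ℝ)
  have hf : ∀ h : Fin (l + 1) → ℝ, ∀ b b', (f * diagonal h * fᵀ) b b' =
      u b * u b' * h a.succ + if b = b' then w b ^ 2 * h (a.succ.succAbove b) else 0 := by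
    intro h b b'
    rw [Matrix.mul_apply, Fin.sum_univ_succAbove _ a.succ]
    simp only [Matrix.mul_diagonal, Matrix.transpose_apply, f, Matrix.of_apply,
      Fin.insertNth_apply_same, Fin.insertNth_apply_succAbove]
    congr 1
    · ring
    · rw [Finset.sum_eq_single b]
      · by_cases hb : b = b'
        · subst hb; simp; ring
        · simp [hb]
      · intro c _ hc; simp [hc]
      · simp
  have hσ : ∀ h : ℕ → ℝ, ∀ b, h (a.succ.succAbove b : Fin (l + 1)) =
      if b ≤ a then h b else h (b + 1) := by
    intro h b
    by_cases hb : b ≤ a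
    · rw [if_pos hb, Fin.succAbove_of_castSucc_lt _ _ (by simpa [Fin.lt_def, Nat.lt_succ_iff] using hb)]
      simp
    · rw [if_neg hb, Fin.succAbove_of_le_castSucc _ _
        (by rw [Fin.le_def]; simp; rw [not_le, Fin.lt_def] at hb; omega)]
      simp
  have hr : ∀ h : ℕ → ℝ, ∑ j : Fin (l + 1), r j ^ 2 * h j = p ^ 2 * h a + q ^ 2 * h (a + 1) := by
    intro h
    rw [Fin.sum_univ_succAbove _ a.succ]
    simp only [r, Fin.insertNth_apply_same, Fin.insertNth_apply_succAbove, Fin.val_succ]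
    rw [Finset.sum_eq_single a (fun c _ hc => by simp [hc]) (by simp), hσ h]
    simp; ring
  refine ⟨r, f, ?_, ?_, ?_, fun h => ⟨hr h, ?_⟩⟩
  · have := hr fun _ => 1
    simp only [mul_one] at this
    rw [← hpq, ← this, dotProduct]
    exact Finset.sum_congr rfl fun j _ => by ring
  · ext b
    rw [mulVec, dotProduct, Fin.sum_univ_succAbove _ a.succ]
    simp only [r, f, Matrix.of_apply, Fin.insertNth_apply_same, Fin.insertNth_apply_succAbove]
    rw [Finset.sum_eq_single a (fun c _ hc => by simp [hc]) (by simp)]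
    by_cases hb : b = a
    · subst hb; simp [u, w]; ring
    · simp [u, hb, Ne.symm hb]
  · have := hf fun _ => 1
    rw [show (diagonal fun _ : Fin (l + 1) => (1 : ℝ)) = 1 from diagonal_one, Matrix.mul_one] at this
    ext b b'
    rw [this, Matrix.one_apply]
    by_cases hb : b = b'
    · subst hb
      by_cases hba : b = a
      · simp [u, w, hba]; linarith
      · simp [u, w, hba]
    · by_cases hba : b = a
      · subst hba; simp [u, hb, Ne.symm hb]
      · simp [u, hb, hba]
  · ext b b'
    rw [hf, hσ h, Fin.val_succ, Matrix.diagonal_apply]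
    by_cases hb : b = b'
    · subst hb
      by_cases hba : b = a
      · subst hba; simp [u, w]; ring
      · by_cases hlt : b < a
        · simp [u, w, hba, hlt, hlt.le]
        · have : ¬ b ≤ a := fun h => hlt (lt_of_le_of_ne h hba)
          simp [u, w, hba, hlt, this]
    · by_cases hba : b = a
      · subst hba; simp [u, hb, Ne.symm hb]
      · simp [u, hb, hba]

/-- A form of the Schur–Horn theorem for weak majorization: an ascending list that is weakly
majorized by `c` from below is the spectrum of a matrix with diagonal at most `c`. -/
theorem exists_orthogonal_diag_le : ∀ (l : ℕ) (h : ℕ → ℝ) (_ : Monotone h) (c : Fin l → ℝ)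
    (_ : ∀ J : Finset (Fin l), ∑ i ∈ Finset.range J.card, h i ≤ ∑ i ∈ J, c i),
    ∃ Q : Matrix (Fin l) (Fin l) ℝ, Q * Qᵀ = 1 ∧
      ∀ i, (Q * diagonal (fun j : Fin l => h j) * Qᵀ) i i ≤ c i := by
  intro l
  induction l with
  | zero => exact fun h _ c _ => ⟨1, by simp, fun i => i.elim0⟩
  | succ l ih =>
    intro h hmono c hc
    -- The smallest bound is met first, with equality unless every entry of `h` already lies below
    -- it.
    obtain ⟨i₀, -, hi₀⟩ := Finset.exists_min_image Finset.univ c Finset.univ_nonempty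
    rcases le_or_gt (h l) (c i₀) with hl | hl
    · refine ⟨1, by simp, fun i => ?_⟩
      simp only [Matrix.one_mul, Matrix.transpose_one, Matrix.mul_one, diagonal_apply_eq]
      exact (hmono (by omega)).trans (hl.trans (hi₀ i (Finset.mem_univ i)))
    have hex : ∃ b, c i₀ < h b := ⟨l, hl⟩
    have h0 : h 0 ≤ c i₀ := by simpa using hc {i₀}
    classical
    have hb1 := Nat.find_spec hex
    have hb2 := Nat.find_min' hex hl
    have hb3 : Nat.find hex ≠ 0 := fun h => by rw [h] at hb1; linarith
    obtain ⟨a, ha⟩ := Nat.exists_eq_succ_of_ne_zero hb3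
    have hb4 : h a ≤ c i₀ := not_lt.1 (Nat.find_min hex (by omega))
    rw [ha] at hb1 hb2
    -- Here `h` crosses the bound, `h a ≤ c i₀ < h (a + 1)`, so a rotation in these two coordinates
    -- produces `c i₀` on the diagonal.
    obtain ⟨p, q, hpq, hx⟩ := exists_sq_convex_combination hb4 hb1
    obtain ⟨r, f, hrr, hfr, hff, hrf⟩ := exists_givens ⟨a, hb2⟩ hpq
    obtain ⟨hr, hf⟩ := hrf h
    -- Trace preservation replaces the pair by `h a + h (a + 1) - c i₀`, which lies between the two,
    -- so the list stays ascending.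
    let h' : ℕ → ℝ := fun b => if b < a then h b else
      if b = a then h a + h (a + 1) - c i₀ else h (b + 1)
    have hh' : f * diagonal (fun j : Fin (l + 1) => h j) * fᵀ = diagonal fun b : Fin l => h' b := by
      rw [hf]
      congr 1
      ext b
      simp only [h', Fin.lt_def, Fin.ext_iff]
      have : q ^ 2 * h a + p ^ 2 * h (a + 1) = h a + h (a + 1) - c i₀ := by
        rw [← hx]; linear_combination (h a + h (a + 1)) * hpq
      rw [this]
    have hsum1 : ∀ j ≤ a, ∑ i ∈ Finset.range j, h' i = ∑ i ∈ Finset.range j, h i := by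
      intro j hj
      refine Finset.sum_congr rfl fun i hi => ?_
      rw [Finset.mem_range] at hi
      simp only [h', if_pos (lt_of_lt_of_le hi hj)]
    have hsum2 : ∀ j, a < j → ∑ i ∈ Finset.range j, h' i =
        ∑ i ∈ Finset.range (j + 1), h i - c i₀ := by
      intro j hj
      induction j, hj using Nat.le_induction with
      | base =>
        rw [Finset.sum_range_succ, hsum1 a le_rfl, Finset.sum_range_succ, Finset.sum_range_succ]
        simp only [h', lt_irrefl, if_false, if_true]
        ring
      | succ j hj ihj =>
        have h1 : ¬ j < a := by omega
        have h2 : j ≠ a := by omega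
        rw [Finset.sum_range_succ, ihj, Finset.sum_range_succ _ (j + 1)]
        simp only [h', h1, h2, if_false]
        ring
    have hmono' : Monotone h' := by
      refine monotone_nat_of_le_succ fun b => ?_
      simp only [h']
      have e1 := hmono (Nat.le_succ b)
      have e2 := hmono (Nat.le_succ (b + 1))
      simp only [Nat.succ_eq_add_one] at e1 e2 hb1
      rcases lt_trichotomy b a with hb | rfl | hb
      · rw [if_pos hb]
        rcases eq_or_ne (b + 1) a with he | he
        · rw [if_neg (by omega), if_pos he]
          rw [he] at e1
          linarith
        · rw [if_pos (by omega)]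
          exact e1
      · rw [if_neg (lt_irrefl b), if_pos rfl, if_neg (by omega), if_neg (by omega)]
        linarith
      · rw [if_neg (by omega), if_neg (by omega), if_neg (by omega), if_neg (by omega)]
        exact e2
    obtain ⟨Q, hQ, hQc⟩ := ih h' hmono' (fun i => c (i₀.succAbove i)) (by
      intro J
      have hJ1 : ∑ i ∈ J, c (i₀.succAbove i) = ∑ i ∈ J.map i₀.succAboveEmb, c i := by
        simp
      -- Up to length `a` the partial sums are unchanged. Beyond it they drop by `c i₀`, which is
      -- compensated by testing the hypothesis on `J` with `i₀` added.
      rcases le_or_gt J.card a with hJ | hJ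
      · rw [hsum1 _ hJ, hJ1]
        simpa using hc (J.map i₀.succAboveEmb)
      · rw [hsum2 _ hJ, hJ1]
        have hni : i₀ ∉ J.map i₀.succAboveEmb := by simp [Fin.succAbove_ne]
        have := hc (insert i₀ (J.map i₀.succAboveEmb))
        rw [Finset.card_insert_of_notMem hni, Finset.sum_insert hni, Finset.card_map] at this
        linarith)
    let Q' : Matrix (Fin (l + 1)) (Fin (l + 1)) ℝ := 
      Matrix.of (Fin.insertNth (α := fun _ => Fin (l + 1) → ℝ) i₀ r (Q * f))
    have hrow : ∀ i, Q'.row (i₀.succAbove i) = (Q * f).row i := by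
      exact fun i => Fin.insertNth_apply_succAbove (α := fun _ => Fin (l + 1) → ℝ) i₀ r (Q * f) i
    have hrow₀ : Q'.row i₀ = r :=
      Fin.insertNth_apply_same (α := fun _ => Fin (l + 1) → ℝ) i₀ r (Q * f)
    have hent : ∀ (D : Matrix (Fin (l + 1)) (Fin (l + 1)) ℝ) i j, (Q' * D * Q'ᵀ) i j =
        Q'.row i ⬝ᵥ (D *ᵥ Q'.row j) := by
      intro D i j
      rw [Matrix.mul_assoc]
      rfl
    have hent' : ∀ (D : Matrix (Fin (l + 1)) (Fin (l + 1)) ℝ) i j,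
        (Q' * D * Q'ᵀ) (i₀.succAbove i) (i₀.succAbove j) = (Q * (f * D * fᵀ) * Qᵀ) i j := by
      intro D i j
      rw [hent, hrow, hrow]
      have : Q * (f * D * fᵀ) * Qᵀ = (Q * f) * (D * (Q * f)ᵀ) := by
        simp only [Matrix.transpose_mul, Matrix.mul_assoc]
      rw [this]
      rfl
    have hfr' : (Q * f) *ᵥ r = 0 := by rw [← Matrix.mulVec_mulVec, hfr, Matrix.mulVec_zero]
    refine ⟨Q', ?_, fun i => ?_⟩
    · ext i j
      have h1 := hent 1 i j
      rw [Matrix.mul_one, Matrix.one_mulVec] at h1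
      have h2 : ∀ i, (Q * f).row i ⬝ᵥ r = 0 := fun i => congrFun hfr' i
      rcases Fin.eq_self_or_eq_succAbove i₀ i with hi | ⟨i, rfl⟩ <;>
        rcases Fin.eq_self_or_eq_succAbove i₀ j with hj | ⟨j, rfl⟩
      · rw [h1, hi, hj, hrow₀, hrr, Matrix.one_apply_eq]
      · rw [h1, hi, hrow₀, hrow, dotProduct_comm, h2, Matrix.one_apply_ne (Fin.succAbove_ne _ _).symm]
      · rw [h1, hj, hrow₀, hrow, h2, Matrix.one_apply_ne (Fin.succAbove_ne _ _)]
      · have h3 := hent' 1 i j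
        rw [Matrix.mul_one, Matrix.mul_one, hff, Matrix.mul_one, hQ] at h3
        rw [h3, Matrix.one_apply, Matrix.one_apply]
        simp
    · rcases Fin.eq_self_or_eq_succAbove i₀ i with rfl | ⟨i, rfl⟩
      · rw [hent, hrow₀]
        have : r ⬝ᵥ (diagonal (fun j : Fin (l + 1) => h j) *ᵥ r) = ∑ j, r j ^ 2 * h j := by
          simp only [dotProduct, mulVec_diagonal]
          exact Finset.sum_congr rfl fun j _ => by ring
        rw [this, hr]
        exact hx.le
      · rw [hent', hh']
        exact hQc i

end SchurHorn

/-! ### Construction of the feedback, encoder and decoder. -/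

section Sufficiency

variable {n m l : ℕ} {A : Matrix (Fin n) (Fin n) ℝ} {B : Matrix (Fin n) (Fin m) ℝ}

/-- A Riccati certificate and an isometry distributing the input powers give a coder and a
stabilizing state feedback. -/
theorem InputRiccatiFeasible.stabilizableOverAWGN {h : Fin m → ℝ}
    (H : InputRiccatiFeasible A B h) {Q : Matrix (Fin l) (Fin m) ℝ} (hQ : Qᵀ * Q = 1)
    {P N : Fin l → ℝ} (hN : ∀ i, 0 < N i)
    (hP : ∀ i, N i * (Q * diagonal h * Qᵀ) i i < P i) : StabilizableOverAWGN A B P N := by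
  obtain ⟨G, G', hG, hG', X, hX, hXB, hR⟩ := H
  set b := B * G with hb
  have hXs : Xᵀ = X := by
    simpa [conjTranspose_eq_transpose_of_trivial] using hX.isHermitian.eq
  have hXu : IsUnit X.det := (Matrix.isUnit_iff_isUnit_det X).1 hX.isUnit
  have hXi : X⁻¹ * X = 1 := Matrix.nonsing_inv_mul _ hXu
  have hXi' : X * X⁻¹ = 1 := Matrix.mul_nonsing_inv _ hXu
  have hXis : X⁻¹ᵀ = X⁻¹ := by rw [Matrix.transpose_nonsing_inv, hXs]
  -- With this gain the cross terms of the closed-loop Lyapunov operator at `X` are `-2 b bᵀ`, so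
  -- `X` is a Lyapunov certificate with an excess of `b bᵀ` over the noise.
  let f : Matrix (Fin m) (Fin n) ℝ := -(bᵀ * X⁻¹)
  have hfX : f * X = -bᵀ := by simp [f, Matrix.mul_assoc, hXi]
  have hXf : X * fᵀ = -b := by
    have := congrArg Matrix.transpose hfX
    simpa [hXs] using this
  have hlyap : (A + b * f) * X + X * (A + b * f)ᵀ = A * X + X * Aᵀ - b * bᵀ - b * bᵀ := by
    rw [Matrix.transpose_add, Matrix.transpose_mul, Matrix.add_mul, Matrix.mul_add,
      Matrix.mul_assoc b, hfX, ← Matrix.mul_assoc X, hXf]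
    simp only [Matrix.mul_neg, Matrix.neg_mul]
    abel
  have hbb : (b * bᵀ).PosSemidef := by
    simpa [conjTranspose_eq_transpose_of_trivial] using posSemidef_self_mul_conjTranspose b
  have hM : IsHurwitz (A + b * f) := by
    refine isHurwitz_of_lyapunov hX ?_
    have : -((A + b * f) * X + X * (A + b * f)ᵀ) = b * bᵀ - (A * X + X * Aᵀ) + b * bᵀ := by
      rw [hlyap]; abel
    rw [this]
    exact hR.add_posSemidef hbb
  obtain ⟨Y, hYs, hY⟩ := exists_lyapunov (Q := b * bᵀ) hM (by simp)
  -- `X` dominates the actual Gramian `Y`, so the power is at most its value at `X`, namely an entry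
  -- built from `bᵀ X⁻¹ b ≤ diag h`.
  have hXY : (X - Y).PosSemidef := by
    refine posSemidef_of_lyapunov hM (by rw [Matrix.transpose_sub, hXs, hYs]) hR.posSemidef ?_
    rw [Matrix.mul_sub, Matrix.sub_mul]
    have : (A + b * f) * X - (A + b * f) * Y + (X * (A + b * f)ᵀ - Y * (A + b * f)ᵀ) +
        (b * bᵀ - (A * X + X * Aᵀ)) = ((A + b * f) * X + X * (A + b * f)ᵀ) -
        ((A + b * f) * Y + Y * (A + b * f)ᵀ + b * bᵀ) + b * bᵀ +
        (b * bᵀ - (A * X + X * Aᵀ)) := by abel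
    rw [this, hY, hlyap]
    abel
  -- Scaling by `√N` in the encoder and its inverse in the decoder makes the noise white of unit
  -- intensity; the isometry `Q` then leaves the injected noise `b bᵀ` unchanged.
  let E : Matrix (Fin l) (Fin l) ℝ := diagonal fun i => √(N i)
  let E' : Matrix (Fin l) (Fin l) ℝ := diagonal fun i => (√(N i))⁻¹
  have hs : ∀ i, √(N i) ≠ 0 := fun i => (Real.sqrt_pos.2 (hN i)).ne'
  have hE : E' * E = 1 := by
    simp [E, E', diagonal_mul_diagonal, hs]
  have hEN : E' * diagonal N * E' = 1 := by
    rw [diagonal_mul_diagonal, diagonal_mul_diagonal, ← diagonal_one]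
    congr 1
    ext i
    field_simp [hs i]
    rw [Real.sq_sqrt (hN i).le]
  have hEt : E'ᵀ = E' := diagonal_transpose _
  have hRT : G * Qᵀ * E' * (E * Q * G') = 1 := by
    calc G * Qᵀ * E' * (E * Q * G') = G * (Qᵀ * ((E' * E) * Q) * G') := by
          simp only [Matrix.mul_assoc]
      _ = 1 := by rw [hE, Matrix.one_mul, hQ, Matrix.one_mul, hG]
  have hTF : E * Q * G' * (G * f) = E * (Q * f) := by
    calc E * Q * G' * (G * f) = E * (Q * ((G' * G) * f)) := by simp only [Matrix.mul_assoc]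
      _ = _ := by rw [hG', Matrix.one_mul]
  have hcl : closedLoop A B (G * f) (E * Q * G') (G * Qᵀ * E') = A + b * f := by
    rw [closedLoop, Matrix.mul_assoc B, hRT, Matrix.mul_one, hb, Matrix.mul_assoc]
  have hBR : (B * (G * Qᵀ * E')) * diagonal N * (B * (G * Qᵀ * E'))ᵀ = b * bᵀ := by
    calc _ = b * (Qᵀ * ((E' * diagonal N * E') * Q)) * bᵀ := by
          simp only [hb, Matrix.transpose_mul, hEt, Matrix.transpose_transpose, Matrix.mul_assoc]
      _ = b * bᵀ := by rw [hEN, Matrix.one_mul, hQ, Matrix.mul_one]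
  refine ⟨G * f, E * Q * G', G * Qᵀ * E', hRT, by rwa [hcl], fun i => ?_⟩
  rw [inputPower_eq (by rwa [hcl]) hYs (by rw [hcl, hBR]; exact hY), hTF]
  refine lt_of_le_of_lt ?_ (hP i)
  have hconj : ∀ {ι : Type} [Fintype ι] {Z : Matrix ι ι ℝ} (_ : Z.PosSemidef)
      (K : Matrix (Fin l) ι ℝ), 0 ≤ (K * Z * Kᵀ) i i := by
    intro ι _ Z hZ K
    have := (hZ.mul_mul_conjTranspose_same K).diag_nonneg (i := i)
    rwa [conjTranspose_eq_transpose_of_trivial] at this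
  have h1 := hconj hXY (E * (Q * f))
  have h2 := hconj (posSemidef_sub_of_fromBlocks hX hXB) (E * Q)
  rw [Matrix.mul_sub, Matrix.sub_mul, Matrix.sub_apply, sub_nonneg] at h1 h2
  have h3 : E * (Q * f) * X * (E * (Q * f))ᵀ = E * Q * (bᵀ * X⁻¹ * b) * (E * Q)ᵀ := by
    calc _ = E * Q * ((f * X) * fᵀ) * (E * Q)ᵀ := by
          simp only [Matrix.transpose_mul, Matrix.mul_assoc]
      _ = _ := by
          rw [hfX]
          simp [f, hXis, Matrix.mul_assoc]
  have h4 : (E * Q * diagonal h * (E * Q)ᵀ) i i = N i * (Q * diagonal h * Qᵀ) i i := by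
    have : E * Q * diagonal h * (E * Q)ᵀ = E * (Q * diagonal h * Qᵀ) * E := by
      rw [Matrix.transpose_mul, show Eᵀ = E from diagonal_transpose _]
      simp only [Matrix.mul_assoc]
    rw [this, Matrix.mul_diagonal, Matrix.diagonal_mul, mul_right_comm,
      Real.mul_self_sqrt (hN i).le]
  rw [h3] at h1
  rw [h4] at h2
  exact h1.trans h2

theorem sum_filter_sub_card_le (e : ℕ → ℝ) {j : ℕ} (hj : j ≤ l) :
    ∑ i ∈ Finset.univ.filter (fun i : Fin l => l - j ≤ (i : ℕ)), e i =
      ∑ a ∈ Finset.range j, e (l - 1 - a) := by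
  refine Finset.sum_bij (fun i _ => l - 1 - (i : ℕ)) ?_ ?_ ?_ ?_
  · intro i hi
    simp only [Finset.mem_filter, Finset.mem_univ, true_and] at hi
    have := i.2
    simp only [Finset.mem_range]
    omega
  · intro i _ i' _ h
    have := i.2
    have := i'.2
    ext
    omega
  · intro a ha
    rw [Finset.mem_range] at ha
    exact ⟨⟨l - 1 - a, by omega⟩, by simp; omega, by simp; omega⟩
  · intro i _
    have := i.2
    congr 1
    omega

theorem CyclicDecomposition.stabilizableOverAWGN (D : CyclicDecomposition A)
    (hAB : IsStabilizable A B) (hml : m ≤ l) {P N : Fin l → ℝ} (hN : ∀ i, 0 < N i)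
    (hmaj : StrictWeakMajorizedAbove (capacity P N) (D.entropyVector l)) :
    StabilizableOverAWGN A B P N := by
  rw [strictWeakMajorizedAbove_iff (D.entropyVector_antitone l)] at hmaj
  -- An entry of the entropy vector depends only on its index, not on the length.
  let e : ℕ → ℝ := fun i => D.entropyVector (i + 1) (Fin.last i)
  have he : ∀ (r : ℕ) (i : Fin r), D.entropyVector r i = e i := fun r i => rfl
  have he0 : ∀ i, 0 ≤ e i := fun i => D.entropyVector_nonneg _ _
  have hanti : Antitone e := by
    intro i j hij
    exact D.entropyVector_antitone (j + 1) (a := ⟨i, by omega⟩) (b := Fin.last j) hij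
  -- Finitely many strict inequalities leave a common margin, spent both on the Riccati demands and
  -- on the power budgets.
  have hδ : ∃ δ : ℝ, 0 < δ ∧ ∀ J : Finset (Fin l),
      ∑ a ∈ Finset.range J.card, (2 * e (l - 1 - a) + δ) ≤ ∑ i ∈ J, (P i / N i - δ) := by
    have h1 : ∀ J : Finset (Fin l), ∀ᶠ δ : ℝ in nhdsWithin 0 (Set.Ioi 0),
        ∑ a ∈ Finset.range J.card, (2 * e (l - 1 - a) + δ) ≤ ∑ i ∈ J, (P i / N i - δ) := by
      intro J
      rcases J.eq_empty_or_nonempty with rfl | hJ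
      · simp
      have h2 := hmaj J hJ
      simp only [he] at h2
      rw [sum_filter_sub_card_le e (by simpa using J.card_le_univ)] at h2
      simp only [capacity, ← Finset.mul_sum] at h2
      have h3 : ∑ a ∈ Finset.range J.card, (2 * e (l - 1 - a) + 0) <
          ∑ i ∈ J, (P i / N i - 0) := by
        simp only [add_zero, sub_zero, ← Finset.mul_sum]
        linarith
      have hc1 : Continuous fun δ : ℝ => ∑ a ∈ Finset.range J.card, (2 * e (l - 1 - a) + δ) := by
        fun_prop
      have hc2 : Continuous fun δ : ℝ => ∑ i ∈ J, (P i / N i - δ) := by fun_prop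
      exact ((hc1.continuousAt.eventually_lt hc2.continuousAt h3).filter_mono
        nhdsWithin_le_nhds).mono fun δ h => h.le
    obtain ⟨δ, h2, h3⟩ := ((Filter.eventually_all.2 h1).and self_mem_nhdsWithin).exists
    exact ⟨δ, h3, h2⟩
  obtain ⟨δ, hδ0, hδ⟩ := hδ
  -- Reversal makes the demands ascending, as the Schur–Horn step requires.
  let h : ℕ → ℝ := fun a => 2 * e (l - 1 - a) + δ
  have hmono : Monotone h := by
    intro a b hab
    have := hanti (show l - 1 - b ≤ l - 1 - a by omega)
    simp only [h]
    linarith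
  have hh0 : ∀ a, 0 ≤ h a := fun a => by
    have := he0 (l - 1 - a)
    simp only [h]
    linarith
  obtain ⟨Q, hQ, hQh⟩ := exists_orthogonal_diag_le l h hmono (fun i => P i / N i - δ) hδ
  have hQ' : Qᵀ * Q = 1 := mul_eq_one_comm.1 hQ
  -- Only the columns of `Q` for the `m` largest demands, those of the first `m` blocks, are used.
  -- The omitted terms are nonnegative, so the diagonal bounds survive.
  let ρ : Fin m ↪ Fin l := ⟨fun j => ⟨l - 1 - j, by omega⟩, fun i j hij => by
    simp only [Fin.mk.injEq] at hij
    ext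
    omega⟩
  have hρ : ∀ j : Fin m, 2 * D.entropyVector m j + δ = h (ρ j) := by
    intro j
    have : l - 1 - (ρ j : ℕ) = j := by
      change l - 1 - (l - 1 - (j : ℕ)) = j
      omega
    simp only [h, he, this]
  refine (D.inputRiccatiFeasible hAB hδ0).stabilizableOverAWGN (Q := Q.submatrix id ρ) ?_ hN
    fun i => ?_
  · rw [Matrix.transpose_submatrix, ← Matrix.submatrix_mul _ _ _ _ _ Function.bijective_id, hQ']
    exact Matrix.submatrix_one_embedding ρ
  · have hsum : ∀ {r : ℕ} (K : Matrix (Fin l) (Fin r) ℝ) (g : Fin r → ℝ),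
        (K * diagonal g * Kᵀ) i i = ∑ a, K i a ^ 2 * g a := by
      intro r K g
      rw [Matrix.mul_apply]
      refine Finset.sum_congr rfl fun a _ => ?_
      rw [Matrix.mul_diagonal, Matrix.transpose_apply]
      ring
    have h1 := hQh i
    rw [hsum] at h1 ⊢
    have h2 : ∑ j, Q.submatrix id ρ i j ^ 2 * (2 * D.entropyVector m j + δ) ≤
        ∑ a : Fin l, Q i a ^ 2 * h a := by
      simp only [hρ, Matrix.submatrix_apply, id_eq]
      rw [← Finset.sum_map Finset.univ ρ (fun a : Fin l => Q i a ^ 2 * h a)]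
      exact Finset.sum_le_univ_sum_of_nonneg fun a => mul_nonneg (sq_nonneg _) (hh0 _)
    have h3 : ∑ j, Q.submatrix id ρ i j ^ 2 * (2 * D.entropyVector m j + δ) < P i / N i := by
      linarith
    rwa [lt_div_iff₀ (hN i), mul_comm] at h3

end Sufficiency

end NCS

theorem theorem1 (n m l : ℕ) (hml : m ≤ l)
    (A : Matrix (Fin n) (Fin n) ℝ) (B : Matrix (Fin n) (Fin m) ℝ)
    (hAB : NCS.IsStabilizable A B)
    (P N : Fin l → ℝ) (hP : ∀ i, 0 < P i) (hN : ∀ i, 0 < N i) :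
    Nonempty (NCS.CyclicDecomposition A) ∧
      ∀ D : NCS.CyclicDecomposition A,
        (NCS.StabilizableOverAWGN A B P N ↔
          NCS.StrictWeakMajorizedAbove (NCS.capacity P N) (D.entropyVector l)) := by
  refine ⟨NCS.nonempty_cyclicDecomposition n A, fun D => ⟨fun h => ?_, fun h => ?_⟩⟩
  · rw [NCS.strictWeakMajorizedAbove_iff (D.entropyVector_antitone l)]
    exact NCS.sum_entropyVector_lt_of_stabilizable hN D h
  · exact D.stabilizableOverAWGN hAB hml hN h
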